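/- Let $(X,\mathcal B,\mu)$ be a standard probability space. An automorphism of a probability space is an invertible, measurable in both directions, measure preserving transformation, considered up to null sets. A factor of an automorphism $T$ is its restriction to a $\sigma$-subalgebra $\mathcal F$ with $T\mathcal F=\mathcal F$. The factor is rigid if there is a sequence $n_k\to\infty$ such that the measure of $T^{n_k}B\,\Delta\,B$ tends to $0$ for every $B\in\mathcal F$, and trivial if every set in $\mathcal F$ has measure $0$ or $1$. The automorphism $T$ is mildly mixing if it has no nontrivial rigid factor. For an automorphism $S$ of $(X,\mu)$ let $\mathrm{Ext}(S)$ be the set of all automorphisms $R$ of $(X\times X,\mu\otimes\mu)$ of the form $R(x,y)=(Sx,R_xy)$, where $\{R_x\}$ is a measurable family of automorphisms of $(X,\mu)$. It carries the topology induced by the Halmos metric $$\rho(R,R')=\sum_i 2^{-i}\bigl((\mu\otimes\mu)(RA_i\,\Delta\,R'A_i)+(\mu\otimes\mu)(R^{-1}A_i\,\Delta\,R'^{-1}A_i)\bigr),$$ where $\{A_i\}$ is any fixed countable family of measurable sets that is dense in the $\sigma$-algebra of measurable subsets of $X\times X$ (with the distance $(\mu\otimes\mu)(A\,\Delta\,B)$).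 **Theorem.** Mild mixing is stable: if $S$ is a mildly mixing automorphism of $(X,\mu)$, then a generic extension of $S$ is mildly mixing. That is, the set of mildly mixing $R\in\mathrm{Ext}(S)$ contains a $G_\delta$ set that is dense in $\mathrm{Ext}(S)$. -/

import Mathlib

open MeasureTheory Filter Topology
open scoped symmDiff

/-- An automorphism of the measure space `(X, μ)`: an invertible bimeasurable map preserving `μ`.
Automorphisms that agree almost everywhere are not identified here; they are at distance `0` in
`halmosPseudoMetric`, so no open set and no `Gδ` set separates them. -/
structure MPAut {X : Type*} [MeasurableSpace X] (μ : Measure X) where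
  toEquiv : X ≃ᵐ X
  measurePreserving : MeasurePreserving toEquiv μ μ

instance {X : Type*} [MeasurableSpace X] (μ : Measure X) : CoeFun (MPAut μ) (fun _ => X → X) :=
  ⟨fun T => T.toEquiv⟩

section Halmos

variable {X : Type*} [MeasurableSpace X] {μ : Measure X}

/-- The `i`-th weighted term of the Halmos distance. -/
noncomputable def halmosTerm (A : ℕ → Set X) (S T : MPAut μ) (i : ℕ) : ℝ :=
  (1 / 2 : ℝ) ^ i * (μ.real ((S '' A i) ∆ (T '' A i)) +
    μ.real ((S.toEquiv.symm '' A i) ∆ (T.toEquiv.symm '' A i)))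

/-- The Halmos distance
`ρ(S, T) = ∑ᵢ 2⁻ⁱ (μ(S Aᵢ ∆ T Aᵢ) + μ(S⁻¹ Aᵢ ∆ T⁻¹ Aᵢ))` of the family `A`. -/
noncomputable def halmosDist (A : ℕ → Set X) (S T : MPAut μ) : ℝ :=
  ∑' i, halmosTerm A S T i

theorem halmosTerm_nonneg (A : ℕ → Set X) (S T : MPAut μ) (i : ℕ) : 0 ≤ halmosTerm A S T i := by
  unfold halmosTerm; positivity

theorem summable_halmosTerm [IsProbabilityMeasure μ] (A : ℕ → Set X) (S T : MPAut μ) :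
    Summable (halmosTerm A S T) := by
  refine Summable.of_nonneg_of_le (halmosTerm_nonneg A S T) (fun i => ?_)
    (summable_geometric_two.mul_right (2 : ℝ))
  unfold halmosTerm
  have h1 : μ.real ((S '' A i) ∆ (T '' A i)) ≤ 1 := measureReal_le_one
  have h2 : μ.real ((S.toEquiv.symm '' A i) ∆ (T.toEquiv.symm '' A i)) ≤ 1 := measureReal_le_one
  gcongr
  linarith

theorem halmosTerm_triangle [IsProbabilityMeasure μ] (A : ℕ → Set X) (R S T : MPAut μ) (i : ℕ) :
    halmosTerm A R T i ≤ halmosTerm A R S i + halmosTerm A S T i := by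
  unfold halmosTerm
  have h (s t u : Set X) : μ.real (s ∆ u) ≤ μ.real (s ∆ t) + μ.real (t ∆ u) :=
    (measureReal_mono (symmDiff_triangle s t u)).trans (measureReal_union_le _ _)
  rw [← mul_add]
  refine mul_le_mul_of_nonneg_left ?_ (by positivity)
  linarith [h (R '' A i) (S '' A i) (T '' A i),
    h (R.toEquiv.symm '' A i) (S.toEquiv.symm '' A i) (T.toEquiv.symm '' A i)]

/-- The Halmos distance as a pseudometric on automorphisms. -/
@[reducible] noncomputable def halmosPseudoMetric (μ : Measure X) [IsProbabilityMeasure μ]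
    (A : ℕ → Set X) : PseudoMetricSpace (MPAut μ) where
  dist := halmosDist A
  dist_self S := by simp [halmosDist, halmosTerm]
  dist_comm S T := by simp [halmosDist, halmosTerm, symmDiff_comm]
  dist_triangle R S T := by
    unfold halmosDist
    rw [← (summable_halmosTerm A R S).tsum_add (summable_halmosTerm A S T)]
    exact (summable_halmosTerm A R T).tsum_le_tsum (halmosTerm_triangle A R S T)
      ((summable_halmosTerm A R S).add (summable_halmosTerm A S T))

end Halmos

section Mixing

/-- A factor of `T`, given as a `σ`-subalgebra `m` that is invariant under `T` and `T⁻¹`. -/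
structure IsFactor {X : Type*} (m : MeasurableSpace X) {mX : MeasurableSpace X} {μ : Measure X}
    (T : MPAut μ) : Prop where
  le : m ≤ mX
  invariant : ∀ B : Set X, MeasurableSet[m] (T ⁻¹' B) ↔ MeasurableSet[m] B

/-- The action of `T` on the `σ`-subalgebra `m` is rigid: `T ^ (n k) → I` for some sequence
`n k → ∞`. -/
def IsRigidOn {X : Type*} (m : MeasurableSpace X) {mX : MeasurableSpace X} {μ : Measure X}
    (T : MPAut μ) : Prop :=
  ∃ n : ℕ → ℕ, Tendsto n atTop atTop ∧ ∀ B : Set X, MeasurableSet[m] B →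
    Tendsto (fun k => μ.real (((T : X → X)^[n k] '' B) ∆ B)) atTop (𝓝 0)

/-- The `σ`-subalgebra `m` is trivial: it consists of null and conull sets. -/
def IsTrivialFactor {X : Type*} (m : MeasurableSpace X) {mX : MeasurableSpace X}
    (μ : Measure X) : Prop :=
  ∀ B : Set X, MeasurableSet[m] B → μ B = 0 ∨ μ Bᶜ = 0

/-- Mild mixing: there is no nontrivial rigid factor. -/
def IsMildlyMixing {X : Type*} {mX : MeasurableSpace X} {μ : Measure X} (T : MPAut μ) : Prop :=
  ∀ m : MeasurableSpace X, IsFactor m T → IsRigidOn m T → IsTrivialFactor m μ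

end Mixing

section Extensions

variable {X : Type*} [MeasurableSpace X] {μ : Measure X}

/-- The extensions `Ext(S)` of `S`: the automorphisms of `(X × X, μ ⊗ μ)` that are skew products
`R (x, y) = (S x, R_x y)` over `S` (almost everywhere, automorphisms being considered mod `0`). -/
def ExtensionsOf (S : MPAut μ) : Set (MPAut (μ.prod μ)) :=
  {R | ∀ᵐ z ∂(μ.prod μ), (R z).1 = S z.1}

/-- The generic extension of `S` has the property `P`: there is a `Gδ` set, dense in `Ext(S)` for
the topology of the Halmos distance of the family `A` of subsets of `X × X`, all of whose members
have the property `P`. -/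
def IsGenericExtProperty [IsProbabilityMeasure μ] (A : ℕ → Set (X × X)) (S : MPAut μ)
    (P : MPAut (μ.prod μ) → Prop) : Prop :=
  letI : PseudoMetricSpace (MPAut (μ.prod μ)) := halmosPseudoMetric (μ.prod μ) A
  ∃ W : Set (ExtensionsOf S), IsGδ W ∧ Dense W ∧ ∀ R ∈ W, P R.1

end Extensions

/-! Let `m` be a rigid factor of an extension `R` of the mildly mixing `S`. For `B` in `m` the fibre
measure g(x) = μ(B_x) satisfies ‖g ∘ Sⁿ - g‖₁ ≤ (μ ⊗ μ)(RⁿB ∆ B), so g is rigid for `S` and hence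
constant: `m` is independent of the base (`IsMildlyMixing.indep_of_isRigidOn`). It therefore
suffices that a generic extension has no nontrivial factor independent of the base.

This is made quantitative by `condExpVar`, the variance of E(1_C | m). If `m` is a factor of `R`,
the variance does not change when 1_C is replaced by 1_C ∘ Rⁱ, so it equals its average over i < N.
If `R` is close to `Q`, then Rⁱ may be replaced by Qⁱ for these finitely many i at a small cost.
Thus a bound on the averages along `Q` that is uniform in all σ-algebras `m` independent of the
base, not only in factors of `Q`, controls a whole neighbourhood of `Q`. Such a bound is what
`IsTame` provides, and countably many of these open conditions cut out the Gδ set. It is dense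
because the conjugates of any single skew product over `S` by fibre-preserving automorphisms are
dense (`exists_conjugate_halmosDist_lt`), so one tame extension R₀ is enough.

R₀ is the group extension given by a cocycle into (ℤ/2)^ℕ none of whose nontrivial characters is a
coboundary up to sign (`exists_cocycle`). For f = a(x) χ(y) with χ a character, f ∘ R₀ⁱ = uᵢ(x)
χ(y), where uᵢ = Wⁱa and W is a Koopman operator weighted by ±1. The relatively independent
self-joining over `m` projects to μ ⊗ μ by independence, which bounds ∑ ∫ E(f ∘ R₀ⁱ ∘ Ψ | m)² by ∫
|∑ uᵢ(x) uᵢ(x')|, free of `m` and Ψ (`sum_integral_condExp_sq_le`). By the mean ergodic theorem for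
W ⊗ W the averages of uᵢ ⊗ uᵢ converge; the limit is the kernel of a compact operator commuting with
W, whose range consists of rigid vectors. A nonzero rigid vector would make the weight a
quasi-coboundary (`weightedKoopman_eq_zero_of_rigid`), so the limit is 0. -/

/-! ### Rigid sets and rigid functions of a mildly mixing automorphism. -/

section Rigidity

variable {X : Type*} {mX : MeasurableSpace X} {μ : Measure X}

theorem MeasureTheory.MeasurePreserving.measureReal_symmDiff_preimage {f : X → X}
    (hf : MeasurePreserving f μ μ) {A B : Set X} (hA : MeasurableSet A) (hB : MeasurableSet B) :
    μ.real ((f ⁻¹' A) ∆ (f ⁻¹' B)) = μ.real (A ∆ B) := by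
  rw [← Set.preimage_symmDiff, measureReal_def, hf.measure_preimage
    (hA.symmDiff hB).nullMeasurableSet, ← measureReal_def]

theorem MPAut.measurePreserving_iterate (T : MPAut μ) (n : ℕ) :
    MeasurePreserving ((T : X → X)^[n]) μ μ := T.measurePreserving.iterate n

theorem MPAut.iterate_image_symmDiff (T : MPAut μ) (n : ℕ) {B : Set X} (hB : MeasurableSet B) :
    μ.real (((T : X → X)^[n] '' B) ∆ B) = μ.real (((T : X → X)^[n] ⁻¹' B) ∆ B) := by
  have hinj : Function.Injective ((T : X → X)^[n]) := T.toEquiv.injective.iterate n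
  have hsurj : Function.Surjective ((T : X → X)^[n]) := T.toEquiv.surjective.iterate n
  have himg : MeasurableSet ((T : X → X)^[n] '' B) := by
    clear hinj hsurj
    induction n with
    | zero => simpa
    | succ n ih =>
      rw [Function.iterate_succ', Set.image_comp]
      exact T.toEquiv.measurableEmbedding.measurableSet_image.2 ih
  rw [← (T.measurePreserving_iterate n).measureReal_symmDiff_preimage himg hB,
    Set.preimage_image_eq _ hinj, symmDiff_comm]

variable [IsProbabilityMeasure μ]

theorem measureReal_symmDiff_triangle (s t u : Set X) :
    μ.real (s ∆ u) ≤ μ.real (s ∆ t) + μ.real (t ∆ u) :=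
  (measureReal_mono (symmDiff_triangle s t u)).trans (measureReal_union_le _ _)

/-- The error is 2 μ(A ∆ B) whatever `f` is; this uniformity lets rigidity pass to limits of sets.
-/
theorem MeasureTheory.MeasurePreserving.measureReal_preimage_symmDiff_le {f : X → X}
    (hf : MeasurePreserving f μ μ) {A B : Set X} (hA : MeasurableSet A) (hB : MeasurableSet B) :
    μ.real ((f ⁻¹' A) ∆ A) ≤ μ.real ((f ⁻¹' B) ∆ B) + 2 * μ.real (A ∆ B) := by
  have h1 := measureReal_symmDiff_triangle (μ := μ) (f ⁻¹' A) (f ⁻¹' B) A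
  have h2 := measureReal_symmDiff_triangle (μ := μ) (f ⁻¹' B) B A
  rw [hf.measureReal_symmDiff_preimage hA hB] at h1
  rw [symmDiff_comm B A] at h2
  linarith

theorem preimage_union_symmDiff_subset {f : X → X} (A B : Set X) :
    (f ⁻¹' (A ∪ B)) ∆ (A ∪ B) ⊆ ((f ⁻¹' A) ∆ A) ∪ ((f ⁻¹' B) ∆ B) := by
  intro x
  simp only [Set.mem_symmDiff, Set.mem_preimage, Set.mem_union]
  tauto

/-- The maximal `σ`-algebra on which the measure preserving maps `f k` tend to the identity. -/
@[reducible] def rigidSets (f : ℕ → X → X) (hf : ∀ k, MeasurePreserving (f k) μ μ) :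
    MeasurableSpace X where
  MeasurableSet' B := MeasurableSet B ∧
    Tendsto (fun k => μ.real ((f k ⁻¹' B) ∆ B)) atTop (𝓝 0)
  measurableSet_empty := by simp
  measurableSet_compl B hB := by
    refine ⟨hB.1.compl, ?_⟩
    simpa only [Set.preimage_compl, compl_symmDiff_compl] using hB.2
  measurableSet_iUnion B hB := by
    have hm : MeasurableSet (⋃ i, B i) := .iUnion fun i => (hB i).1
    have hacc : ∀ N, MeasurableSet (Set.accumulate B N) ∧
        Tendsto (fun k => μ.real ((f k ⁻¹' (Set.accumulate B N)) ∆ (Set.accumulate B N)))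
          atTop (𝓝 0) := by
      intro N
      induction N with
      | zero => simpa using hB 0
      | succ N ih =>
        rw [Set.accumulate_succ]
        refine ⟨ih.1.union (hB _).1, ?_⟩
        refine squeeze_zero (fun _ => measureReal_nonneg) (fun k => ?_)
          (by simpa using ih.2.add (hB (N + 1)).2)
        exact (measureReal_mono (preimage_union_symmDiff_subset _ _)).trans
          (measureReal_union_le _ _)
    have hlim : Tendsto (fun N => μ.real ((⋃ i, B i) ∆ Set.accumulate B N)) atTop (𝓝 0) := by
      have h1 : Tendsto (fun N => μ.real (Set.accumulate B N)) atTop (𝓝 (μ.real (⋃ i, B i))) :=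
        (ENNReal.tendsto_toReal (measure_ne_top _ _)).comp tendsto_measure_iUnion_accumulate
      have h2 : ∀ N, μ.real ((⋃ i, B i) ∆ Set.accumulate B N) =
          μ.real (⋃ i, B i) - μ.real (Set.accumulate B N) := by
        intro N
        have hsub : Set.accumulate B N ⊆ ⋃ i, B i := Set.accumulate_subset_iUnion N
        rw [← measureReal_sdiff hsub (hacc N).1, Set.symmDiff_def, Set.sdiff_eq_empty.2 hsub,
          Set.union_empty]
      simpa [h2] using (tendsto_const_nhds (x := μ.real (⋃ i, B i))).sub h1
    refine ⟨hm, ?_⟩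
    rw [Metric.tendsto_atTop]
    intro ε hε
    -- Passing from the union to the `N`-th partial union costs twice their distance: 2 · ε/4 + ε/2
    -- = ε.
    obtain ⟨N, hN⟩ := ((tendsto_order.1 hlim).2 (ε / 4) (by positivity)).exists
    obtain ⟨K, hK⟩ := eventually_atTop.1 ((tendsto_order.1 (hacc N).2).2 (ε / 2) (by positivity))
    refine ⟨K, fun k hk => ?_⟩
    rw [Real.dist_eq, sub_zero, abs_of_nonneg measureReal_nonneg]
    have := (hf k).measureReal_preimage_symmDiff_le hm (hacc N).1
    have := hK k hk
    linarith

/-- A mildly mixing automorphism has no nontrivial rigid sets. -/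
theorem IsMildlyMixing.trivial_of_rigid {T : MPAut μ} (hT : IsMildlyMixing T) {n : ℕ → ℕ}
    (hn : Tendsto n atTop atTop) {B : Set X} (hB : MeasurableSet B)
    (h : Tendsto (fun k => μ.real (((T : X → X)^[n k] ⁻¹' B) ∆ B)) atTop (𝓝 0)) :
    μ B = 0 ∨ μ Bᶜ = 0 := by
  -- The sets rigid along `n` form a factor because `T` commutes with its powers, and this factor is
  -- rigid by construction.
  refine hT (rigidSets (fun k => (T : X → X)^[n k]) fun k => T.measurePreserving_iterate _)
    ⟨fun B hB => hB.1, fun C => ?_⟩ ⟨n, hn, fun C hC => ?_⟩ B ⟨hB, h⟩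
  · have h1 : MeasurableSet ((T : X → X) ⁻¹' C) ↔ MeasurableSet C :=
      T.toEquiv.measurableSet_preimage
    refine and_congr_right_iff.2 (fun hm => ?_) |>.trans (and_congr_left' h1)
    refine iff_of_eq (congrArg (Tendsto · atTop (𝓝 0)) (funext fun k => ?_))
    rw [← T.measurePreserving.measureReal_symmDiff_preimage
      ((T.measurePreserving_iterate _).measurable (h1.1 hm)) (h1.1 hm), ← Set.preimage_comp,
      ← Set.preimage_comp, (Function.Commute.self_iterate (T : X → X) (n k)).comp_eq]
  · simpa only [T.iterate_image_symmDiff _ hC.1] using hC.2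

/-- A function that is rigid under a mildly mixing automorphism is constant. -/
theorem IsMildlyMixing.ae_const_of_rigid {T : MPAut μ} (hT : IsMildlyMixing T) {n : ℕ → ℕ}
    (hn : Tendsto n atTop atTop) {g : X → ℝ} (hg : Measurable g)
    (h : ∀ᵐ x ∂μ, Tendsto (fun k => g ((T : X → X)^[n k] x)) atTop (𝓝 (g x))) :
    ∃ c, g =ᵐ[μ] fun _ => c := by
  have hmp : ∀ k, MeasurePreserving ((T : X → X)^[n k]) μ μ :=
    fun k => T.measurePreserving_iterate _
  -- Off a null level set the indicator of {g < r} is locally constant in the value of g, so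
  -- pointwise convergence passes to it.
  have hgood : ∀ r, μ {x | g x = r} = 0 →
      MeasurableSet[rigidSets (fun k => (T : X → X)^[n k]) hmp] {x | g x < r} := by
    intro r hr
    have hms : MeasurableSet {x | g x < r} := hg measurableSet_Iio
    refine ⟨hms, ?_⟩
    have hr' : ∀ᵐ x ∂μ, g x ≠ r := by simpa [ae_iff] using hr
    have hmeas : ∀ k, MeasurableSet (((T : X → X)^[n k] ⁻¹' {x | g x < r}) ∆ {x | g x < r}) :=
      fun k => ((T.measurePreserving_iterate _).measurable hms).symmDiff hms
    have : Tendsto (fun k => ∫ x, (((T : X → X)^[n k] ⁻¹' {x | g x < r}) ∆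
        {x | g x < r}).indicator (fun _ => (1 : ℝ)) x ∂μ) atTop (𝓝 (∫ _, (0 : ℝ) ∂μ)) := by
      refine tendsto_integral_of_dominated_convergence (fun _ => 1)
        (fun k => (measurable_const.indicator (hmeas k)).aestronglyMeasurable)
        (integrable_const _) (fun k => ae_of_all _ fun x => ?_) ?_
      · exact (norm_indicator_le_norm_self _ _).trans (by simp)
      · filter_upwards [h, hr'] with x hx hxr
        refine tendsto_const_nhds.congr' ?_
        rcases lt_or_gt_of_ne hxr with hlt | hgt
        · filter_upwards [(tendsto_order.1 hx).2 r hlt] with k hk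
          simp [Set.mem_symmDiff, hk, hlt]
        · filter_upwards [(tendsto_order.1 hx).1 r hgt] with k hk
          simp [Set.mem_symmDiff, hk.le, hgt.le]
    simp only [integral_indicator_const _ (hmeas _)] at this
    simpa using this
  have hall : ∀ r,
      MeasurableSet[rigidSets (fun k => (T : X → X)^[n k]) hmp] {x | g x < r} := by
    intro r
    -- Only countably many level sets have positive measure, so every r is an increasing limit of
    -- good levels.
    have hdense : Dense {t : ℝ | 0 < μ {x | g x = t}}ᶜ :=
      (Measure.countable_meas_level_set_pos hg).dense_compl ℝ
    obtain ⟨u, -, hu, hlim⟩ := hdense.exists_seq_strictMono_tendsto r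
    have : {x | g x < r} = ⋃ k, {x | g x < u k} := by
      ext x
      simp only [Set.mem_ofPred_eq, Set.mem_iUnion]
      constructor
      · intro hx
        exact ((tendsto_order.1 hlim).1 _ hx).exists
      · rintro ⟨k, hk⟩
        exact hk.trans (hu k).1
    rw [this]
    exact MeasurableSet.iUnion fun k => hgood _ (by simpa using (hu k).2)
  have hgm : Measurable[rigidSets (fun k => (T : X → X)^[n k]) hmp] g :=
    
    measurable_of_Iio (mδ := rigidSets (fun k => (T : X → X)^[n k]) hmp) hall
  refine exists_eventuallyEq_const_of_forall_separating MeasurableSet fun U hU => ?_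
  have hU' := hgm hU
  rcases hT.trivial_of_rigid hn hU'.1 hU'.2 with h0 | h0
  · right; exact measure_eq_zero_iff_ae_notMem.1 h0
  · left; exact h0

/-- A function that is rigid in `L¹` under a mildly mixing automorphism is constant. -/
theorem IsMildlyMixing.ae_const_of_tendsto_integral {T : MPAut μ} (hT : IsMildlyMixing T)
    {n : ℕ → ℕ} (hn : Tendsto n atTop atTop) {g : X → ℝ} (hg : Measurable g)
    (h : Tendsto (fun k => ∫⁻ x, ‖g ((T : X → X)^[n k] x) - g x‖ₑ ∂μ) atTop (𝓝 0)) :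
    ∃ c, g =ᵐ[μ] fun _ => c := by
  have hmeas : ∀ k, Measurable fun x => g ((T : X → X)^[n k] x) :=
    fun k => hg.comp (T.measurePreserving_iterate _).measurable
  have h1 : TendstoInMeasure μ (fun k x => g ((T : X → X)^[n k] x)) atTop g := by
    refine tendstoInMeasure_of_tendsto_eLpNorm one_ne_zero
      (fun k => (hmeas k).aestronglyMeasurable) hg.aestronglyMeasurable ?_
    simpa [eLpNorm_one_eq_lintegral_enorm] using h
  obtain ⟨ns, hns, hlim⟩ := h1.exists_seq_tendsto_ae
  exact hT.ae_const_of_rigid (hn.comp hns.tendsto_atTop) hg hlim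

/-- An invariant set is rigid along every sequence. -/
theorem IsMildlyMixing.ergodic {T : MPAut μ} (hT : IsMildlyMixing T) :
    Ergodic (T : X → X) μ where
  toMeasurePreserving := T.measurePreserving
  aeconst_set s hs hinv := by
    have hk : ∀ k, ((T : X → X)^[k]) ⁻¹' s = s := by
      intro k
      induction k with
      | zero => rfl
      | succ k ih => rw [Function.iterate_succ', Set.preimage_comp, hinv, ih]
    rcases hT.trivial_of_rigid tendsto_id hs (by simp [hk]) with h | h
    · exact eventuallyConst_set'.2 (.inl (ae_eq_empty.2 h))
    · exact eventuallyConst_set'.2 (.inr (ae_eq_univ.2 h))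

end Rigidity

/-! ### Averages of rank one operators along an orbit of an isometry. -/

section RankOneAverages

open scoped InnerProductSpace

variable {H : Type*} [NormedAddCommGroup H] [InnerProductSpace ℝ H]

/-- The average of the rank one operators `b ↦ ⟪uᵢ, b⟫ uᵢ` for `i < N`. -/
noncomputable def rankOneAverage (u : ℕ → H) (N : ℕ) : H →L[ℝ] H :=
  (N : ℝ)⁻¹ • ∑ i ∈ Finset.range N, (innerSL ℝ (u i)).smulRight (u i)

theorem rankOneAverage_apply (u : ℕ → H) (N : ℕ) (b : H) :
    rankOneAverage u N b = (N : ℝ)⁻¹ • ∑ i ∈ Finset.range N, ⟪u i, b⟫_ℝ • u i := by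
  simp [rankOneAverage]

theorem isCompactOperator_rankOneAverage (u : ℕ → H) (N : ℕ) :
    IsCompactOperator (rankOneAverage u N) := by
  have h1 : ∀ v : H, IsCompactOperator ((innerSL ℝ v).smulRight v) := fun v =>
    (isCompactOperator_of_locallyCompactSpace_rng
      ((ContinuousLinearMap.toSpanSingleton ℝ v))).comp_clm (innerSL ℝ v)
  have h2 : ∀ s : Finset ℕ,
      IsCompactOperator (∑ i ∈ s, (innerSL ℝ (u i)).smulRight (u i) : H →L[ℝ] H) := by
    intro s
    induction s using Finset.cons_induction with
    | empty => simpa using isCompactOperator_zero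
    | cons i s his ih => rw [Finset.sum_cons]; exact (h1 (u i)).add ih
  exact (h2 _).smul _

variable [CompleteSpace H]

/-- If the averages of the rank one operators along an orbit of the isometry `W` are Cauchy
and `W` has no rigid vectors, then the averages tend to `0`. -/
theorem tendsto_rankOneAverage_zero (W : H →ₗᵢ[ℝ] H) (a : H)
    (hW : ∀ (n : ℕ → ℕ) (f : H), Tendsto n atTop atTop →
      Tendsto (fun k => W^[n k] f) atTop (𝓝 f) → f = 0)
    (hc : CauchySeq (rankOneAverage fun i => W^[i] a)) :
    Tendsto (rankOneAverage fun i => W^[i] a) atTop (𝓝 0) := by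
  obtain ⟨K, hK⟩ := cauchySeq_tendsto_of_complete hc
  -- Norm limits of finite rank operators are compact.
  have hcomp : IsCompactOperator K :=
    isCompactOperator_of_tendsto hK (.of_forall fun N => isCompactOperator_rankOneAverage _ N)
  have hiso : ∀ n (f : H), ‖W^[n] f‖ = ‖f‖ := by
    intro n f
    induction n with
    | zero => rfl
    | succ n ih => rw [Function.iterate_succ_apply', W.norm_map, ih]
  have hcomm : ∀ b, W (K b) = K (W b) := by
    intro b
    have hlim : ∀ b, Tendsto (fun N => rankOneAverage (fun i => W^[i] a) N b) atTop (𝓝 (K b)) :=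
      fun b => ((ContinuousLinearMap.apply ℝ H b).continuous.tendsto K).comp hK
    have h1 := ((W.continuous.tendsto _).comp (hlim b)).sub (hlim (W b))
    -- The commutator with `W` telescopes to two boundary terms, which the factor 1/N kills.
    have h2 : ∀ N, W (rankOneAverage (fun i => W^[i] a) N b) -
        rankOneAverage (fun i => W^[i] a) N (W b) =
        (N : ℝ)⁻¹ • (⟪W^[N] a, W b⟫_ℝ • W^[N] a - ⟪a, W b⟫_ℝ • a) := by
      intro N
      rw [rankOneAverage_apply, rankOneAverage_apply, map_smul, map_sum, ← smul_sub]
      congr 1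
      rw [← Finset.sum_sub_distrib]
      have := Finset.sum_range_sub (fun i => ⟪W^[i] a, W b⟫_ℝ • W^[i] a) N
      rw [Function.iterate_zero, id] at this
      rw [← this]
      refine Finset.sum_congr rfl fun i _ => ?_
      rw [map_smul, Function.iterate_succ_apply', W.inner_map_map]
    have h3 : Tendsto (fun N : ℕ => (N : ℝ)⁻¹ • (⟪W^[N] a, W b⟫_ℝ • W^[N] a - ⟪a, W b⟫_ℝ • a))
        atTop (𝓝 0) := by
      refine squeeze_zero_norm (a := fun N : ℕ => (N : ℝ)⁻¹ * (2 * (‖a‖ * ‖b‖ * ‖a‖)))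
        (fun N => ?_) ?_
      · rw [norm_smul, Real.norm_of_nonneg (by positivity)]
        refine mul_le_mul_of_nonneg_left ((norm_sub_le _ _).trans ?_) (by positivity)
        have h4 : ∀ v : H, ‖v‖ = ‖a‖ → ‖⟪v, W b⟫_ℝ • v‖ ≤ ‖a‖ * ‖b‖ * ‖a‖ := by
          intro v hv
          rw [norm_smul, ← hv]
          refine mul_le_mul_of_nonneg_right ?_ (norm_nonneg _)
          simpa using norm_inner_le_norm (𝕜 := ℝ) v (W b)
        have h5 := h4 _ (hiso N a)
        have h6 := h4 a rfl
        linarith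
      · simpa using tendsto_inv_atTop_nhds_zero_nat.mul_const (2 * (‖a‖ * ‖b‖ * ‖a‖))
    refine sub_eq_zero.1 (tendsto_nhds_unique h1 ?_)
    exact h3.congr fun N => (h2 N).symm
  have hcommn : ∀ n b, W^[n] (K b) = K (W^[n] b) := by
    intro n b
    induction n with
    | zero => rfl
    | succ n ih => rw [Function.iterate_succ_apply', ih, hcomm, ← Function.iterate_succ_apply' W]
  suffices K = 0 by rwa [this] at hK
  ext b
  set f := K b with hf
  -- The orbit of K b is the image under K of a bounded orbit, so it is relatively compact and must
  -- be recurrent.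
  obtain ⟨C, hC, hsub⟩ := hcomp.image_closedBall_subset_compact ‖b‖
  have hmem : ∀ n, W^[n] f ∈ C := fun n => by
    rw [hf, hcommn]
    exact hsub ⟨_, by simp [hiso], rfl⟩
  obtain ⟨y, -, φ, hφ, hlim⟩ := hC.tendsto_subseq hmem
  have hret : ∀ j : ℕ, ∃ n, j ≤ n ∧ ‖W^[n] f - f‖ < 1 / ((j : ℝ) + 1) := by
    intro j
    obtain ⟨k, hk⟩ := Metric.cauchySeq_iff.1 hlim.cauchySeq (1 / ((j : ℝ) + 1)) (by positivity)
    -- Two late terms of the convergent subsequence are close; cancelling the common power of the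
    -- isometry gives the return time φ k' - φ k, which this choice makes at least j.
    obtain ⟨k', hk', hkk'⟩ : ∃ k', k ≤ k' ∧ φ k + j ≤ φ k' :=
      ⟨max k (φ k + j), le_max_left _ _, (le_max_right _ _).trans hφ.le_apply⟩
    refine ⟨φ k' - φ k, by omega, ?_⟩
    have h1 := hk k' hk' k le_rfl
    rw [dist_eq_norm] at h1
    have h2 : W^[φ k'] f = W^[φ k] (W^[φ k' - φ k] f) := by
      rw [← Function.iterate_add_apply]; congr 2; omega
    have h3 : ∀ n (v w : H), W^[n] v - W^[n] w = W^[n] (v - w) := by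
      intro n
      induction n with
      | zero => intros; rfl
      | succ n ih =>
        intro v w
        rw [Function.iterate_succ_apply', Function.iterate_succ_apply',
          Function.iterate_succ_apply', ← map_sub, ih]
    simp only [Function.comp_apply] at h1
    rwa [h2, h3, hiso] at h1
  choose n hn hnlt using hret
  refine hW n f (tendsto_atTop_mono hn tendsto_id) ?_
  rw [tendsto_iff_norm_sub_tendsto_zero]
  exact squeeze_zero (fun _ => norm_nonneg _) (fun j => (hnlt j).le)
    tendsto_one_div_add_atTop_nhds_zero_nat

end RankOneAverages

/-! ### Koopman operators with weight ±1. -/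

section WeightedKoopman

open scoped InnerProductSpace

variable {Z : Type*} {mZ : MeasurableSpace Z} {ν : Measure Z} {T : Z → Z} {σ : Z → ℝ}

theorem eLpNorm_sign_mul_comp (hT : MeasurePreserving T ν ν) (hσ1 : ∀ z, |σ z| = 1) {f : Z → ℝ}
    (hf : AEStronglyMeasurable f ν) :
    eLpNorm (fun z => σ z * f (T z)) 2 ν = eLpNorm f 2 ν := by
  rw [← eLpNorm_comp_measurePreserving hf hT]
  refine eLpNorm_congr_norm_ae (ae_of_all _ fun z => ?_)
  simp [hσ1]

theorem MeasureTheory.MemLp.sign_mul_comp (hT : MeasurePreserving T ν ν) (hσ : Measurable σ)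
    (hσ1 : ∀ z, |σ z| = 1) {f : Z → ℝ} (hf : MemLp f 2 ν) :
    MemLp (fun z => σ z * f (T z)) 2 ν :=
  ⟨hσ.aestronglyMeasurable.mul (hf.1.comp_measurePreserving hT),
    by rw [eLpNorm_sign_mul_comp hT hσ1 hf.1]; exact hf.2⟩

/-- The weighted Koopman operator `f ↦ σ • f ∘ T` on `L²`, for a weight `σ = ±1`. -/
noncomputable def weightedKoopman (hT : MeasurePreserving T ν ν) (hσ : Measurable σ)
    (hσ1 : ∀ z, |σ z| = 1) : Lp ℝ 2 ν →ₗᵢ[ℝ] Lp ℝ 2 ν where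
  toFun f := ((Lp.memLp f).sign_mul_comp hT hσ hσ1).toLp _
  map_add' f g := by
    rw [← MemLp.toLp_add]
    refine MemLp.toLp_congr _ _ ?_
    filter_upwards [hT.quasiMeasurePreserving.ae_eq_comp (Lp.coeFn_add f g)] with z hz
    simp only [Function.comp_apply, Pi.add_apply] at hz ⊢
    rw [hz, mul_add]
  map_smul' c f := by
    rw [RingHom.id_apply, ← MemLp.toLp_const_smul]
    refine MemLp.toLp_congr _ _ ?_
    filter_upwards [hT.quasiMeasurePreserving.ae_eq_comp (Lp.coeFn_smul c f)] with z hz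
    simp only [Function.comp_apply, Pi.smul_apply, smul_eq_mul] at hz ⊢
    rw [hz]; ring
  norm_map' f := by
    simp only [LinearMap.coe_mk, AddHom.coe_mk]
    rw [Lp.norm_toLp, eLpNorm_sign_mul_comp hT hσ1 (Lp.aestronglyMeasurable f), Lp.norm_def]

theorem coeFn_weightedKoopman (hT : MeasurePreserving T ν ν) (hσ : Measurable σ)
    (hσ1 : ∀ z, |σ z| = 1) (f : Lp ℝ 2 ν) :
    weightedKoopman hT hσ hσ1 f =ᵐ[ν] fun z => σ z * f (T z) :=
  MemLp.coeFn_toLp ((Lp.memLp f).sign_mul_comp hT hσ hσ1)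

theorem coeFn_weightedKoopman_iterate (hT : MeasurePreserving T ν ν) (hσ : Measurable σ)
    (hσ1 : ∀ z, |σ z| = 1) (f : Lp ℝ 2 ν) (n : ℕ) :
    (weightedKoopman hT hσ hσ1)^[n] f =ᵐ[ν]
      fun z => (∏ j ∈ Finset.range n, σ (T^[j] z)) * f (T^[n] z) := by
  induction n with
  | zero => simp
  | succ n ih =>
    rw [Function.iterate_succ_apply']
    filter_upwards [coeFn_weightedKoopman hT hσ hσ1 ((weightedKoopman hT hσ hσ1)^[n] f),
      hT.quasiMeasurePreserving.ae_eq_comp ih] with z h1 h2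
    simp only [Function.comp_apply] at h2
    rw [h1, h2, Finset.prod_range_succ']
    simp only [Function.iterate_succ_apply, Function.iterate_zero, id]
    ring

end WeightedKoopman

/-! ### Tensor squares: from operator norm to Hilbert–Schmidt norm. -/

section Tensor

open scoped InnerProductSpace

variable {Z : Type*} {mZ : MeasurableSpace Z} {ν : Measure Z}

theorem MeasureTheory.MemLp.tensor {f g : Z → ℝ} (hf : MemLp f 2 ν) (hg : MemLp g 2 ν) :
    MemLp (fun p : Z × Z => f p.1 * g p.2) 2 (ν.prod ν) := by
  have hm : AEStronglyMeasurable (fun p : Z × Z => f p.1 * g p.2) (ν.prod ν) :=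
    hf.1.comp_fst.mul hg.1.comp_snd
  rw [memLp_two_iff_integrable_sq hm]
  simpa only [Pi.mul_apply, mul_pow] using hf.integrable_sq.mul_prod hg.integrable_sq

/-- The tensor product of two elements of `L²`. -/
noncomputable def tensorLp (f g : Lp ℝ 2 ν) : Lp ℝ 2 (ν.prod ν) :=
  ((Lp.memLp f).tensor (Lp.memLp g)).toLp _

theorem coeFn_tensorLp (f g : Lp ℝ 2 ν) :
    tensorLp f g =ᵐ[ν.prod ν] fun p => f p.1 * g p.2 := MemLp.coeFn_toLp _

variable [IsFiniteMeasure ν]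

theorem inner_tensorLp (f g f' g' : Lp ℝ 2 ν) :
    ⟪tensorLp f g, tensorLp f' g'⟫_ℝ = ⟪f, f'⟫_ℝ * ⟪g, g'⟫_ℝ := by
  rw [L2.inner_def, L2.inner_def, L2.inner_def, ← integral_prod_mul]
  refine integral_congr_ae ?_
  filter_upwards [coeFn_tensorLp f g, coeFn_tensorLp f' g'] with p h1 h2
  rw [h1, h2]
  simp only [RCLike.inner_apply, conj_trivial]
  ring

theorem norm_tensorLp (f g : Lp ℝ 2 ν) : ‖tensorLp f g‖ = ‖f‖ * ‖g‖ := by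
  have h := inner_tensorLp f g f g
  rw [real_inner_self_eq_norm_sq, real_inner_self_eq_norm_sq, real_inner_self_eq_norm_sq,
    ← mul_pow] at h
  exact (pow_left_inj₀ (norm_nonneg _) (by positivity) two_ne_zero).1 h

variable {T : Z → Z} {σ : Z → ℝ}

/-- W ⊗ W is again a weighted Koopman operator, now on the product space, so the mean ergodic
theorem applies to it. -/
theorem weightedKoopman_tensorLp (hT : MeasurePreserving T ν ν) (hσ : Measurable σ)
    (hσ1 : ∀ z, |σ z| = 1) (hσ2 : Measurable fun p : Z × Z => σ p.1 * σ p.2)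
    (hσ21 : ∀ p : Z × Z, |σ p.1 * σ p.2| = 1) (f g : Lp ℝ 2 ν) :
    weightedKoopman (hT.prod hT) hσ2 hσ21 (tensorLp f g) =
      tensorLp (weightedKoopman hT hσ hσ1 f) (weightedKoopman hT hσ hσ1 g) := by
  apply Lp.ext
  filter_upwards [coeFn_weightedKoopman (hT.prod hT) hσ2 hσ21 (tensorLp f g),
    (hT.prod hT).quasiMeasurePreserving.ae_eq_comp (coeFn_tensorLp f g),
    coeFn_tensorLp (weightedKoopman hT hσ hσ1 f) (weightedKoopman hT hσ hσ1 g),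
    Measure.quasiMeasurePreserving_fst.ae_eq_comp (coeFn_weightedKoopman hT hσ hσ1 f),
    Measure.quasiMeasurePreserving_snd.ae_eq_comp (coeFn_weightedKoopman hT hσ hσ1 g)]
    with p h1 h2 h3 h4 h5
  simp only [Function.comp_apply, Prod.map_fst, Prod.map_snd] at h2 h4 h5
  rw [h1, h2, h3, h4, h5]
  ring

theorem weightedKoopman_iterate_tensorLp (hT : MeasurePreserving T ν ν) (hσ : Measurable σ)
    (hσ1 : ∀ z, |σ z| = 1) (hσ2 : Measurable fun p : Z × Z => σ p.1 * σ p.2)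
    (hσ21 : ∀ p : Z × Z, |σ p.1 * σ p.2| = 1) (f : Lp ℝ 2 ν) (n : ℕ) :
    (weightedKoopman (hT.prod hT) hσ2 hσ21)^[n] (tensorLp f f) =
      tensorLp ((weightedKoopman hT hσ hσ1)^[n] f) ((weightedKoopman hT hσ hσ1)^[n] f) := by
  induction n with
  | zero => rfl
  | succ n ih =>
    rw [Function.iterate_succ_apply', ih, weightedKoopman_tensorLp hT hσ hσ1 hσ2 hσ21,
      Function.iterate_succ_apply']

/-- This identifies the averaged tensor as the integral kernel of `rankOneAverage u N`. -/
theorem inner_sum_tensorLp (u : ℕ → Lp ℝ 2 ν) (N : ℕ) (b c : Lp ℝ 2 ν) :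
    ⟪(N : ℝ)⁻¹ • ∑ i ∈ Finset.range N, tensorLp (u i) (u i), tensorLp b c⟫_ℝ =
      ⟪rankOneAverage u N b, c⟫_ℝ := by
  rw [rankOneAverage_apply, inner_smul_left, inner_smul_left, sum_inner, sum_inner]
  congr 1
  refine Finset.sum_congr rfl fun i _ => ?_
  rw [inner_tensorLp, inner_smul_left]
  simp

/-- If the weighted Koopman operator has no rigid vectors, then the averages of `uᵢ ⊗ uᵢ` along
each orbit `u` tend to `0`. -/
theorem tendsto_average_tensorLp (hT : MeasurePreserving T ν ν) (hσ : Measurable σ)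
    (hσ1 : ∀ z, |σ z| = 1)
    (hW : ∀ (n : ℕ → ℕ) (f : Lp ℝ 2 ν), Tendsto n atTop atTop →
      Tendsto (fun k => (weightedKoopman hT hσ hσ1)^[n k] f) atTop (𝓝 f) → f = 0)
    (a : Lp ℝ 2 ν) :
    Tendsto (fun N : ℕ => (N : ℝ)⁻¹ • ∑ i ∈ Finset.range N,
      tensorLp ((weightedKoopman hT hσ hσ1)^[i] a) ((weightedKoopman hT hσ hσ1)^[i] a))
      atTop (𝓝 0) := by
  have hσ2 : Measurable fun p : Z × Z => σ p.1 * σ p.2 := by fun_prop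
  have hσ21 : ∀ p : Z × Z, |σ p.1 * σ p.2| = 1 := fun p => by rw [abs_mul, hσ1, hσ1, one_mul]
  set W := weightedKoopman hT hσ hσ1 with hWdef
  set u : ℕ → Lp ℝ 2 ν := fun i => W^[i] a with hu
  set F : ℕ → Lp ℝ 2 (ν.prod ν) :=
    fun N => (N : ℝ)⁻¹ • ∑ i ∈ Finset.range N, tensorLp (u i) (u i) with hF
  have hFc : CauchySeq F := by
    set V := weightedKoopman (hT.prod hT) hσ2 hσ21
    have h1 := ContinuousLinearMap.tendsto_birkhoffAverage_orthogonalProjection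
      V.toContinuousLinearMap V.norm_toContinuousLinearMap_le (tensorLp a a)
    refine (h1.congr fun N => ?_).cauchySeq
    rw [birkhoffAverage, birkhoffSum, hF]
    congr 1
    refine Finset.sum_congr rfl fun i _ => ?_
    exact weightedKoopman_iterate_tensorLp hT hσ hσ1 hσ2 hσ21 a i
  -- The operator norm is at most the Hilbert–Schmidt norm: the difference of kernels is tested
  -- against b ⊗ c with c the image of b.
  have hle : ∀ N M, dist (rankOneAverage u N) (rankOneAverage u M) ≤ dist (F N) (F M) := by
    intro N M
    rw [dist_eq_norm, dist_eq_norm]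
    refine ContinuousLinearMap.opNorm_le_bound _ (norm_nonneg _) fun b => ?_
    set c := (rankOneAverage u N - rankOneAverage u M) b with hc
    have h1 : ‖c‖ ^ 2 = ⟪F N - F M, tensorLp b c⟫_ℝ := by
      rw [inner_sub_left, hF, inner_sum_tensorLp, inner_sum_tensorLp, ← inner_sub_left,
        ← real_inner_self_eq_norm_sq, hc]
      rfl
    have h2 := real_inner_le_norm (F N - F M) (tensorLp b c)
    rw [← h1, norm_tensorLp, ← mul_assoc, sq] at h2
    rcases (norm_nonneg c).eq_or_lt with h0 | h0
    · rw [← h0]; positivity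
    · exact le_of_mul_le_mul_right h2 h0
  have hKc : CauchySeq (rankOneAverage u) := by
    rw [Metric.cauchySeq_iff'] at hFc ⊢
    exact fun ε hε => (hFc ε hε).imp fun N hN n hn => (hle n N).trans_lt (hN n hn)
  have hK := tendsto_rankOneAverage_zero W a hW hKc
  have hu1 : ∀ i, ‖u i‖ = ‖a‖ := by
    intro i
    induction i with
    | zero => rfl
    | succ n ih => simpa [hu, Function.iterate_succ_apply'] using ih
  -- Operator norm convergence returns to the kernels because ‖F N‖² is the average of ⟪K_N uᵢ, uᵢ⟫
  -- over i < N, with K_N the operator of kernel F N and all uᵢ of the same norm.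
  have hbound : ∀ N, ‖F N‖ ^ 2 ≤ ‖rankOneAverage u N‖ * ‖a‖ ^ 2 := by
    intro N
    rw [← real_inner_self_eq_norm_sq]
    conv_lhs => rw [hF, inner_smul_right, inner_sum]
    simp only [inner_sum_tensorLp]
    have h1 : ∀ i ∈ Finset.range N, ⟪rankOneAverage u N (u i), u i⟫_ℝ ≤
        ‖rankOneAverage u N‖ * ‖a‖ ^ 2 := by
      intro i _
      refine (real_inner_le_norm _ _).trans ?_
      rw [sq, ← mul_assoc, hu1]
      refine mul_le_mul_of_nonneg_right ?_ (norm_nonneg _)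
      simpa [hu1] using (rankOneAverage u N).le_opNorm (u i)
    have h2 := Finset.sum_le_sum h1
    rw [Finset.sum_const, Finset.card_range, nsmul_eq_mul] at h2
    rcases N.eq_zero_or_pos with rfl | hN
    · simp; positivity
    · rw [inv_mul_le_iff₀ (by positivity)]
      exact h2
  rw [tendsto_zero_iff_norm_tendsto_zero]
  have h3 : Tendsto (fun N => ‖F N‖ ^ 2) atTop (𝓝 0) :=
    squeeze_zero (fun _ => by positivity) hbound
      (by simpa using (tendsto_zero_iff_norm_tendsto_zero.1 hK).mul_const (‖a‖ ^ 2))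
  simpa [Function.comp_def] using (Real.continuous_sqrt.tendsto 0).comp h3

end Tensor

/-! ### Rigid vectors and quasi-coboundaries. -/

section Cocycle

variable {X : Type*} {mX : MeasurableSpace X} {μ : Measure X} [IsProbabilityMeasure μ]

/-- The function `ε = ±1` is, up to sign, a coboundary over `S`. -/
def IsQuasiCoboundary (S : MPAut μ) (ε : X → ℝ) : Prop :=
  ∃ v : X → ℝ, Measurable v ∧ (∀ x, |v x| = 1) ∧
    ((∀ᵐ x ∂μ, ε x = v x * v (S x)) ∨ (∀ᵐ x ∂μ, ε x = -(v x * v (S x))))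

/-- Over a mildly mixing automorphism, the Koopman operator with a weight that is not a
quasi-coboundary has no rigid vectors. -/
theorem weightedKoopman_eq_zero_of_rigid {S : MPAut μ} (hS : IsMildlyMixing S) {ε : X → ℝ}
    (hε : Measurable ε) (hε1 : ∀ x, |ε x| = 1) (hcob : ¬ IsQuasiCoboundary S ε)
    {n : ℕ → ℕ} (hn : Tendsto n atTop atTop) {f : Lp ℝ 2 μ}
    (hf : Tendsto (fun k => (weightedKoopman S.measurePreserving hε hε1)^[n k] f) atTop (𝓝 f)) :
    f = 0 := by
  set W := weightedKoopman S.measurePreserving hε hε1 with hW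
  obtain ⟨g, hg, hfg⟩ := (Lp.aestronglyMeasurable f).aemeasurable
  have hSn : ∀ n, MeasurePreserving ((S : X → X)^[n]) μ μ := S.measurePreserving_iterate
  have hprod : ∀ n x, |∏ j ∈ Finset.range n, ε ((S : X → X)^[j] x)| = 1 := by
    intro n x
    rw [Finset.abs_prod]
    exact Finset.prod_eq_one fun j _ => hε1 _
  have hit : ∀ n, W^[n] f =ᵐ[μ]
      fun x => (∏ j ∈ Finset.range n, ε ((S : X → X)^[j] x)) * g ((S : X → X)^[n] x) := by
    intro n
    filter_upwards [coeFn_weightedKoopman_iterate S.measurePreserving hε hε1 f n,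
      (hSn n).quasiMeasurePreserving.ae_eq_comp hfg] with x h1 h2
    simp only [Function.comp_apply] at h2
    rw [h1, h2]
  have hL1 : ∀ h : Lp ℝ 2 μ, ∫⁻ x, ‖h x‖ₑ ∂μ ≤ ‖h‖ₑ := by
    intro h
    rw [← eLpNorm_one_eq_lintegral_enorm, Lp.enorm_def]
    exact eLpNorm_le_eLpNorm_of_exponent_le one_le_two (Lp.aestronglyMeasurable h)
  have hdiff : Tendsto (fun k => ‖W^[n k] f - f‖ₑ) atTop (𝓝 0) := by
    have := (tendsto_iff_norm_sub_tendsto_zero.1 hf)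
    simpa [← ofReal_norm] using ENNReal.tendsto_ofReal this
  have hae : ∀ k, (fun x => ((W^[n k] f - f : Lp ℝ 2 μ) : X → ℝ) x) =ᵐ[μ]
      fun x => (∏ j ∈ Finset.range (n k), ε ((S : X → X)^[j] x)) * g ((S : X → X)^[n k] x)
        - g x := by
    intro k
    filter_upwards [Lp.coeFn_sub (W^[n k] f) f, hit (n k), hfg] with x h1 h2 h3
    rw [h1, Pi.sub_apply, h2, h3]
  -- Absolute values remove the weight, so |g| is a rigid function of `S`.
  obtain ⟨c, hc⟩ := hS.ae_const_of_tendsto_integral hn (g := fun x => |g x|) hg.abs (by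
    refine tendsto_of_tendsto_of_tendsto_of_le_of_le tendsto_const_nhds hdiff
      (fun _ => zero_le) (fun k => le_trans (lintegral_mono_ae ?_) (hL1 _))
    filter_upwards [hae k] with x hx
    rw [hx, enorm_le_iff_norm_le, Real.norm_eq_abs, Real.norm_eq_abs]
    refine le_trans ?_ (abs_abs_sub_abs_le _ _)
    rw [abs_mul, hprod, one_mul])
  by_cases hc0 : c = 0
  · apply Lp.ext
    filter_upwards [hfg, hc, Lp.coeFn_zero ℝ 2 μ] with x h1 h2 h3
    rw [h1, h3]
    simpa [hc0] using h2
  exfalso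
  have hcpos : 0 < c := by
    obtain ⟨x, hx⟩ := hc.exists
    exact lt_of_le_of_ne (by simp only [← hx]; exact abs_nonneg _) (Ne.symm hc0)
  have hcS : ∀ᵐ x ∂μ, ∀ n, |g ((S : X → X)^[n] x)| = c :=
    ae_all_iff.2 fun n => (hSn n).quasiMeasurePreserving.ae hc
  -- When |g| = c > 0, the function g · ε · g ∘ S is rigid too: the sign products over n k steps at
  -- x and at S x differ only by the two end factors. Once it is constant, ε is read off from the
  -- signs of g and g ∘ S.
  have hqm : Measurable fun x => g x * (ε x * g (S x)) :=
    hg.mul (hε.mul (hg.comp S.measurePreserving.measurable))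
  obtain ⟨d, hd⟩ := hS.ae_const_of_tendsto_integral hn hqm (by
    have hub : Tendsto (fun k => ENNReal.ofReal (2 * c) * ‖W^[n k] f - f‖ₑ) atTop (𝓝 0) := by
      simpa using ENNReal.Tendsto.const_mul (a := ENNReal.ofReal (2 * c)) hdiff
        (.inr ENNReal.ofReal_ne_top)
    refine tendsto_of_tendsto_of_tendsto_of_le_of_le tendsto_const_nhds hub
      (fun _ => zero_le) (fun k => ?_)
    set h := W^[n k] f - f with hh
    have h1 : ∫⁻ x, ‖h x‖ₑ + ‖h (S x)‖ₑ ∂μ ≤ 2 * ‖h‖ₑ := by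
      rw [lintegral_add_left' (Lp.aestronglyMeasurable h).enorm, two_mul]
      refine add_le_add (hL1 h) (le_of_eq_of_le ?_ (hL1 h))
      have := lintegral_map_equiv (μ := μ) (fun x => ‖h x‖ₑ) S.toEquiv
      rw [S.measurePreserving.map_eq] at this
      exact this.symm
    calc _ ≤ ∫⁻ x, ENNReal.ofReal c * (‖h x‖ₑ + ‖h (S x)‖ₑ) ∂μ := by
          refine lintegral_mono_ae ?_
          filter_upwards [hae k, S.measurePreserving.quasiMeasurePreserving.ae (hae k), hcS]
            with x h2 h3 h4
          simp only [hh, h2, h3]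
          rw [← ofReal_norm, ← ofReal_norm, ← ofReal_norm, ← ENNReal.ofReal_add (norm_nonneg _)
            (norm_nonneg _), ← ENNReal.ofReal_mul hcpos.le]
          refine ENNReal.ofReal_le_ofReal ?_
          simp only [Real.norm_eq_abs]
          set p := ∏ j ∈ Finset.range (n k), ε ((S : X → X)^[j] x) with hp
          have h5 : ∏ j ∈ Finset.range (n k), ε ((S : X → X)^[j] (S x)) =
              ε x * (p * ε ((S : X → X)^[n k] x)) := by
            have h6 := Finset.prod_range_succ (fun j => ε ((S : X → X)^[j] x)) (n k)
            rw [Finset.prod_range_succ'] at h6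
            simp only [Function.iterate_succ_apply, Function.iterate_zero, id] at h6
            have h7 : ε x * ε x = 1 := by rw [← abs_mul_abs_self, hε1, one_mul]
            rw [hp, ← h6, mul_comm _ (ε x), ← mul_assoc, h7, one_mul]
          have h8 : p * p = 1 := by rw [← abs_mul_abs_self, hp, hprod, one_mul]
          have h9 : ε x * ε x = 1 := by rw [← abs_mul_abs_self, hε1, one_mul]
          rw [h5, ← Function.iterate_succ_apply (S : X → X), Function.iterate_succ_apply']
          set α := g ((S : X → X)^[n k] x)
          set β := g (S ((S : X → X)^[n k] x)) with hβ
          set e := ε ((S : X → X)^[n k] x)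
          have hβc : |β| = c := by
            rw [hβ, ← Function.iterate_succ_apply' (S : X → X)]; exact h4 (n k + 1)
          have hgc : |g x| = c := h4 0
          -- The two brackets on the right are the values of h = W^[n k] f - f at x and at S x.
          have key : α * (e * β) - g x * (ε x * g (S x)) =
              (p * α - g x) * (p * e * β) + g x * ε x * (ε x * (p * e) * β - g (S x)) := by
            linear_combination (-(α * e * β)) * h8 + (-(g x * p * e * β)) * h9
          rw [key]
          refine (abs_add_le _ _).trans ?_
          have he : |p * e * β| = c := by
            rw [abs_mul, abs_mul, hp, hprod, hε1, hβc, one_mul, one_mul]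
          have he2 : |g x * ε x| = c := by rw [abs_mul, hε1, hgc, mul_one]
          rw [abs_mul, abs_mul (g x * ε x), he, he2]
          exact le_of_eq (by ring)
      _ ≤ ENNReal.ofReal c * (2 * ‖h‖ₑ) := by
          rw [lintegral_const_mul' _ _ ENNReal.ofReal_ne_top]
          exact mul_le_mul_right h1 _
      _ = _ := by rw [ENNReal.ofReal_mul zero_le_two, ← mul_assoc, mul_comm (ENNReal.ofReal c)]; simp)
  -- The sign of 0 is taken to be 1, so that the transfer function has modulus 1 everywhere.
  obtain ⟨sg, hsgm, hsg1, hsgc⟩ : ∃ sg : ℝ → ℝ, Measurable sg ∧ (∀ r, |sg r| = 1) ∧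
      ∀ r, r = |r| * sg r := by
    refine ⟨fun r => if 0 ≤ r then 1 else -1,
      Measurable.ite measurableSet_Ici measurable_const measurable_const, fun r => ?_, fun r => ?_⟩
    · dsimp only; split_ifs <;> simp
    · dsimp only
      split_ifs with h
      · rw [abs_of_nonneg h, mul_one]
      · rw [abs_of_neg (not_le.1 h)]; ring
  refine hcob ⟨fun x => sg (g x), hsgm.comp hg, fun x => hsg1 _, ?_⟩
  have hsq : ∀ r, sg r * sg r = 1 := fun r => by rw [← abs_mul_abs_self, hsg1, one_mul]
  have hfin : ∀ᵐ x ∂μ, ε x = d / c ^ 2 * (sg (g x) * sg (g (S x))) := by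
    filter_upwards [hd, hcS] with x h1 h2
    have h3 := hsgc (g x)
    have h4 := hsgc (g (S x))
    rw [show |g x| = c from h2 0] at h3
    rw [show |g (S x)| = c from h2 1] at h4
    rw [← h1, div_mul_eq_mul_div, eq_div_iff (by positivity)]
    have h5 := hsq (g x)
    have h6 := hsq (g (S x))
    generalize sg (g x) = s at h3 h5 ⊢
    generalize sg (g (S x)) = t at h4 h6 ⊢
    rw [h3, h4]
    linear_combination (-(c ^ 2 * ε x * t * t)) * h5 - c ^ 2 * ε x * h6
  have hd1 : d / c ^ 2 = 1 ∨ d / c ^ 2 = -1 := by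
    obtain ⟨x, hx⟩ := hfin.exists
    have h1 := hε1 x
    rw [hx, abs_mul, abs_mul] at h1
    rw [hsg1, hsg1, mul_one, mul_one] at h1
    exact eq_or_eq_neg_of_abs_eq h1
  rcases hd1 with h | h
  · left
    filter_upwards [hfin] with x hx
    rw [hx, h, one_mul]
  · right
    filter_upwards [hfin] with x hx
    rw [hx, h]; ring

/-- The averages of `uᵢ(x) uᵢ(x')` tend to `0` in `L²`, where `uᵢ` is the orbit of `a` under the
Koopman operator of a mildly mixing automorphism weighted by a non quasi-coboundary. -/
theorem tendsto_integral_average_sq {S : MPAut μ} (hS : IsMildlyMixing S) {ε : X → ℝ}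
    (hε : Measurable ε) (hε1 : ∀ x, |ε x| = 1) (hcob : ¬ IsQuasiCoboundary S ε) {a : X → ℝ}
    (ha : MemLp a 2 μ) {u : ℕ → X → ℝ} (hu : ∀ i x, u i x =
      (∏ j ∈ Finset.range i, ε ((S : X → X)^[j] x)) * a ((S : X → X)^[i] x)) :
    Tendsto (fun N : ℕ => ∫ p, ((N : ℝ)⁻¹ * ∑ i ∈ Finset.range N, u i p.1 * u i p.2) ^ 2
      ∂(μ.prod μ)) atTop (𝓝 0) := by
  have h := tendsto_average_tensorLp S.measurePreserving hε hε1
    (fun n f hn hf => weightedKoopman_eq_zero_of_rigid hS hε hε1 hcob hn hf) (ha.toLp a)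
  rw [tendsto_zero_iff_norm_tendsto_zero] at h
  have h2 := h.pow 2
  rw [zero_pow two_ne_zero] at h2
  refine h2.congr fun N => ?_
  rw [← real_inner_self_eq_norm_sq, L2.inner_def]
  refine integral_congr_ae ?_
  have hui : ∀ i, (weightedKoopman S.measurePreserving hε hε1)^[i] (ha.toLp a) =ᵐ[μ] u i := by
    intro i
    filter_upwards [coeFn_weightedKoopman_iterate S.measurePreserving hε hε1 (ha.toLp a) i,
      (S.measurePreserving_iterate i).quasiMeasurePreserving.ae_eq_comp ha.coeFn_toLp]
      with x h1 h2
    simp only [Function.comp_apply] at h2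
    rw [h1, h2, hu]
  have h1 : ∀ᵐ p ∂(μ.prod μ), ∀ i,
      tensorLp ((weightedKoopman S.measurePreserving hε hε1)^[i] (ha.toLp a))
        ((weightedKoopman S.measurePreserving hε hε1)^[i] (ha.toLp a)) p =
      u i p.1 * u i p.2 := by
    rw [ae_all_iff]
    intro i
    filter_upwards [coeFn_tensorLp ((weightedKoopman S.measurePreserving hε hε1)^[i] (ha.toLp a))
        ((weightedKoopman S.measurePreserving hε hε1)^[i] (ha.toLp a)),
      Measure.quasiMeasurePreserving_fst.ae_eq_comp (hui i),
      Measure.quasiMeasurePreserving_snd.ae_eq_comp (hui i)] with p h1 h2 h3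
    simp only [Function.comp_apply] at h2 h3
    rw [h1, h2, h3]
  filter_upwards [h1, Lp.coeFn_smul (N : ℝ)⁻¹ (∑ i ∈ Finset.range N,
    tensorLp ((weightedKoopman S.measurePreserving hε hε1)^[i] (ha.toLp a))
        ((weightedKoopman S.measurePreserving hε hε1)^[i] (ha.toLp a))),
    Lp.coeFn_finsetSum (Finset.range N) (fun i =>
    tensorLp ((weightedKoopman S.measurePreserving hε hε1)^[i] (ha.toLp a))
        ((weightedKoopman S.measurePreserving hε hε1)^[i] (ha.toLp a)))] with p h1 h2 h3
  rw [h2, Pi.smul_apply, h3, Finset.sum_apply, Finset.sum_congr rfl fun i _ => h1 i]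
  simp only [RCLike.inner_apply, conj_trivial, smul_eq_mul, sq]

end Cocycle

/-! ### Kakutani skyscrapers and almost invariant sets. -/

section Skyscraper

open scoped InnerProductSpace

variable {X : Type*} {mX : MeasurableSpace X} {μ : Measure X} [IsProbabilityMeasure μ]

/-- Every neighbourhood of a point of the support has positive measure, and such neighbourhoods can
be arbitrarily small because points are null. -/
theorem exists_measurableSet_pos_lt [StandardBorelSpace X] [NullSingletonClass μ] {δ : ENNReal}
    (hδ : 0 < δ) : ∃ C, MeasurableSet C ∧ 0 < μ C ∧ μ C < δ := by
  let := upgradeStandardBorel X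
  obtain ⟨x, -, hx⟩ := exists_mem_forall_mem_nhdsWithin_pos_measure (μ := μ) (s := Set.univ)
    (by simp)
  obtain ⟨U, hxU, hU, hlt⟩ := Set.exists_isOpen_lt_of_lt ({x} : Set X) (μ := μ) δ (by simpa)
  exact ⟨U, hU.measurableSet, hx U (by simpa using hU.mem_nhds (hxU rfl)), hlt⟩

/-- The height function of a Kakutani skyscraper over a small set. -/
theorem exists_height_function [StandardBorelSpace X] [NullSingletonClass μ] {S : MPAut μ}
    (hS : Ergodic (S : X → X) μ) {δ : ENNReal} (hδ : 0 < δ) :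
    ∃ l : X → ℕ, Measurable l ∧ μ {x | l (S x) ≠ l x + 1} ≤ δ ∧ ∀ r, μ {x | l x = r} ≤ δ := by
  classical
  obtain ⟨C, hC, hC0, hCδ⟩ := exists_measurableSet_pos_lt (μ := μ) hδ
  set U : X → X := ⇑S.toEquiv.symm with hU
  have hUm : MeasurePreserving U μ μ := S.measurePreserving.symm
  have hUn : ∀ n, MeasurePreserving (U^[n]) μ μ := fun n => hUm.iterate n
  set G : Set X := ⋃ n, U^[n] ⁻¹' C with hG
  have hGm : MeasurableSet G := .iUnion fun n => (hUn n).measurable hC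
  have hGc : μ Gᶜ = 0 := by
    have hsub : U ⁻¹' G ⊆ G := by
      intro x hx
      obtain ⟨n, hn⟩ := Set.mem_iUnion.1 hx
      exact Set.mem_iUnion.2 ⟨n + 1, by simpa using hn⟩
    have hUe : Ergodic U μ := hS.symm
    rcases hUe.ae_empty_or_univ_of_preimage_ae_le hGm.nullMeasurableSet
      (Eventually.of_forall hsub) with h | h
    · exfalso
      have : μ C ≤ μ G := measure_mono fun x hx => Set.mem_iUnion.2 ⟨0, hx⟩
      rw [ae_eq_empty.1 h] at this
      exact hC0.not_ge this
    · exact ae_eq_univ.1 h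
  -- The height is the time since the last visit to `C`; on the null set of points whose past avoids
  -- `C` it defaults to 0. It grows by one unless S x lands in `C`, and its r-th level lies over the
  -- r-th image of `C`.
  have hex : ∀ x, ∃ n, U^[n] x ∈ C ∨ x ∉ G := by
    intro x
    by_cases hx : x ∈ G
    · exact (Set.mem_iUnion.1 hx).imp fun n hn => .inl hn
    · exact ⟨0, .inr hx⟩
  refine ⟨fun x => Nat.find (hex x), measurable_find hex fun k =>
    ((hUn k).measurable hC).union hGm.compl, ?_, fun r => ?_⟩
  · have hsub : {x | Nat.find (hex (S x)) ≠ Nat.find (hex x) + 1} ⊆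
        (S : X → X) ⁻¹' C ∪ (Gᶜ ∪ (S : X → X) ⁻¹' Gᶜ) := by
      intro x hx
      by_contra hcon
      simp only [Set.mem_union, Set.mem_preimage, Set.mem_compl_iff, not_or, not_not] at hcon
      obtain ⟨h1, h2, h3⟩ := hcon
      refine hx ((Nat.find_eq_iff _).2 ⟨.inl ?_, fun k hk => ?_⟩)
      · rw [Function.iterate_succ_apply]
        have := (Nat.find_spec (hex x)).resolve_right (not_not.2 h2)
        simpa [hU] using this
      · rcases k with _ | k
        · simpa [h3] using h1
        · have := Nat.find_min (hex x) (show k < _ by omega)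
          simpa [hU, h2, h3] using this
    refine (measure_mono hsub).trans ((measure_union_le _ _).trans ?_)
    rw [measure_union_null hGc
      (by rw [S.measurePreserving.measure_preimage hGm.compl.nullMeasurableSet, hGc]),
      S.measurePreserving.measure_preimage hC.nullMeasurableSet, add_zero]
    exact hCδ.le
  · have hsub : {x | Nat.find (hex x) = r} ⊆ U^[r] ⁻¹' C ∪ Gᶜ := by
      rintro x rfl
      exact Nat.find_spec (hex x)
    refine (measure_mono hsub).trans ((measure_union_le _ _).trans ?_)
    rw [hGc, (hUn r).measure_preimage hC.nullMeasurableSet, add_zero]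
    exact hCδ.le

/-- The mean ergodic theorem for a set: some iterate makes it almost independent of itself. -/
theorem exists_inter_preimage_iterate_le {S : MPAut μ} (hS : Ergodic (S : X → X) μ) {D : Set X}
    (hD : MeasurableSet D) {η : ℝ} (hη : 0 < η) :
    ∃ m, μ.real (D ∩ (S : X → X)^[m] ⁻¹' D) ≤ μ.real D ^ 2 + η := by
  -- The averages of μ(D ∩ S⁻ⁱD) tend to μ(D)², since the projection of 1_D to the invariant
  -- functions is constant by ergodicity; they could not all exceed μ(D)² + η.
  by_contra! hcon
  have h1m : Measurable fun _ : X => (1 : ℝ) := measurable_const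
  have h11 : ∀ x : X, |(fun _ : X => (1 : ℝ)) x| = 1 := fun x => by simp
  set W := weightedKoopman S.measurePreserving h1m h11
  set f : Lp ℝ 2 μ := indicatorConstLp 2 hD (measure_ne_top μ D) 1 with hf
  set P' := (W.toContinuousLinearMap.eqLocus
    (1 : Lp ℝ 2 μ →L[ℝ] Lp ℝ 2 μ)).orthogonalProjectionOnto f
  set P : Lp ℝ 2 μ := P'.1
  have hlim : Tendsto (birkhoffAverage ℝ W id · f) atTop (𝓝 P) :=
    ContinuousLinearMap.tendsto_birkhoffAverage_orthogonalProjection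
      W.toContinuousLinearMap W.norm_toContinuousLinearMap_le f
  have hWP : W P = P := P'.2
  obtain ⟨c, hc⟩ : ∃ c, (P : X → ℝ) =ᵐ[μ] fun _ => c := by
    refine hS.quasiErgodic.ae_eq_const_of_ae_eq_comp₀ (Lp.aestronglyMeasurable P).aemeasurable.nullMeasurable ?_
    have := coeFn_weightedKoopman S.measurePreserving h1m h11 P
    rw [show weightedKoopman S.measurePreserving h1m h11 P = P from hWP] at this
    filter_upwards [this] with x hx
    simp [hx]
  have hit : ∀ i, ∀ᵐ x ∂μ, W^[i] f x = D.indicator (fun _ => (1 : ℝ)) ((S : X → X)^[i] x) := by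
    intro i
    filter_upwards [coeFn_weightedKoopman_iterate S.measurePreserving h1m h11 f i,
      (S.measurePreserving_iterate i).quasiMeasurePreserving.ae_eq_comp
        (indicatorConstLp_coeFn (p := 2) (hs := hD) (hμs := measure_ne_top μ D) (c := (1 : ℝ)))]
      with x h1 h2
    rw [h1]
    simpa using h2
  have hinner : ∀ i, ⟪f, W^[i] f⟫_ℝ = μ.real (D ∩ (S : X → X)^[i] ⁻¹' D) := by
    intro i
    rw [hf, L2.inner_indicatorConstLp_one]
    rw [setIntegral_congr_ae hD ((hit i).mono fun x hx _ => hx)]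
    have : (fun x => D.indicator (fun _ => (1 : ℝ)) ((S : X → X)^[i] x)) =
      ((S : X → X)^[i] ⁻¹' D).indicator fun _ => 1 := by
      ext x; rfl
    rw [this, setIntegral_indicator ((S.measurePreserving_iterate i).measurable hD)]
    simp
  have hint : ∀ i, ∫ x, W^[i] f x ∂μ = μ.real D := by
    intro i
    rw [integral_congr_ae (hit i)]
    have : (fun x => D.indicator (fun _ => (1 : ℝ)) ((S : X → X)^[i] x)) =
      ((S : X → X)^[i] ⁻¹' D).indicator fun _ => 1 := by
      ext x; rfl
    rw [this, integral_indicator_const _ ((S.measurePreserving_iterate i).measurable hD)]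
    simp only [smul_eq_mul, mul_one, measureReal_def]
    rw [(S.measurePreserving_iterate i).measure_preimage hD.nullMeasurableSet]
  set one : Lp ℝ 2 μ := indicatorConstLp 2 MeasurableSet.univ (measure_ne_top μ _) 1 with hone
  have hcval : c = μ.real D := by
    have h1 : Tendsto (fun N => ⟪one, birkhoffAverage ℝ W id N f⟫_ℝ) atTop (𝓝 ⟪one, P⟫_ℝ) :=
      (tendsto_const_nhds.inner hlim)
    have h2 : ⟪one, P⟫_ℝ = c := by
      rw [hone, L2.inner_indicatorConstLp_one, setIntegral_univ, integral_congr_ae hc]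
      simp
    have h3 : ∀ᶠ N : ℕ in atTop, ⟪one, birkhoffAverage ℝ W id N f⟫_ℝ = μ.real D := by
      filter_upwards [eventually_ge_atTop 1] with N hN
      rw [birkhoffAverage, birkhoffSum, inner_smul_right, inner_sum]
      have : ∀ i ∈ Finset.range N, ⟪one, id (W^[i] f)⟫_ℝ = μ.real D := by
        intro i _
        rw [hone, L2.inner_indicatorConstLp_one, setIntegral_univ]
        exact hint i
      rw [Finset.sum_congr rfl this]
      have : (N : ℝ) ≠ 0 := by positivity
      simp [this]
    rw [← h2]
    exact tendsto_nhds_unique h1 (tendsto_const_nhds.congr' (h3.mono fun _ h => h.symm))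
  have h1 : Tendsto (fun N => ⟪f, birkhoffAverage ℝ W id N f⟫_ℝ) atTop (𝓝 ⟪f, P⟫_ℝ) :=
    (tendsto_const_nhds.inner hlim)
  have h2 : ⟪f, P⟫_ℝ = μ.real D ^ 2 := by
    rw [hf, L2.inner_indicatorConstLp_one, setIntegral_congr_ae hD (hc.mono fun x hx _ => hx), hcval]
    simp [sq]
  have h3 : ∀ᶠ N : ℕ in atTop, μ.real D ^ 2 + η ≤ ⟪f, birkhoffAverage ℝ W id N f⟫_ℝ := by
    filter_upwards [eventually_ge_atTop 1] with N hN
    rw [birkhoffAverage, birkhoffSum, inner_smul_right, inner_sum]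
    have : ∀ i ∈ Finset.range N, μ.real D ^ 2 + η ≤ ⟪f, id (W^[i] f)⟫_ℝ := by
      intro i _
      rw [id, hinner]
      exact (hcon i).le
    have h4 := Finset.sum_le_sum this
    rw [Finset.sum_const, Finset.card_range, nsmul_eq_mul] at h4
    have : (0 : ℝ) < N := by positivity
    rwa [le_inv_mul_iff₀ this]
  have h4 := ge_of_tendsto h1 h3
  rw [h2] at h4
  linarith

/-- Sets of intermediate measure that are almost invariant, but not under all iterates. -/
theorem exists_almost_invariant_set [StandardBorelSpace X] [NullSingletonClass μ] {S : MPAut μ}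
    (hS : Ergodic (S : X → X) μ) {δ : ℝ} (hδ : 0 < δ) :
    ∃ (D : Set X) (m : ℕ), MeasurableSet D ∧ μ {x | ¬(x ∈ D ↔ S x ∈ D)} ≤ ENNReal.ofReal δ ∧
      1 / 8 ≤ μ.real {x | ¬(x ∈ D ↔ (S : X → X)^[m] x ∈ D)} := by
  -- Two exceptional sets of measure δ' make up the boundary, and 1/3 + 1/10 < 1/2 keeps the measure
  -- of `D` in [1/3, 1/2].
  set δ' : ℝ := min (δ / 2) (1 / 10) with hδ'
  have hδ'0 : 0 < δ' := by positivity
  obtain ⟨l, hl, hl1, hl2⟩ := exists_height_function (μ := μ) hS (ENNReal.ofReal_pos.2 hδ'0)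
  have hDm : ∀ r, MeasurableSet {x | l x < r} := fun r => hl measurableSet_Iio
  have hlim : Tendsto (fun r : ℕ => μ.real {x | l x < r}) atTop (𝓝 1) := by
    have hmono : Monotone fun r : ℕ => {x | l x < r} := fun r s hrs x hx => lt_of_lt_of_le hx hrs
    have h1 := tendsto_measure_iUnion_atTop (μ := μ) hmono
    have h2 : ⋃ r : ℕ, {x | l x < r} = Set.univ :=
      Set.eq_univ_of_forall fun x => Set.mem_iUnion.2 ⟨l x + 1, Nat.lt_succ_self _⟩
    rw [h2, measure_univ] at h1
    simpa [Function.comp_def, measureReal_def] using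
      (ENNReal.tendsto_toReal ENNReal.one_ne_top).comp h1
  have hex : ∃ r : ℕ, 1 / 3 ≤ μ.real {x | l x < r} :=
    (((tendsto_order.1 hlim).1 (1 / 3) (by norm_num)).exists).imp fun r hr => hr.le
  classical
  set r := Nat.find hex with hr
  have hr1 : 1 / 3 ≤ μ.real {x | l x < r} := Nat.find_spec hex
  obtain ⟨q, hq⟩ : ∃ q, r = q + 1 := by
    refine Nat.exists_eq_succ_of_ne_zero fun h0 => ?_
    rw [h0] at hr1
    norm_num at hr1
  have hr2 : μ.real {x | l x < q} < 1 / 3 := not_le.1 (Nat.find_min hex (by omega))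
  have hreal : ∀ k, μ.real {x | l x = k} ≤ δ' := fun k =>
    ENNReal.toReal_le_of_le_ofReal hδ'0.le (hl2 k)
  have hr3 : μ.real {x | l x < r} ≤ 1 / 2 := by
    have hsub : {x | l x < r} ⊆ {x | l x < q} ∪ {x | l x = q} := by
      intro x hx
      simp only [Set.mem_ofPred_eq, Set.mem_union] at hx ⊢
      omega
    have h1 := (measureReal_mono hsub).trans (measureReal_union_le (μ := μ) _ _)
    have h2 := hreal q
    have h3 : δ' ≤ 1 / 10 := min_le_right _ _
    linarith
  obtain ⟨m, hm⟩ := exists_inter_preimage_iterate_le hS (hDm r) (η := 1 / 100) (by norm_num)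
  refine ⟨{x | l x < r}, m, hDm r, ?_, ?_⟩
  · have hsub : {x | ¬(x ∈ {x | l x < r} ↔ S x ∈ {x | l x < r})} ⊆
        {x | l (S x) ≠ l x + 1} ∪ {x | l x = q} := by
      intro x hx
      simp only [Set.mem_ofPred_eq, Set.mem_union] at hx ⊢
      omega
    refine (measure_mono hsub).trans ((measure_union_le _ _).trans ((add_le_add hl1 (hl2 q)).trans ?_))
    rw [← ENNReal.ofReal_add hδ'0.le hδ'0.le]
    refine ENNReal.ofReal_le_ofReal ?_
    have : δ' ≤ δ / 2 := min_le_left _ _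
    linarith
  · set D := {x | l x < r}
    have hpre : μ.real ((S : X → X)^[m] ⁻¹' D) = μ.real D := by
      rw [measureReal_def, (S.measurePreserving_iterate m).measure_preimage
        (hDm r).nullMeasurableSet, measureReal_def]
    have hsub : D ∪ (S : X → X)^[m] ⁻¹' D ⊆
        {x | ¬(x ∈ D ↔ (S : X → X)^[m] x ∈ D)} ∪ (D ∩ (S : X → X)^[m] ⁻¹' D) := by
      intro x hx
      simp only [Set.mem_ofPred_eq, Set.mem_union, Set.mem_preimage, Set.mem_inter_iff] at hx ⊢
      tauto
    have h1 := (measureReal_mono hsub).trans (measureReal_union_le (μ := μ) _ _)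
    have h2 := measureReal_union_add_inter (μ := μ) (s := D)
      ((S.measurePreserving_iterate m).measurable (hDm r))
    rw [hpre] at h2
    -- With d = μ(D) in [1/3, 1/2], the symmetric difference is at least 2d - 2d² - 2/100, well
    -- above 1/8.
    nlinarith

end Skyscraper

/-! ### Signs of ℤ/2. -/

section SignCharacter

/-- The nontrivial character of `ZMod 2`. -/
def zmodSign (a : ZMod 2) : ℝ := if a = 0 then 1 else -1

theorem abs_zmodSign (a : ZMod 2) : |zmodSign a| = 1 := by
  unfold zmodSign; split_ifs <;> simp

theorem zmodSign_zero : zmodSign 0 = 1 := if_pos rfl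

theorem ZMod.eq_zero_or_one_of_two (a : ZMod 2) : a = 0 ∨ a = 1 := by
  fin_cases a
  · exact .inl rfl
  · exact .inr rfl

theorem zmodSign_add (a b : ZMod 2) : zmodSign (a + b) = zmodSign a * zmodSign b := by
  have h : (1 : ZMod 2) + 1 = 0 := by decide
  rcases a.eq_zero_or_one_of_two with rfl | rfl <;> rcases b.eq_zero_or_one_of_two with rfl | rfl <;>
    simp [zmodSign, h]

end SignCharacter

/-! ### A cocycle without quasi-coboundary characters. -/

section CocycleConstruction

variable {X : Type*} {mX : MeasurableSpace X} {μ : Measure X}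

/-- A change of w over m steps must occur at one of the steps, and each step has the same
probability of change. -/
theorem MPAut.measure_iterate_ne_le (S : MPAut μ) {w : X → ℝ} (hw : Measurable w) (m : ℕ) :
    μ {x | w x ≠ w ((S : X → X)^[m] x)} ≤ m * μ {x | w x ≠ w (S x)} := by
  induction m with
  | zero => simp
  | succ m ih =>
    have hsub : {x | w x ≠ w ((S : X → X)^[m + 1] x)} ⊆
        {x | w x ≠ w ((S : X → X)^[m] x)} ∪ (S : X → X)^[m] ⁻¹' {x | w x ≠ w (S x)} := by
      intro x hx
      rw [Set.mem_ofPred_eq, Function.iterate_succ_apply'] at hx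
      by_cases h : w x = w ((S : X → X)^[m] x)
      · exact .inr (by rw [Set.mem_preimage, Set.mem_ofPred_eq, ← h]; exact hx)
      · exact .inl h
    have hms : MeasurableSet {x | w x ≠ w (S x)} :=
      (measurableSet_eq_fun hw (hw.comp S.measurePreserving.measurable)).compl
    refine (measure_mono hsub).trans ((measure_union_le _ _).trans ?_)
    rw [(S.measurePreserving_iterate m).measure_preimage hms.nullMeasurableSet]
    refine (add_le_add_left ih _).trans (le_of_eq ?_)
    push_cast
    ring

variable [IsProbabilityMeasure μ]

/-- A sequence of sets whose boundaries decrease quickly compared to the times at which the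
previous sets fail to be invariant. -/
theorem exists_seq_almost_invariant_set [StandardBorelSpace X] [NullSingletonClass μ]
    {S : MPAut μ} (hS : Ergodic (S : X → X) μ) :
    ∃ (D : ℕ → Set X) (m : ℕ → ℕ), (∀ n, MeasurableSet (D n)) ∧
      (∑' k, μ {x | ¬(x ∈ D k ↔ S x ∈ D k)} ≠ ⊤) ∧
      (∀ n, m n * ∑' k, μ {x | ¬(x ∈ D (n + 1 + k) ↔ S x ∈ D (n + 1 + k))} ≤
        ENNReal.ofReal (1 / 100)) ∧
      ∀ n, 1 / 8 ≤ μ.real {x | ¬(x ∈ D n ↔ (S : X → X)^[m n] x ∈ D n)} := by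
  have hex := fun (δ : ℝ) (hδ : 0 < δ) => exists_almost_invariant_set (μ := μ) hS hδ
  choose! D m hD hbd hlarge using hex
  -- The recursion divides by the previous return time, so m n times the tail after n is at most m n
  -- · δ (n+1) · 4/3 ≤ δ n / 3.
  set δ : ℕ → ℝ := fun n => Nat.rec (1 / 100) (fun _ d => d / (4 * (m d + 1))) n with hδ
  have hsucc : ∀ n, δ (n + 1) = δ n / (4 * (m (δ n) + 1)) := fun n => rfl
  have hpos : ∀ n, 0 < δ n := by
    intro n
    induction n with
    | zero => norm_num [hδ]
    | succ n ih => rw [hsucc]; positivity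
  have hstep : ∀ n, δ (n + 1) ≤ δ n * (1 / 4) := by
    intro n
    rw [hsucc, div_eq_mul_inv]
    refine mul_le_mul_of_nonneg_left ?_ (hpos n).le
    rw [one_div]
    refine inv_anti₀ (by norm_num) ?_
    have : (0 : ℝ) ≤ m (δ n) := Nat.cast_nonneg _
    linarith
  have hgeom : ∀ n k, δ (n + k) ≤ δ n * (1 / 4) ^ k := by
    intro n k
    induction k with
    | zero => simp
    | succ k ih =>
      rw [← add_assoc, pow_succ, ← mul_assoc]
      exact (hstep _).trans (mul_le_mul_of_nonneg_right ih (by norm_num))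
  have hle : ∀ n, δ n ≤ 1 / 100 := by
    intro n
    have h1 := hgeom 0 n
    rw [zero_add] at h1
    refine h1.trans (mul_le_of_le_one_right (hpos 0).le (pow_le_one₀ (by norm_num) (by norm_num)))
  have hsum : ∀ n, ∑' k, μ {x | ¬(x ∈ D (δ (n + k)) ↔ S x ∈ D (δ (n + k)))} ≤
      ENNReal.ofReal (δ n * (4 / 3)) := by
    intro n
    calc _ ≤ ∑' k : ℕ, ENNReal.ofReal (δ n * (1 / 4) ^ k) :=
          ENNReal.tsum_le_tsum fun k =>
            (hbd _ (hpos _)).trans (ENNReal.ofReal_le_ofReal (hgeom n k))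
      _ = ENNReal.ofReal (∑' k : ℕ, δ n * (1 / 4) ^ k) :=
          (ENNReal.ofReal_tsum_of_nonneg (fun k => mul_nonneg (hpos n).le (by positivity))
            ((summable_geometric_of_lt_one (by norm_num) (by norm_num)).mul_left _)).symm
      _ = _ := by
          rw [tsum_mul_left, tsum_geometric_of_lt_one (by norm_num) (by norm_num)]
          norm_num
  refine ⟨fun n => D (δ n), fun n => m (δ n), fun n => hD _ (hpos n), ?_, fun n => ?_,
    fun n => hlarge _ (hpos n)⟩
  · have h1 := hsum 0
    simp only [zero_add] at h1
    exact ne_top_of_le_ne_top ENNReal.ofReal_ne_top h1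
  · refine (mul_le_mul_right (hsum (n + 1)) _).trans ?_
    rw [← ENNReal.ofReal_natCast, ← ENNReal.ofReal_mul (Nat.cast_nonneg _)]
    refine ENNReal.ofReal_le_ofReal ?_
    rw [hsucc]
    have h1 : (m (δ n) : ℝ) * (δ n / (4 * (m (δ n) + 1)) * (4 / 3)) =
        δ n / 3 * (m (δ n) / (m (δ n) + 1)) := by
      field_simp
    rw [h1]
    have h2 : (m (δ n) : ℝ) / (m (δ n) + 1) ≤ 1 := by
      rw [div_le_one (by positivity)]; linarith
    refine (mul_le_of_le_one_right (by have := hpos n; positivity) h2).trans ?_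
    linarith [hle n]

/-- There is a cocycle with values in `(ℤ/2)^ℕ` none of whose nontrivial characters is a
quasi-coboundary. -/
theorem exists_cocycle [StandardBorelSpace X] [NullSingletonClass μ] {S : MPAut μ}
    (hS : Ergodic (S : X → X) μ) :
    ∃ φ : X → ℕ → ZMod 2, Measurable φ ∧ ∀ A : Finset ℕ, A.Nonempty →
      ¬ IsQuasiCoboundary S fun x => zmodSign (∑ j ∈ A, φ x j) := by
  classical
  obtain ⟨D, m, hD, hsum, hsmall, hlarge⟩ := exists_seq_almost_invariant_set (μ := μ) hS
  set B : ℕ → Set X := fun k => {x | ¬(x ∈ D k ↔ S x ∈ D k)} with hB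
  have hBm : ∀ k, MeasurableSet (B k) := by
    intro k
    have : B k = (D k) ∆ ((S : X → X) ⁻¹' D k) := by
      ext x; simp only [hB, Set.mem_ofPred_eq, Set.mem_symmDiff, Set.mem_preimage]; tauto
    rw [this]
    exact (hD k).symmDiff (S.measurePreserving.measurable (hD k))
  set L : Set X := limsup B atTop with hL
  have hLm : MeasurableSet L := MeasurableSet.measurableSet_limsup hBm
  have hL0 : μ L = 0 := measure_limsup_atTop_eq_zero hsum
  -- By Borel–Cantelli almost every point lies in finitely many `B k`; removing the null set `L`
  -- makes this true everywhere.
  have hfin : ∀ x, {k | x ∈ B k \ L}.Finite := by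
    intro x
    by_cases hx : x ∈ L
    · simp [hx]
    · have h1 : ¬ ∃ᶠ k in atTop, x ∈ B k := fun h => hx (mem_limsup_iff_frequently_mem.2 h)
      rw [Nat.frequently_atTop_iff_infinite, Set.not_infinite] at h1
      exact h1.subset fun k hk => hk.1
  set κ : X → Finset ℕ := fun x => (hfin x).toFinset with hκ
  have hκmem : ∀ x k, k ∈ κ x ↔ x ∈ B k \ L := fun x k => by simp [hκ]
  have hκm : ∀ s, MeasurableSet {x | κ x = s} := by
    intro s
    have : {x | κ x = s} = ⋂ k, {x | x ∈ B k \ L ↔ k ∈ s} := by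
      ext x
      simp only [Set.mem_ofPred_eq, Set.mem_iInter, Finset.ext_iff, hκmem]
    rw [this]
    refine .iInter fun k => ?_
    by_cases hk : k ∈ s
    · simp only [hk, iff_true]
      exact (hBm k).diff hLm
    · simp only [hk, iff_false]
      exact ((hBm k).diff hLm).compl
  have hκcomp : ∀ {β : Type} [MeasurableSpace β] (g : Finset ℕ → β),
      Measurable fun x => g (κ x) := by
    intro β _ g U _
    have : (fun x => g (κ x)) ⁻¹' U = ⋃ s ∈ g ⁻¹' U, {x | κ x = s} := by
      ext x; simp
    rw [this]
    exact .biUnion (Set.to_countable _) fun s _ => hκm s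
  -- Off `L` this is the product over t k = 1 of the coboundaries of the ±1 functions of the sets D
  -- k. The product of the transfer functions need not converge.
  set ε : (ℕ → ZMod 2) → X → ℝ := fun t x => zmodSign (∑ k ∈ κ x, t k) with hε
  have hεadd : ∀ s t x, ε (s + t) x = ε s x * ε t x := by
    intro s t x
    simp only [hε, Pi.add_apply, Finset.sum_add_distrib, zmodSign_add]
  -- coboundaries with a small transfer function are excluded
  have hkey : ∀ (s : ℕ → ZMod 2) (v : X → ℝ), s ≠ 0 → Measurable v → (∀ x, |v x| = 1) →
      (∀ᵐ x ∂μ, ε s x = v x * v (S x)) → 1 / 100 ≤ μ.real {x | v x ≠ 1} := by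
    intro s v hs hv hv1 hcob
    have hex : ∃ n, s n ≠ 0 := by
      by_contra! h
      exact hs (funext h)
    set n := Nat.find hex with hn
    have hsn : s n = 1 := (s n).eq_zero_or_one_of_two.resolve_left (Nat.find_spec hex)
    have hslt : ∀ k < n, s k = 0 := fun k hk => not_not.1 (Nat.find_min hex hk)
    set d : X → ℝ := fun x => if x ∈ D n then 1 else -1 with hd
    have hdm : Measurable d := Measurable.ite (hD n) measurable_const measurable_const
    have hdd : ∀ x, d x * d x = 1 := fun x => by simp only [hd]; split_ifs <;> norm_num
    have hvv : ∀ x, v x * v x = 1 := fun x => by rw [← abs_mul_abs_self, hv1, one_mul]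
    set w : X → ℝ := fun x => v x * d x with hw
    -- For n the first index in the support of s, multiplying v by the sign of D n cancels the n-th
    -- factor, so w changes only on later sets `B k`. Thus w is nearly invariant under S^[m n] while
    -- D n is not, which gives 1/8 ≤ 1/100 + 2 μ{v ≠ 1}.
    have hwS : μ {x | w x ≠ w (S x)} ≤ ∑' k, μ (B (n + 1 + k)) := by
      have h1 : μ ({x | w x ≠ w (S x)} \ ⋃ k, B (n + 1 + k)) = 0 := by
        have hae : ∀ᵐ x ∂μ, x ∉ {x | w x ≠ w (S x)} \ ⋃ k, B (n + 1 + k) := by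
          filter_upwards [hcob, measure_eq_zero_iff_ae_notMem.1 hL0] with x h1 h2 h3
          refine h3.1 ?_
          have h4 : ε s x = d x * d (S x) := by
            have h5 : ∑ k ∈ κ x, s k = if n ∈ κ x then 1 else 0 := by
              rw [← Finset.sum_ite_eq' (κ x) n (fun _ => (1 : ZMod 2))]
              refine Finset.sum_congr rfl fun k hk => ?_
              rcases lt_trichotomy k n with h | h | h
              · rw [hslt k h, if_neg h.ne]
              · rw [if_pos h, h, hsn]
              · exfalso
                refine h3.2 (Set.mem_iUnion.2 ⟨k - (n + 1), ?_⟩)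
                rw [show n + 1 + (k - (n + 1)) = k by omega]
                exact ((hκmem x k).1 hk).1
            have h6 : n ∈ κ x ↔ ¬(x ∈ D n ↔ S x ∈ D n) := by
              rw [hκmem]; exact ⟨fun h => h.1, fun h => ⟨h, h2⟩⟩
            simp only [hε, h5, hd]
            by_cases hx1 : x ∈ D n <;> by_cases hx2 : S x ∈ D n <;>
              simp [h6, hx1, hx2, zmodSign]
          rw [h4] at h1
          have h7 := hdd (S x)
          have h8 := hvv x
          simp only [hw]
          linear_combination v x * d (S x) * h1 - v x * d x * h7 + v (S x) * d (S x) * h8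
        exact measure_eq_zero_iff_ae_notMem.2 hae
      calc μ {x | w x ≠ w (S x)}
          ≤ μ (({x | w x ≠ w (S x)} \ ⋃ k, B (n + 1 + k)) ∪ ⋃ k, B (n + 1 + k)) :=
            measure_mono fun x hx => by
              by_cases h : x ∈ ⋃ k, B (n + 1 + k)
              · exact .inr h
              · exact .inl ⟨hx, h⟩
        _ ≤ 0 + μ (⋃ k, B (n + 1 + k)) := (measure_union_le _ _).trans (by rw [h1])
        _ ≤ _ := by rw [zero_add]; exact measure_iUnion_le _
    have hwm : μ.real {x | w x ≠ w ((S : X → X)^[m n] x)} ≤ 1 / 100 := by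
      refine ENNReal.toReal_le_of_le_ofReal (by norm_num) ?_
      refine (S.measure_iterate_ne_le (hv.mul hdm) (m n)).trans ?_
      exact (mul_le_mul_right hwS _).trans (hsmall n)
    have hpre : μ.real ((S : X → X)^[m n] ⁻¹' {x | v x ≠ 1}) = μ.real {x | v x ≠ 1} := by
      rw [measureReal_def, (S.measurePreserving_iterate _).measure_preimage, measureReal_def]
      exact (hv (measurableSet_singleton (1 : ℝ))).compl.nullMeasurableSet
    have hsub : {x | ¬(x ∈ D n ↔ (S : X → X)^[m n] x ∈ D n)} ⊆
        {x | w x ≠ w ((S : X → X)^[m n] x)} ∪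
          ({x | v x ≠ 1} ∪ (S : X → X)^[m n] ⁻¹' {x | v x ≠ 1}) := by
      intro x hx
      by_contra hcon
      simp only [Set.mem_union, Set.mem_ofPred_eq, Set.mem_preimage, not_or, not_not] at hcon hx
      obtain ⟨h1, h2, h3⟩ := hcon
      simp only [hw, h2, h3, one_mul, hd] at h1
      refine hx ?_
      by_cases hx1 : x ∈ D n <;> by_cases hx2 : (S : X → X)^[m n] x ∈ D n <;>
        simp only [hx1, hx2, if_true, if_false] at h1 ⊢ <;> norm_num at h1
    have h1 := (measureReal_mono hsub).trans (measureReal_union_le (μ := μ) _ _)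
    have h2 := measureReal_union_le (μ := μ) {x | v x ≠ 1} ((S : X → X)^[m n] ⁻¹' {x | v x ≠ 1})
    have h3 := hlarge n
    rw [hpre] at h2
    linarith
  -- the quasi-coboundaries of this family form a countable subgroup
  set Q : Submodule (ZMod 2) (ℕ → ZMod 2) :=
    { carrier := {t | IsQuasiCoboundary S (ε t)}
      zero_mem' := ⟨fun _ => 1, measurable_const, by simp, .inl (.of_forall fun x => by
        simp [hε, zmodSign_zero])⟩
      add_mem' := by
        rintro s t ⟨v, hv, hv1, hvc⟩ ⟨w, hw, hw1, hwc⟩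
        refine ⟨fun x => v x * w x, hv.mul hw, fun x => by rw [abs_mul, hv1, hw1, one_mul], ?_⟩
        rcases hvc with hvc | hvc <;> rcases hwc with hwc | hwc
        · left; filter_upwards [hvc, hwc] with x h1 h2; rw [hεadd, h1, h2]; ring
        · right; filter_upwards [hvc, hwc] with x h1 h2; rw [hεadd, h1, h2]; ring
        · right; filter_upwards [hvc, hwc] with x h1 h2; rw [hεadd, h1, h2]; ring
        · left; filter_upwards [hvc, hwc] with x h1 h2; rw [hεadd, h1, h2]; ring
      smul_mem' := by
        intro c t ht
        rcases c.eq_zero_or_one_of_two with rfl | rfl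
        · rw [zero_smul]
          exact ⟨fun _ => 1, measurable_const, by simp, .inl (.of_forall fun x => by
            simp [hε, zmodSign_zero])⟩
        · rwa [one_smul] } with hQ
  have hQmem : ∀ t, t ∈ Q ↔ IsQuasiCoboundary S (ε t) := fun t => Iff.rfl
  have hQc : Countable Q := by
    obtain ⟨𝒜, hAc, hAd⟩ := exists_countable_measureDense μ
    -- Each quasi-coboundary is coded by its sign and a member of a countable dense family. Equal
    -- codes give v s · v t ≠ 1 on a set of measure below 2/400, less than the 1/100 of `hkey`, so
    -- the codes are injective.
    have hch : ∀ t : Q, ∃ (v : X → ℝ) (σ : Bool) (a : 𝒜), Measurable v ∧ (∀ x, |v x| = 1) ∧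
        (∀ᵐ x ∂μ, ε t x = (if σ then 1 else -1) * (v x * v (S x))) ∧
        μ.real ({x | v x ≠ 1} ∆ a) < 1 / 400 := by
      rintro ⟨t, v, hv, hv1, hvc⟩
      obtain ⟨a, ha, hlt⟩ := hAd.approx {x | v x ≠ 1}
        (hv (measurableSet_singleton (1 : ℝ))).compl (measure_ne_top _ _) (1 / 400) (by norm_num)
      have hlt' : μ.real ({x | v x ≠ 1} ∆ a) < 1 / 400 := by
        rw [measureReal_def]
        exact ENNReal.toReal_lt_of_lt_ofReal hlt
      rcases hvc with hvc | hvc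
      · exact ⟨v, true, ⟨a, ha⟩, hv, hv1, by simpa using hvc, hlt'⟩
      · exact ⟨v, false, ⟨a, ha⟩, hv, hv1, by simpa using hvc, hlt'⟩
    choose v σ a hv hv1 hvc hva using hch
    have := hAc.to_subtype
    refine Function.Injective.countable (f := fun t => (σ t, a t)) fun s t hst => ?_
    simp only [Prod.mk.injEq] at hst
    by_contra hne
    have hne' : (s : ℕ → ZMod 2) + t ≠ 0 := by
      intro h
      refine hne (Subtype.ext ?_)
      have h2 : (t : ℕ → ZMod 2) + t = 0 := by
        ext k; exact CharTwo.add_self_eq_zero _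
      exact add_right_cancel (h.trans h2.symm)
    have h1 := hkey (s + t) (fun x => v s x * v t x) hne' ((hv s).mul (hv t))
      (fun x => by rw [abs_mul, hv1, hv1, one_mul]) (by
        filter_upwards [hvc s, hvc t] with x h1 h2
        rw [hεadd, h1, h2, hst.1]
        split_ifs <;> ring)
    have hsub : {x | v s x * v t x ≠ 1} ⊆ {x | v s x ≠ 1} ∆ {x | v t x ≠ 1} := by
      intro x hx
      have h3 := eq_or_eq_neg_of_abs_eq (hv1 s x)
      have h4 := eq_or_eq_neg_of_abs_eq (hv1 t x)
      simp only [Set.mem_ofPred_eq, Set.mem_symmDiff] at hx ⊢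
      rcases h3 with h3 | h3 <;> rcases h4 with h4 | h4 <;> rw [h3, h4] at hx ⊢ <;>
        first
        | norm_num; done
        | exact absurd (by norm_num) hx
    have h2 := measureReal_symmDiff_triangle (μ := μ) {x | v s x ≠ 1} (a s) {x | v t x ≠ 1}
    have h3 := hva s
    have h4 := hva t
    rw [← hst.2, symmDiff_comm] at h4
    have h5 := measureReal_mono (μ := μ) hsub
    linarith
  -- choose a linearly independent sequence modulo the quasi-coboundaries
  have hinf : ¬ Module.Finite (ZMod 2) ((ℕ → ZMod 2) ⧸ Q) := by
    intro h
    have h1 : Finite ((ℕ → ZMod 2) ⧸ Q) := Module.finite_of_finite (ZMod 2)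
    have h2 : Countable (((ℕ → ZMod 2) ⧸ Q.toAddSubgroup) × Q.toAddSubgroup) := by
      have h3 : Countable ((ℕ → ZMod 2) ⧸ Q.toAddSubgroup) :=
        (inferInstance : Countable ((ℕ → ZMod 2) ⧸ Q))
      have h4 : Countable Q.toAddSubgroup := hQc
      infer_instance
    have h5 : Countable (ℕ → ZMod 2) :=
      (AddSubgroup.addGroupEquivQuotientProdAddSubgroup (s := Q.toAddSubgroup)).injective.countable
    have h6 : Function.Injective fun (s : Set ℕ) (k : ℕ) => if k ∈ s then (1 : ZMod 2) else 0 := by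
      intro s s' hss
      ext k
      have h7 := congrFun hss k
      by_cases hk : k ∈ s <;> by_cases hk' : k ∈ s' <;> simp [hk, hk'] at h7 ⊢
    obtain ⟨f, hf⟩ := (h6.countable).exists_injective_nat
    exact Function.cantor_injective f hf
  obtain ⟨t, ht⟩ : ∃ t : ℕ → ℕ → ZMod 2, LinearIndependent (ZMod 2) fun j => Q.mkQ (t j) := by
    set b := Module.Basis.ofVectorSpace (ZMod 2) ((ℕ → ZMod 2) ⧸ Q)
    have hι : Infinite (Module.Basis.ofVectorSpaceIndex (ZMod 2) ((ℕ → ZMod 2) ⧸ Q)) := by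
      by_contra h
      rw [not_infinite_iff_finite] at h
      exact hinf (Module.Finite.of_basis b)
    set e := Infinite.natEmbedding (Module.Basis.ofVectorSpaceIndex (ZMod 2) ((ℕ → ZMod 2) ⧸ Q))
    choose t ht using fun j => Q.mkQ_surjective (b (e j))
    refine ⟨t, ?_⟩
    simp only [ht]
    exact b.linearIndependent.comp e e.injective
  refine ⟨fun x j => ∑ k ∈ κ x, t j k, measurable_pi_iff.2 fun j =>
    hκcomp fun s => ∑ k ∈ s, t j k, fun A hA hcob => ?_⟩
  -- The character `A` of φ is the weight of the sum of t j over `A`, which independence modulo `Q`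
  -- keeps out of `Q`.
  have h1 : ∑ j ∈ A, t j ∈ Q := by
    rw [hQmem]
    convert hcob using 2 with x
    simp only [hε, Finset.sum_apply]
    rw [Finset.sum_comm]
  obtain ⟨j, hj⟩ := hA
  have h2 := linearIndependent_iff'.1 ht A (fun _ => 1) (by
    simp only [one_smul]
    rw [← map_sum, Submodule.mkQ_apply, Submodule.Quotient.mk_eq_zero]
    exact h1) j hj
  exact one_ne_zero h2

end CocycleConstruction

/-! ### Isomorphism of atomless standard probability spaces. -/

section IsomorphismTheorem

open ProbabilityTheory

/-- The distribution function of an atomless measure transports it to Lebesgue measure. -/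
theorem map_cdf_eq_volume_restrict (ν : Measure ℝ) [IsProbabilityMeasure ν]
    [NullSingletonClass ν] : ν.map (cdf ν) = volume.restrict (Set.Icc 0 1) := by
  have hcont : Continuous (cdf ν) := by
    rw [continuous_iff_continuousAt]
    intro a
    rw [(monotone_cdf ν).continuousAt_iff_leftLim_eq_rightLim, StieltjesFunction.rightLim_eq]
    have h1 := (cdf ν).measure_singleton a
    rw [measure_cdf, measure_singleton] at h1
    have h2 := ENNReal.ofReal_eq_zero.1 h1.symm
    have h3 := (monotone_cdf ν).leftLim_le (le_refl a)
    linarith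
  have hfin : IsFiniteMeasure (ν.map (cdf ν)) := inferInstance
  refine Measure.ext_of_Iic _ _ fun t => ?_
  rw [Measure.map_apply hcont.measurable measurableSet_Iic,
    Measure.restrict_apply measurableSet_Iic]
  rcases lt_or_ge t 0 with ht0 | ht0
  · have h1 : (cdf ν) ⁻¹' Set.Iic t = ∅ := by
      ext x
      simp only [Set.mem_preimage, Set.mem_Iic, Set.mem_empty_iff_false, iff_false, not_le]
      exact ht0.trans_le (cdf_nonneg ν x)
    have h2 : Set.Iic t ∩ Set.Icc (0 : ℝ) 1 = ∅ := by
      ext x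
      simp only [Set.mem_inter_iff, Set.mem_Iic, Set.mem_Icc, Set.mem_empty_iff_false, iff_false]
      intro h; linarith [h.1, h.2.1]
    rw [h1, h2, measure_empty, measure_empty]
  rcases le_or_gt 1 t with ht1 | ht1
  · have h1 : (cdf ν) ⁻¹' Set.Iic t = Set.univ :=
      Set.eq_univ_of_forall fun x => (cdf_le_one ν x).trans ht1
    have h2 : Set.Iic t ∩ Set.Icc (0 : ℝ) 1 = Set.Icc 0 1 :=
      Set.inter_eq_right.2 fun x hx => hx.2.trans ht1
    rw [h1, h2, measure_univ, Real.volume_Icc]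
    norm_num
  have h2 : Set.Iic t ∩ Set.Icc (0 : ℝ) 1 = Set.Icc 0 t := by
    ext x
    simp only [Set.mem_inter_iff, Set.mem_Iic, Set.mem_Icc]
    constructor
    · rintro ⟨h1, h2, h3⟩; exact ⟨h2, h1⟩
    · rintro ⟨h1, h2⟩; exact ⟨h2, h1, h2.trans ht1.le⟩
  rw [h2, Real.volume_Icc, sub_zero]
  set s := (cdf ν) ⁻¹' Set.Iic t with hs
  rcases s.eq_empty_or_nonempty with hemp | hne
  · have : t = 0 := by
      refine le_antisymm (not_lt.1 fun ht => ?_) ht0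
      obtain ⟨x, hx⟩ := ((tendsto_order.1 (tendsto_cdf_atBot ν)).2 t ht).exists
      exact (Set.eq_empty_iff_forall_notMem.1 hemp x) (show cdf ν x ≤ t from hx.le)
    rw [hemp, this]; simp
  have hbdd : BddAbove s := by
    obtain ⟨b, hb⟩ := ((tendsto_order.1 (tendsto_cdf_atTop ν)).1 t ht1).exists
    refine ⟨b, fun x hx => not_lt.1 fun hbx => ?_⟩
    exact absurd (hb.trans_le ((monotone_cdf ν) hbx.le)) (not_lt.2 hx)
  have hclosed : IsClosed s := isClosed_Iic.preimage hcont
  have hmem : sSup s ∈ s := hclosed.csSup_mem hne hbdd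
  have hsI : s = Set.Iic (sSup s) := by
    ext x
    exact ⟨fun hx => le_csSup hbdd hx, fun hx => ((monotone_cdf ν) hx).trans hmem⟩
  -- Otherwise continuity would put points beyond the supremum into s.
  have heq : cdf ν (sSup s) = t := by
    refine le_antisymm hmem (not_lt.1 fun hlt => ?_)
    have h3 : ∀ᶠ x in 𝓝[>] (sSup s), cdf ν x < t :=
      ((tendsto_order.1 (hcont.tendsto (sSup s))).2 t hlt).filter_mono nhdsWithin_le_nhds
    obtain ⟨x, hx1, hx2⟩ := (h3.and self_mem_nhdsWithin).exists
    exact absurd (le_csSup hbdd (show x ∈ s from hx1.le)) (not_le.2 hx2)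
  rw [hsI, ← ofReal_cdf, heq]

/-- An atomless standard probability space maps to the unit interval with Lebesgue measure,
injectively outside a null set. -/
theorem exists_measurePreserving_injOn (X : Type*) [MeasurableSpace X] [StandardBorelSpace X]
    (μ : Measure X) [IsProbabilityMeasure μ] [NullSingletonClass μ] :
    ∃ (F : X → ℝ) (N : Set X), Measurable F ∧ MeasurableSet N ∧ μ N = 0 ∧ Set.InjOn F Nᶜ ∧
      μ.map F = volume.restrict (Set.Icc 0 1) := by
  set e := embeddingReal X
  have he : MeasurableEmbedding e := measurableEmbedding_embeddingReal X
  set ν := μ.map e with hν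
  have : IsProbabilityMeasure ν := Measure.isProbabilityMeasure_map he.measurable.aemeasurable
  have : NullSingletonClass ν := ⟨fun x => by
    rw [hν, he.map_apply]
    exact Set.Subsingleton.measure_zero
      (fun a ha b hb => he.injective ((show e a = x from ha).trans (show e b = x from hb).symm)) μ⟩
  have hFm : Measurable (cdf ν) := (monotone_cdf ν).measurable
  have hmap := map_cdf_eq_volume_restrict ν
  -- The distribution function fails to be injective only on flat intervals; each contains a
  -- rational, so removing the levels of the rationals is enough.
  have hN : MeasurableSet (⋃ q : ℚ, cdf ν ⁻¹' {cdf ν q}) :=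
    .iUnion fun q => hFm (measurableSet_singleton _)
  have hN0 : ν (⋃ q : ℚ, cdf ν ⁻¹' {cdf ν q}) = 0 := by
    refine measure_iUnion_null fun q => ?_
    rw [← Measure.map_apply hFm (measurableSet_singleton _), hmap, measure_singleton]
  have hinj : Set.InjOn (cdf ν) (⋃ q : ℚ, cdf ν ⁻¹' {cdf ν q})ᶜ := by
    have key : ∀ x y, x ∉ (⋃ q : ℚ, cdf ν ⁻¹' {cdf ν q}) → x < y → cdf ν x ≠ cdf ν y := by
      intro x y hx hxy heq
      obtain ⟨q, hq1, hq2⟩ := exists_rat_btwn hxy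
      refine hx (Set.mem_iUnion.2 ⟨q, le_antisymm ((monotone_cdf ν) hq1.le) ?_⟩)
      rw [heq]
      exact (monotone_cdf ν) hq2.le
    intro x hx y hy hxy
    rcases lt_trichotomy x y with h | h | h
    · exact absurd hxy (key x y hx h)
    · exact h
    · exact absurd hxy.symm (key y x hy h)
  refine ⟨cdf ν ∘ e, e ⁻¹' (⋃ q : ℚ, cdf ν ⁻¹' {cdf ν q}), hFm.comp he.measurable,
    he.measurable hN, ?_, ?_, ?_⟩
  · rw [← he.map_apply, hN0]
  · intro x hx y hy hxy
    exact he.injective (hinj hx hy hxy)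
  · rw [← Measure.map_map hFm he.measurable, hmap]

/-- An uncountable standard Borel space with a finite measure has an uncountable null set. -/
theorem exists_uncountable_null_set (X : Type*) [MeasurableSpace X] [StandardBorelSpace X]
    (hX : ¬ Countable X) (μ : Measure X) [IsFiniteMeasure μ] :
    ∃ K, MeasurableSet K ∧ ¬ K.Countable ∧ μ K = 0 := by
  have hR : ¬ Countable (ℝ × ℝ) := fun h =>
    not_countable (α := ℝ) ((Prod.mk_right_injective (0 : ℝ)).countable)
  let e : X ≃ᵐ ℝ × ℝ := PolishSpace.measurableEquivOfNotCountable hX hR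
  have hg : Measurable fun x => (e x).1 := e.measurable.fst
  -- The vertical lines are disjoint and uncountable in number, so one of them is null.
  obtain ⟨t, ht⟩ := ((Measure.countable_meas_level_set_pos (μ := μ) hg).dense_compl ℝ).nonempty
  refine ⟨{x | (e x).1 = t}, hg (measurableSet_singleton t), fun hc => ?_, by simpa using ht⟩
  have := hc.to_subtype
  refine not_countable (α := ℝ) (Function.Injective.countable (β := {x | (e x).1 = t})
    (f := fun y => ⟨e.symm (t, y), by simp⟩) fun y z hyz => ?_)
  simpa using hyz

/-- The part of a space lying over a subset of `ℝ` onto which it maps injectively. -/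
theorem exists_measurableEquiv_preimage {X : Type*} [MeasurableSpace X] [StandardBorelSpace X]
    (μ : Measure X) {lam : Measure ℝ} {F : X → ℝ} {N : Set X} (hF : Measurable F)
    (hN : MeasurableSet N) (hN0 : μ N = 0) (hi : Set.InjOn F Nᶜ) (hmap : μ.map F = lam)
    {J K : Set ℝ} (hJm : MeasurableSet J) (hJ0 : lam Jᶜ = 0) (hKc : ¬ K.Countable)
    (hJK : Disjoint J K) (hJN : J ⊆ F '' Nᶜ) (hKN : K ⊆ F '' Nᶜ) :
    ∃ A : Set X, A ⊆ Nᶜ ∧ MeasurableSet A ∧ μ Aᶜ = 0 ∧ ¬ Countable (Aᶜ : Set X) ∧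
      ∃ e : A ≃ᵐ J, ∀ x, (e x : ℝ) = F x := by
  have hAm : MeasurableSet (Nᶜ ∩ F ⁻¹' J) := hN.compl.inter (hF hJm)
  refine ⟨Nᶜ ∩ F ⁻¹' J, Set.inter_subset_left, hAm, ?_, fun hc => ?_, ?_⟩
  · rw [Set.compl_inter, compl_compl]
    refine measure_union_null hN0 ?_
    rw [← Set.preimage_compl, ← Measure.map_apply hF hJm.compl, hmap, hJ0]
  · refine hKc (((Set.countable_coe_iff.1 hc).image F).mono fun y hy => ?_)
    obtain ⟨x, hx, rfl⟩ := hKN hy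
    exact ⟨x, fun h => Set.disjoint_left.1 hJK h.2 hy, rfl⟩
  · have : StandardBorelSpace (Nᶜ ∩ F ⁻¹' J : Set X) := hAm.standardBorel
    set f : (Nᶜ ∩ F ⁻¹' J : Set X) → J := fun x => ⟨F x, x.2.2⟩ with hf
    have hfm : Measurable f := (hF.comp measurable_subtype_coe).subtype_mk
    have hfi : Function.Injective f := fun x y hxy =>
      Subtype.ext (hi x.2.1 y.2.1 (congrArg Subtype.val hxy))
    have hfs : Function.Surjective f := by
      rintro ⟨y, hy⟩
      obtain ⟨x, hx, rfl⟩ := hJN hy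
      exact ⟨⟨x, hx, hy⟩, rfl⟩
    have hemb : MeasurableEmbedding f := hfm.measurableEmbedding hfi
    exact ⟨⟨Equiv.ofBijective f ⟨hfi, hfs⟩, hfm, fun t ht => by
      rw [← Equiv.image_eq_preimage_symm]
      exact hemb.measurableSet_image.2 ht⟩, fun x => rfl⟩

theorem measure_eq_of_forall_mem_iff {X : Type*} [MeasurableSpace X] (μ : Measure X)
    {A B B' : Set X} (hA : μ Aᶜ = 0) (h : ∀ x ∈ A, x ∈ B ↔ x ∈ B') : μ B = μ B' := by
  refine measure_congr ?_
  filter_upwards [measure_eq_zero_iff_ae_notMem.1 hA] with x hx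
  exact propext (h x (not_not.1 hx))

/-- Any two atomless standard probability spaces are isomorphic. -/
theorem exists_measurableEquiv_measurePreserving {X₁ X₂ : Type*}
    [MeasurableSpace X₁] [StandardBorelSpace X₁] [MeasurableSpace X₂] [StandardBorelSpace X₂]
    (μ₁ : Measure X₁) [IsProbabilityMeasure μ₁] [NullSingletonClass μ₁]
    (μ₂ : Measure X₂) [IsProbabilityMeasure μ₂] [NullSingletonClass μ₂] :
    ∃ e : X₁ ≃ᵐ X₂, MeasurePreserving e μ₁ μ₂ := by
  classical
  obtain ⟨lam, hlam⟩ : ∃ lam : Measure ℝ, lam = volume.restrict (Set.Icc 0 1) := ⟨_, rfl⟩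
  have hlamfin : IsFiniteMeasure lam := by rw [hlam]; infer_instance
  have hlamsing : NullSingletonClass lam := by rw [hlam]; infer_instance
  obtain ⟨F₁, N₁, hF₁, hN₁, hN₁0, hi₁, hmap₁⟩ := exists_measurePreserving_injOn X₁ μ₁
  obtain ⟨F₂, N₂, hF₂, hN₂, hN₂0, hi₂, hmap₂⟩ := exists_measurePreserving_injOn X₂ μ₂
  rw [← hlam] at hmap₁ hmap₂
  have hI₁ : MeasurableSet (F₁ '' N₁ᶜ) := hN₁.compl.image_of_measurable_injOn hF₁ hi₁
  have hI₂ : MeasurableSet (F₂ '' N₂ᶜ) := hN₂.compl.image_of_measurable_injOn hF₂ hi₂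
  have hI₁0 : lam (F₁ '' N₁ᶜ)ᶜ = 0 := by
    rw [← hmap₁, Measure.map_apply hF₁ hI₁.compl]
    exact measure_mono_null (fun x hx => not_not.1 fun h => hx ⟨x, h, rfl⟩) hN₁0
  have hI₂0 : lam (F₂ '' N₂ᶜ)ᶜ = 0 := by
    rw [← hmap₂, Measure.map_apply hF₂ hI₂.compl]
    exact measure_mono_null (fun x hx => not_not.1 fun h => hx ⟨x, h, rfl⟩) hN₂0
  set I := F₁ '' N₁ᶜ ∩ F₂ '' N₂ᶜ with hI
  have hIm : MeasurableSet I := hI₁.inter hI₂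
  have hI0 : lam Iᶜ = 0 := by
    rw [hI, Set.compl_inter]
    exact measure_union_null hI₁0 hI₂0
  -- An uncountable null set is set aside so that both leftover sets are uncountable, hence Borel
  -- isomorphic; the isomorphism is then defined at every point.
  obtain ⟨K, hKm, hKI, hKc, hK0⟩ : ∃ K, MeasurableSet K ∧ K ⊆ I ∧ ¬ K.Countable ∧ lam K = 0 := by
    have hunc : ¬ Countable I := by
      intro h
      have h1 : lam I = 0 := (Set.countable_coe_iff.1 h).measure_zero lam
      have h2 : lam Set.univ = 0 := by
        rw [← Set.union_compl_self I]
        exact measure_union_null h1 hI0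
      rw [hlam] at h2
      simp at h2
    have : StandardBorelSpace I := hIm.standardBorel
    obtain ⟨K, hK, hKc, hK0⟩ := exists_uncountable_null_set I hunc (lam.comap Subtype.val)
    refine ⟨Subtype.val '' K, hIm.subtype_image hK, Subtype.coe_image_subset _ _, fun h => hKc ?_, ?_⟩
    · exact Set.countable_of_injective_of_countable_image Subtype.val_injective.injOn h
    · rwa [(MeasurableEmbedding.subtype_coe hIm).comap_apply] at hK0
  set J := I \ K with hJ
  have hJm : MeasurableSet J := hIm.diff hKm
  have hJ0 : lam Jᶜ = 0 := by
    have : Jᶜ ⊆ Iᶜ ∪ K := by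
      intro x hx
      by_cases h : x ∈ I
      · exact .inr (not_not.1 fun hK => hx ⟨h, hK⟩)
      · exact .inl h
    exact measure_mono_null this (measure_union_null hI0 hK0)
  obtain ⟨A₁, hs₁, hA₁, hA₁0, hA₁c, e₁, he₁⟩ :=
    exists_measurableEquiv_preimage μ₁ hF₁ hN₁ hN₁0 hi₁ hmap₁ hJm hJ0 hKc Set.disjoint_sdiff_left
      (Set.sdiff_subset.trans Set.inter_subset_left) (hKI.trans Set.inter_subset_left)
  obtain ⟨A₂, hs₂, hA₂, hA₂0, hA₂c, e₂, he₂⟩ :=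
    exists_measurableEquiv_preimage μ₂ hF₂ hN₂ hN₂0 hi₂ hmap₂ hJm hJ0 hKc Set.disjoint_sdiff_left
      (Set.sdiff_subset.trans Set.inter_subset_right) (hKI.trans Set.inter_subset_right)
  have : StandardBorelSpace (A₁ᶜ : Set X₁) := hA₁.compl.standardBorel
  have : StandardBorelSpace (A₂ᶜ : Set X₂) := hA₂.compl.standardBorel
  let c : (A₁ᶜ : Set X₁) ≃ᵐ (A₂ᶜ : Set X₂) := PolishSpace.measurableEquivOfNotCountable hA₁c hA₂c
  let e : X₁ ≃ᵐ X₂ := (MeasurableEquiv.sumCompl hA₁).symm.trans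
    (((e₁.trans e₂.symm).sumCongr c).trans (MeasurableEquiv.sumCompl hA₂))
  have hemem : ∀ x (hx : x ∈ A₁), e x = e₂.symm (e₁ ⟨x, hx⟩) := by
    intro x hx
    have h1 : (MeasurableEquiv.sumCompl hA₁).symm x = Sum.inl ⟨x, hx⟩ := by
      rw [MeasurableEquiv.symm_apply_eq]; rfl
    simp only [e, MeasurableEquiv.trans_apply, h1]
    rfl
  refine ⟨e, e.measurable, ?_⟩
  ext C hC
  rw [Measure.map_apply e.measurable hC]
  set T := F₂ '' (C ∩ A₂) with hT
  have hTm : MeasurableSet T := (hC.inter hA₂).image_of_measurable_injOn hF₂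
    (hi₂.mono fun x hx => hs₂ hx.2)
  have h1 : μ₁ (e ⁻¹' C) = μ₁ (F₁ ⁻¹' T) := by
    refine measure_eq_of_forall_mem_iff μ₁ hA₁0 fun x hx => ?_
    have h2 : F₂ (e x) = F₁ x := by
      rw [hemem x hx, ← he₂, MeasurableEquiv.apply_symm_apply, he₁]
    have h3 : e x ∈ A₂ := by rw [hemem x hx]; exact Subtype.coe_prop _
    constructor
    · intro hxC
      exact ⟨e x, ⟨hxC, h3⟩, h2⟩
    · rintro ⟨y, ⟨hyC, hyA⟩, hy⟩
      have : y = e x := hi₂ (hs₂ hyA) (hs₂ h3) (hy.trans h2.symm)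
      rw [Set.mem_preimage, ← this]; exact hyC
  have h2 : μ₂ C = μ₂ (F₂ ⁻¹' T) := by
    refine measure_eq_of_forall_mem_iff μ₂ hA₂0 fun x hx => ⟨fun h => ⟨x, ⟨h, hx⟩, rfl⟩, ?_⟩
    rintro ⟨y, ⟨hyC, hyA⟩, hy⟩
    rwa [← hi₂ (hs₂ hyA) (hs₂ hx) hy]
  rw [h1, h2, ← Measure.map_apply hF₁ hTm, ← Measure.map_apply hF₂ hTm, hmap₁, hmap₂]

end IsomorphismTheorem

/-! ### Automorphisms and the Halmos topology. -/

theorem fst_iterate {X : Type*} {R : X × X → X × X} {f : X → X} (hR : ∀ z, (R z).1 = f z.1) (n : ℕ)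
    (z : X × X) : (R^[n] z).1 = f^[n] z.1 := by
  induction n generalizing z with
  | zero => rfl
  | succ n ih => rw [Function.iterate_succ_apply, ih, hR, Function.iterate_succ_apply]

section Halmos

variable {X : Type*} [MeasurableSpace X] {μ : Measure X}

namespace MPAut

/-- The identity automorphism. -/
def refl (μ : Measure X) : MPAut μ := ⟨MeasurableEquiv.refl X, MeasurePreserving.id μ⟩

/-- The inverse of an automorphism. -/
def inv (T : MPAut μ) : MPAut μ := ⟨T.toEquiv.symm, T.measurePreserving.symm T.toEquiv⟩

/-- The composition of automorphisms. -/
def comp (T Q : MPAut μ) : MPAut μ :=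
  ⟨Q.toEquiv.trans T.toEquiv, T.measurePreserving.comp Q.measurePreserving⟩

/-- The powers of an automorphism. -/
def iter (T : MPAut μ) : ℕ → MPAut μ
  | 0 => refl μ
  | n + 1 => comp (iter T n) T

@[simp] theorem comp_apply (T Q : MPAut μ) (x : X) : T.comp Q x = T (Q x) := rfl

@[simp] theorem inv_apply_self (T : MPAut μ) (x : X) : T.inv (T x) = x :=
  T.toEquiv.symm_apply_apply x

@[simp] theorem self_apply_inv (T : MPAut μ) (x : X) : T (T.inv x) = x :=
  T.toEquiv.apply_symm_apply x

theorem coe_iter (T : MPAut μ) (n : ℕ) : (T.iter n : X → X) = (T : X → X)^[n] := by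
  induction n with
  | zero => rfl
  | succ n ih =>
    rw [Function.iterate_succ, ← ih]
    rfl

theorem measurable (T : MPAut μ) : Measurable (T : X → X) := T.toEquiv.measurable

/-- Automorphisms preserving the fibres of `L` are glued along these fibres. -/
noncomputable def glue (Θ : ℕ → MPAut μ) (L : X → ℕ) (hL : Measurable L)
    (hΘ : ∀ i x, L (Θ i x) = L x) : MPAut μ :=
  have hΘ' : ∀ i x, L ((Θ i).inv x) = L x := fun i x => by
    rw [← hΘ i, self_apply_inv]
  have hm : ∀ Θ : ℕ → MPAut μ, Measurable fun x => Θ (L x) x := fun Θ =>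
    (measurable_from_prod_countable_right (f := fun p : ℕ × X => Θ p.1 p.2)
      fun i => (Θ i).measurable).comp (hL.prodMk measurable_id)
  { toEquiv :=
    { toFun := fun x => Θ (L x) x
      invFun := fun x => (Θ (L x)).inv x
      left_inv := fun x => by simp [hΘ]
      right_inv := fun x => by simp [hΘ']
      measurable_toFun := hm Θ
      measurable_invFun := hm fun i => (Θ i).inv }
    measurePreserving := by
      refine ⟨hm Θ, ?_⟩
      ext C hC
      have hd : ∀ D : ℕ → Set X, Pairwise (Function.onFun Disjoint fun i => L ⁻¹' {i} ∩ D i) :=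
        fun D i j hij => Set.disjoint_left.2 fun x hx hy => hij (hx.1.symm.trans hy.1)
      have h1 : (fun x => Θ (L x) x) ⁻¹' C = ⋃ i, L ⁻¹' {i} ∩ (Θ i ⁻¹' C) := by
        ext x; simp
      have h2 : C = ⋃ i, L ⁻¹' {i} ∩ C := by
        ext x; simp
      refine (Measure.map_apply (hm Θ) hC).trans ?_
      refine (congrArg μ h1).trans (Eq.trans ?_ (congrArg μ h2).symm)
      have hLi : ∀ i, MeasurableSet (L ⁻¹' {i}) := fun i => hL (measurableSet_singleton i)
      rw [measure_iUnion (hd _) fun i => (hLi i).inter ((Θ i).measurable hC),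
        measure_iUnion (hd _) fun i => (hLi i).inter hC]
      refine tsum_congr fun i => ?_
      rw [← (Θ i).measurePreserving.measure_preimage ((hLi i).inter hC).nullMeasurableSet,
        Set.preimage_inter]
      congr 2
      ext x
      change L x = i ↔ L (Θ i x) = i
      rw [hΘ] }

theorem glue_apply (Θ : ℕ → MPAut μ) (L : X → ℕ) (hL : Measurable L)
    (hΘ : ∀ i x, L (Θ i x) = L x) (x : X) : glue Θ L hL hΘ x = Θ (L x) x := rfl

end MPAut

/-- Images differ by at most 2ε and preimages by at most ε, together less than 4ε, and the weights
sum to 2. -/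
theorem halmosDist_le_of_measureReal_ne_le [IsProbabilityMeasure μ] (A : ℕ → Set X)
    (R Q : MPAut μ) {ε : ℝ} (h : μ.real {x | R x ≠ Q x} ≤ ε) : halmosDist A R Q ≤ 8 * ε := by
  have himg : ∀ (T : MPAut μ) (D : Set X), μ.real (T '' D) = μ.real D := fun T D => by
    have h1 : μ (T.toEquiv.symm ⁻¹' D) = μ D :=
      (T.measurePreserving.symm T.toEquiv).measure_preimage_equiv D
    rw [← T.toEquiv.image_eq_preimage_symm] at h1
    rw [measureReal_def, measureReal_def, ← h1]
  have h1 : ∀ i, halmosTerm A R Q i ≤ (1 / 2 : ℝ) ^ i * (4 * ε) := by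
    intro i
    refine mul_le_mul_of_nonneg_left ?_ (by positivity)
    have h2 : μ.real ((R '' A i) ∆ (Q '' A i)) ≤ 2 * ε := by
      have hsub : (R '' A i) ∆ (Q '' A i) ⊆ R '' {x | R x ≠ Q x} ∪ Q '' {x | R x ≠ Q x} := by
        rintro y (⟨⟨x, hx, rfl⟩, hy⟩ | ⟨⟨x, hx, rfl⟩, hy⟩)
        · exact .inl ⟨x, fun he => hy ⟨x, hx, he.symm⟩, rfl⟩
        · exact .inr ⟨x, fun he => hy ⟨x, hx, he⟩, rfl⟩
      have := (measureReal_mono (μ := μ) hsub).trans (measureReal_union_le _ _)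
      rw [himg, himg] at this
      linarith
    have h3 : μ.real ((R.toEquiv.symm '' A i) ∆ (Q.toEquiv.symm '' A i)) ≤ ε := by
      refine (measureReal_mono ?_).trans h
      rw [R.toEquiv.symm.image_eq_preimage_symm, Q.toEquiv.symm.image_eq_preimage_symm]
      rintro x (⟨hx, hy⟩ | ⟨hx, hy⟩) he
      · exact hy (show Q x ∈ A i from he ▸ hx)
      · exact hy (show R x ∈ A i from he ▸ hx)
    linarith [measureReal_nonneg.trans h]
  calc halmosDist A R Q ≤ ∑' i : ℕ, (1 / 2 : ℝ) ^ i * (4 * ε) :=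
        (summable_halmosTerm A R Q).tsum_le_tsum h1 (summable_geometric_two.mul_right _)
    _ = 8 * ε := by rw [tsum_mul_right, tsum_geometric_two]; ring

/-- A single term of the Halmos series controls the preimages of A l, and A l approximates C
uniformly in R since R preserves the measure. -/
theorem exists_measureReal_preimage_symmDiff_lt [IsProbabilityMeasure μ] {A : ℕ → Set X}
    (hA : μ.MeasureDense (Set.range A)) (Q : MPAut μ) {C : Set X} (hC : MeasurableSet C)
    {η : ℝ} (hη : 0 < η) :
    ∃ δ > 0, ∀ R : MPAut μ, halmosDist A R Q < δ → μ.real ((R ⁻¹' C) ∆ (Q ⁻¹' C)) < η := by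
  obtain ⟨_, ⟨l, rfl⟩, hl⟩ := hA.approx C hC (measure_ne_top _ _) (η / 3) (by positivity)
  have hAl := hA.measurable _ ⟨l, rfl⟩
  have hl' : μ.real (C ∆ A l) < η / 3 := by
    rw [measureReal_def]
    exact ENNReal.toReal_lt_of_lt_ofReal hl
  refine ⟨(1 / 2 : ℝ) ^ l * (η / 3), by positivity, fun R hR => ?_⟩
  have h1 : halmosTerm A R Q l < (1 / 2 : ℝ) ^ l * (η / 3) :=
    ((summable_halmosTerm A R Q).le_tsum l fun i _ => halmosTerm_nonneg A R Q i).trans_lt hR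
  have h2 := lt_of_mul_lt_mul_left h1 (by positivity)
  rw [R.toEquiv.symm.image_eq_preimage_symm, Q.toEquiv.symm.image_eq_preimage_symm] at h2
  have h3 : μ.real ((R ⁻¹' A l) ∆ (Q ⁻¹' A l)) < η / 3 :=
    lt_of_le_of_lt (le_add_of_nonneg_left measureReal_nonneg) h2
  have h4 := R.measurePreserving.measureReal_symmDiff_preimage hC hAl
  have h5 := Q.measurePreserving.measureReal_symmDiff_preimage hAl hC
  rw [symmDiff_comm (A l)] at h5
  have h6 := measureReal_symmDiff_triangle (μ := μ) (R ⁻¹' C) (R ⁻¹' A l) (Q ⁻¹' C)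
  have h7 := measureReal_symmDiff_triangle (μ := μ) (R ⁻¹' A l) (Q ⁻¹' A l) (Q ⁻¹' C)
  linarith

/-- Iterates depend continuously on the automorphism; the induction moves one factor at a time. -/
theorem exists_measureReal_iterate_preimage_symmDiff_lt [IsProbabilityMeasure μ] {A : ℕ → Set X}
    (hA : μ.MeasureDense (Set.range A)) (Q : MPAut μ) {C : Set X} (hC : MeasurableSet C) (i : ℕ)
    {η : ℝ} (hη : 0 < η) :
    ∃ δ > 0, ∀ R : MPAut μ, halmosDist A R Q < δ →
      μ.real (((R : X → X)^[i] ⁻¹' C) ∆ ((Q : X → X)^[i] ⁻¹' C)) < η := by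
  induction i generalizing η with
  | zero => exact ⟨1, one_pos, fun R _ => by simpa using hη⟩
  | succ i ih =>
    obtain ⟨δ₁, hδ₁, h₁⟩ := ih (half_pos hη)
    have hm : ∀ R : MPAut μ, MeasurableSet ((R : X → X)^[i] ⁻¹' C) := fun R =>
      (R.measurePreserving_iterate i).measurable hC
    obtain ⟨δ₂, hδ₂, h₂⟩ := exists_measureReal_preimage_symmDiff_lt hA Q (hm Q) (half_pos hη)
    refine ⟨min δ₁ δ₂, lt_min hδ₁ hδ₂, fun R hR => ?_⟩
    have h3 := h₁ R (hR.trans_le (min_le_left _ _))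
    have h4 := h₂ R (hR.trans_le (min_le_right _ _))
    rw [← R.measurePreserving.measureReal_symmDiff_preimage (hm R) (hm Q)] at h3
    rw [Function.iterate_succ, Function.iterate_succ, Set.preimage_comp, Set.preimage_comp]
    have := measureReal_symmDiff_triangle (μ := μ) (R ⁻¹' ((R : X → X)^[i] ⁻¹' C))
      (R ⁻¹' ((Q : X → X)^[i] ⁻¹' C)) (Q ⁻¹' ((Q : X → X)^[i] ⁻¹' C))
    linarith

/-- A null set lies in a measurable null set invariant under two given automorphisms. -/
theorem exists_invariant_null_superset (R P : MPAut μ) {N : Set X} (hN : μ N = 0) :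
    ∃ M, N ⊆ M ∧ MeasurableSet M ∧ μ M = 0 ∧ (∀ x, R x ∈ M ↔ x ∈ M) ∧ ∀ x, P x ∈ M ↔ x ∈ M := by
  let step : Set X → Set X := fun M =>
    M ∪ R ⁻¹' M ∪ R.inv ⁻¹' M ∪ (P ⁻¹' M ∪ P.inv ⁻¹' M)
  let M : ℕ → Set X := fun n => step^[n] (toMeasurable μ N)
  have hsucc : ∀ n, M (n + 1) = step (M n) := fun n => Function.iterate_succ_apply' _ _ _
  have hMm : ∀ n, MeasurableSet (M n) := by
    intro n
    induction n with
    | zero => exact measurableSet_toMeasurable _ _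
    | succ n ih =>
      rw [hsucc]
      exact ((ih.union (R.measurable ih)).union (R.inv.measurable ih)).union
        ((P.measurable ih).union (P.inv.measurable ih))
  have hM0 : ∀ n, μ (M n) = 0 := by
    intro n
    induction n with
    | zero => exact (measure_toMeasurable _).trans hN
    | succ n ih =>
      have h : ∀ T : MPAut μ, μ (T ⁻¹' M n) = 0 := fun T => by
        rw [T.measurePreserving.measure_preimage (hMm n).nullMeasurableSet, ih]
      rw [hsucc]
      exact measure_union_null (measure_union_null (measure_union_null ih (h R)) (h R.inv))
        (measure_union_null (h P) (h P.inv))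
  refine ⟨⋃ n, M n, (subset_toMeasurable μ N).trans (Set.subset_iUnion M 0), .iUnion hMm,
    measure_iUnion_null hM0, fun x => ⟨fun h => ?_, fun h => ?_⟩, fun x => ⟨fun h => ?_, fun h => ?_⟩⟩
  all_goals
    obtain ⟨n, hn⟩ := Set.mem_iUnion.1 h
    refine Set.mem_iUnion.2 ⟨n + 1, ?_⟩
    rw [hsucc]
  · exact .inl (.inl (.inr hn))
  · refine .inl (.inr ?_)
    rw [Set.mem_preimage, MPAut.inv_apply_self]; exact hn
  · exact .inr (.inl hn)
  · refine .inr (.inr ?_)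
    rw [Set.mem_preimage, MPAut.inv_apply_self]; exact hn

theorem MPAut.iterate_inv_iterate (T : MPAut μ) (n : ℕ) (x : X) :
    (T : X → X)^[n] ((T.inv : X → X)^[n] x) = x :=
  Function.LeftInverse.iterate (f := T.inv) (g := T) T.self_apply_inv n x

theorem fst_inv {S : MPAut μ} {R : MPAut (μ.prod μ)} (hR : ∀ z, (R z).1 = S z.1) (z : X × X) :
    (R.inv z).1 = S.inv z.1 := by
  conv_rhs => rw [← R.self_apply_inv z, hR, S.inv_apply_self]

end Halmos

/-! ### Density of conjugates in Ext(S). -/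

section Conjugation

variable {X : Type*} [MeasurableSpace X] {μ : Measure X} [IsProbabilityMeasure μ] {S : MPAut μ}

/-- The direct product of `S` and the identity. -/
noncomputable def MPAut.prodRefl (S : MPAut μ) : MPAut (μ.prod μ) :=
  ⟨S.toEquiv.prodCongr (MeasurableEquiv.refl X), S.measurePreserving.prod (MeasurePreserving.id μ)⟩

/-- An extension agrees almost everywhere with an everywhere defined skew product. -/
theorem exists_skew_ae_eq {R : MPAut (μ.prod μ)} (hR : R ∈ ExtensionsOf S) :
    ∃ R' : MPAut (μ.prod μ), (∀ z, (R' z).1 = S z.1) ∧ μ.prod μ {z | R' z ≠ R z} = 0 := by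
  classical
  -- `R` is replaced by S × id on a null set that both preserve and that contains all points where
  -- `R` is not a skew product.
  obtain ⟨M, hNM, hM, hM0, hMR, hMP⟩ := exists_invariant_null_superset R S.prodRefl hR
  let Θ : ℕ → MPAut (μ.prod μ) := fun i => if i = 0 then R else S.prodRefl
  let L : X × X → ℕ := fun z => if z ∈ M then 1 else 0
  have hL : Measurable L := Measurable.ite hM measurable_const measurable_const
  have hΘ : ∀ i z, L (Θ i z) = L z := by
    intro i z
    by_cases hi : i = 0
    · simp [L, Θ, hi, hMR]
    · simp [L, Θ, hi, hMP]
  refine ⟨MPAut.glue Θ L hL hΘ, fun z => ?_, measure_mono_null (fun z hz => ?_) hM0⟩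
  · rw [MPAut.glue_apply]
    by_cases hz : z ∈ M
    · simp only [L, Θ, hz, if_true, one_ne_zero, if_false]
      rfl
    · simp only [L, Θ, hz, if_true, if_false]
      exact not_not.1 fun h => hz (hNM h)
  · by_contra hzM
    refine hz ?_
    rw [MPAut.glue_apply]
    simp only [L, Θ, hzM, if_true, if_false]

/-- The conjugates of a skew product by fibre-preserving automorphisms are dense. -/
theorem exists_conjugate_halmosDist_lt [StandardBorelSpace X] [NullSingletonClass μ]
    (hS : Ergodic (S : X → X) μ) {R₀ : MPAut (μ.prod μ)} (hR₀ : ∀ z, (R₀ z).1 = S z.1)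
    (A : ℕ → Set (X × X)) {R : MPAut (μ.prod μ)} (hR : R ∈ ExtensionsOf S) {ε : ℝ} (hε : 0 < ε) :
    ∃ Ψ : MPAut (μ.prod μ), (∀ z, (Ψ z).1 = z.1) ∧
      halmosDist A (Ψ.inv.comp (R₀.comp Ψ)) R < ε := by
  obtain ⟨R', hR', hRR'⟩ := exists_skew_ae_eq hR
  -- The bound ε/9 absorbs the factor 8 of `halmosDist_le_of_measureReal_ne_le` and leaves a strict
  -- inequality.
  obtain ⟨l, hl, hlS, -⟩ := exists_height_function hS
    (δ := ENNReal.ofReal (ε / 9)) (by simpa using hε)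
  -- With Ψ = R₀^l R'^(-l) the relation Ψ R' = R₀ Ψ holds wherever the height l grows by exactly
  -- one.
  let Θ : ℕ → MPAut (μ.prod μ) := fun i => (R₀.iter i).comp (R'.inv.iter i)
  have hΘ : ∀ i z, (Θ i z).1 = z.1 := by
    intro i z
    change ((R₀.iter i) ((R'.inv.iter i) z)).1 = z.1
    rw [MPAut.coe_iter, MPAut.coe_iter, fst_iterate hR₀, fst_iterate (fst_inv hR'),
      MPAut.iterate_inv_iterate]
  let Ψ := MPAut.glue Θ (fun z => l z.1) (hl.comp measurable_fst) fun i z => by rw [hΘ]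
  have hΨ : ∀ z, Ψ z = (R₀ : X × X → X × X)^[l z.1] ((R'.inv : X × X → X × X)^[l z.1] z) := by
    intro z
    change ((R₀.iter _) ((R'.inv.iter _) z)) = _
    rw [MPAut.coe_iter, MPAut.coe_iter]
  refine ⟨Ψ, fun z => hΘ _ _, ?_⟩
  have hsub : {z | Ψ.inv.comp (R₀.comp Ψ) z ≠ R z} ⊆
      {x | l (S x) ≠ l x + 1} ×ˢ Set.univ ∪ {z | R' z ≠ R z} := by
    intro z hz
    by_contra hcon
    simp only [Set.mem_union, Set.mem_prod, Set.mem_univ, and_true, not_or, Set.mem_ofPred_eq,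
      not_not] at hcon
    refine hz ?_
    rw [← hcon.2, MPAut.comp_apply, MPAut.comp_apply, ← Ψ.inv_apply_self (R' z)]
    congr 1
    rw [hΨ, hΨ, hR', hcon.1, Function.iterate_succ_apply', Function.iterate_succ_apply,
      MPAut.inv_apply_self]
  have hle : (μ.prod μ).real {z | Ψ.inv.comp (R₀.comp Ψ) z ≠ R z} ≤ ε / 9 := by
    rw [measureReal_def]
    refine ENNReal.toReal_le_of_le_ofReal (by positivity)
      ((measure_mono hsub).trans ((measure_union_le _ _).trans ?_))
    rw [hRR', Measure.prod_prod, measure_univ, mul_one, add_zero]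
    exact hlS
  linarith [halmosDist_le_of_measureReal_ne_le A _ _ hle]

end Conjugation

/-! ### Variance of conditional expectations. -/

section CondExpVariance

open ProbabilityTheory

variable {Z : Type*} {m m' mZ : MeasurableSpace Z} {ν : Measure Z} {f g : Z → ℝ}

/-- The variance of the conditional expectation of `f` on `m`. -/
noncomputable def condExpVar (m : MeasurableSpace Z) {mZ : MeasurableSpace Z} (ν : Measure Z)
    (f : Z → ℝ) : ℝ :=
  Var[ν[f | m]; ν]

theorem memLp_condExp (hf : MemLp f 2 ν) : MemLp (ν[f | m]) 2 ν :=
  hf.condExp (by norm_num)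

theorem condExpVar_const_mul (c : ℝ) :
    condExpVar m ν (fun z => c * f z) = c ^ 2 * condExpVar m ν f := by
  rw [condExpVar, condExpVar, ← variance_const_mul]
  exact variance_congr (condExp_smul c f m)

variable [IsProbabilityMeasure ν]

theorem condExpVar_le_integral_condExp_sq (hf : MemLp f 2 ν) :
    condExpVar m ν f ≤ ∫ z, (ν[f | m]) z ^ 2 ∂ν :=
  variance_le_expectation_sq (memLp_condExp hf).aestronglyMeasurable

/-- Law of total variance: conditioning does not increase the variance. -/
theorem condExpVar_le_integral_sq (hm : m ≤ mZ) (hf : MemLp f 2 ν) :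
    condExpVar m ν f ≤ ∫ z, f z ^ 2 ∂ν := by
  have h1 := integral_condVar_add_variance_condExp hm hf
  have h2 : 0 ≤ ∫ z, (Var[f; ν | m]) z ∂ν :=
    integral_nonneg_of_ae (condExp_nonneg (ae_of_all _ fun z => sq_nonneg _))
  have h3 : Var[f; ν] ≤ ∫ z, f z ^ 2 ∂ν := variance_le_expectation_sq hf.aestronglyMeasurable
  rw [condExpVar]
  linarith

/-- Parallelogram law, with the variance of the difference dropped. -/
theorem condExpVar_add_le (hf : MemLp f 2 ν) (hg : MemLp g 2 ν) :
    condExpVar m ν (f + g) ≤ 2 * condExpVar m ν f + 2 * condExpVar m ν g := by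
  have h1 := memLp_condExp (m := m) hf
  have h2 := memLp_condExp (m := m) hg
  have h3 : condExpVar m ν (f + g) = Var[ν[f | m] + ν[g | m]; ν] :=
    variance_congr (condExp_add (hf.integrable (by norm_num)) (hg.integrable (by norm_num)) m)
  have h4 := variance_add h1 h2
  have h5 := variance_sub h1 h2
  have h6 := variance_nonneg (ν[f | m] - ν[g | m]) ν
  rw [h3]
  simp only [condExpVar]
  linarith

/-- The conditional expectation on a factor commutes with the automorphism. -/
theorem IsFactor.condExp_comp {T : MPAut ν} (hT : IsFactor m T) (hf : Integrable f ν) :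
    ν[f ∘ T | m] =ᵐ[ν] ν[f | m] ∘ T := by
  have hm := hT.le
  have hTm : Measurable[m, m] (T : Z → Z) := fun B hB => (hT.invariant B).2 hB
  have hint : Integrable (ν[f | m] ∘ T) ν :=
    T.measurePreserving.integrable_comp_of_integrable integrable_condExp
  refine (ae_eq_condExp_of_forall_setIntegral_eq hm
    (T.measurePreserving.integrable_comp_of_integrable hf) (fun s _ _ => hint.integrableOn)
    (fun s hs _ => ?_) ?_).symm
  · have hs' : MeasurableSet[m] (T.toEquiv.symm ⁻¹' s) := by
      rw [← hT.invariant, ← Set.preimage_comp]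
      simpa using hs
    have h1 : s = T ⁻¹' (T.toEquiv.symm ⁻¹' s) := by
      rw [← Set.preimage_comp]; simp
    rw [h1]
    simp only [Function.comp_apply]
    rw [T.measurePreserving.setIntegral_preimage_emb T.toEquiv.measurableEmbedding,
      T.measurePreserving.setIntegral_preimage_emb T.toEquiv.measurableEmbedding,
      setIntegral_condExp hm hf hs']
  · exact (stronglyMeasurable_condExp.comp_measurable hTm).aestronglyMeasurable

theorem IsFactor.condExpVar_comp {T : MPAut ν} (hT : IsFactor m T) (hf : Integrable f ν) :
    condExpVar m ν (f ∘ T) = condExpVar m ν f := by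
  rw [condExpVar, variance_congr (hT.condExp_comp hf), condExpVar]
  have h1 : ∀ h : Z → ℝ, ∫ z, h (T z) ∂ν = ∫ z, h z ∂ν := fun h =>
    T.measurePreserving.integral_comp T.toEquiv.measurableEmbedding h
  have h2 : AEMeasurable (ν[f | m]) ν := integrable_condExp.aemeasurable
  rw [variance_eq_integral h2, variance_eq_integral
    (h2.comp_quasiMeasurePreserving T.measurePreserving.quasiMeasurePreserving)]
  simp only [Function.comp_apply]
  rw [h1, h1 fun z => ((ν[f | m]) z - ∫ z, (ν[f | m]) z ∂ν) ^ 2]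

/-- This invariance lets the variance for a factor be replaced by its average along the orbit. -/
theorem IsFactor.condExpVar_comp_iterate {T : MPAut ν} (hT : IsFactor m T) (hf : Integrable f ν)
    (i : ℕ) : condExpVar m ν (f ∘ (T : Z → Z)^[i]) = condExpVar m ν f := by
  induction i with
  | zero => rfl
  | succ i ih =>
    rw [Function.iterate_succ, ← Function.comp_assoc, hT.condExpVar_comp, ih]
    exact (T.measurePreserving_iterate i).integrable_comp_of_integrable hf

/-- By independence the conditional expectation is the constant mean. -/
theorem condExpVar_eq_zero_of_indep (hm : m ≤ mZ) (hm' : m' ≤ mZ)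
    (hf : StronglyMeasurable[m'] f) (hi : Indep m m' ν) : condExpVar m ν f = 0 := by
  rw [condExpVar, variance_congr (condExp_indep_eq hm' hm hf hi.symm)]
  simp [variance, evariance]

end CondExpVariance

/-! ### The relatively independent self-joining over an independent σ-algebra. -/

section SelfJoining

open ProbabilityTheory

variable {Z : Type*} {m mZ : MeasurableSpace Z} [StandardBorelSpace Z] {ν : Measure Z}
  [IsProbabilityMeasure ν]
  {X : Type*} {mX : MeasurableSpace X} {μ : Measure X} [IsProbabilityMeasure μ]

/-- The relatively independent self-joining over a `σ`-algebra independent of `π` projects to the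
product measure. -/
theorem lintegral_lintegral_condExpKernel_prod (hm : m ≤ mZ) {π : Z → X}
    (hπ : MeasurePreserving π ν μ) (hi : Indep m (mX.comap π) ν) {H : X × X → ENNReal}
    (hH : Measurable H) :
    ∫⁻ z, ∫⁻ p, H (π p.1, π p.2) ∂((condExpKernel ν m z).prod (condExpKernel ν m z)) ∂ν =
      ∫⁻ p, H p ∂(μ.prod μ) := by
  have hππ : Measurable fun p : Z × Z => (π p.1, π p.2) :=
    (hπ.measurable.comp measurable_fst).prodMk (hπ.measurable.comp measurable_snd)
  let κ : Kernel Z Z := (condExpKernel ν m).comap id (measurable_id'' hm)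
  have hκ : ∀ z, (κ ×ₖ κ) z = (condExpKernel ν m z).prod (condExpKernel ν m z) := fun z => by
    rw [Kernel.prod_apply, Kernel.comap_apply]; rfl
  -- Independence means that almost every conditional measure projects to μ itself.
  have hrect : ∀ s : Set X, MeasurableSet s → ∀ᵐ z ∂ν, condExpKernel ν m z (π ⁻¹' s) = μ s := by
    intro s hs
    have h1 := condExpKernel_ae_eq_condExp (μ := ν) hm (hπ.measurable hs)
    have h2 : ν⟦π ⁻¹' s | m⟧ =ᵐ[ν] fun _ => ν[(π ⁻¹' s).indicator fun _ => (1 : ℝ)] :=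
      condExp_indep_eq hπ.measurable.comap_le hm
        (stronglyMeasurable_const.indicator ⟨s, hs, rfl⟩) hi.symm
    filter_upwards [h1, h2] with z hz1 hz2
    rw [hz2, integral_indicator (hπ.measurable hs), setIntegral_const, smul_eq_mul, mul_one,
      measureReal_def, measureReal_def, hπ.measure_preimage hs.nullMeasurableSet] at hz1
    exact (ENNReal.toReal_eq_toReal_iff' (measure_ne_top _ _) (measure_ne_top _ _)).1 hz1
  have hmap : μ.prod μ = ((κ ×ₖ κ) ∘ₘ ν).map fun p : Z × Z => (π p.1, π p.2) := by
    refine Measure.prod_eq fun s t hs ht => ?_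
    rw [Measure.map_apply hππ (hs.prod ht), Measure.bind_apply (hππ (hs.prod ht))
      (Kernel.aemeasurable _)]
    have h1 : ∀ᵐ z ∂ν, (κ ×ₖ κ) z ((fun p : Z × Z => (π p.1, π p.2)) ⁻¹' s ×ˢ t) = μ s * μ t := by
      filter_upwards [hrect s hs, hrect t ht] with z hz1 hz2
      rw [hκ, ← hz1, ← hz2, ← Measure.prod_prod]
      rfl
    rw [lintegral_congr_ae h1, lintegral_const, measure_univ, mul_one]
  rw [hmap, lintegral_map hH hππ, Measure.lintegral_bind
    (f := fun p : Z × Z => H (π p.1, π p.2)) (Kernel.aemeasurable _) (hH.comp hππ).aemeasurable]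
  simp_rw [hκ]

/-- The conditional expectations of the functions `uᵢ ∘ π · w` are small on average if the kernel
`∑ uᵢ ⊗ uᵢ` is small. -/
theorem sum_integral_condExp_sq_le (hm : m ≤ mZ) {π : Z → X}
    (hπ : MeasurePreserving π ν μ) (hi : Indep m (mX.comap π) ν) {u : ℕ → X → ℝ}
    (hu : ∀ i, Measurable (u i)) (hu1 : ∀ i x, |u i x| ≤ 1) {w : Z → ℝ} (hw : Measurable w)
    (hw1 : ∀ z, |w z| ≤ 1) (N : ℕ) :
    ∑ i ∈ Finset.range N, ∫ z, (ν[fun z => u i (π z) * w z | m]) z ^ 2 ∂ν ≤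
      ∫ p, |∑ i ∈ Finset.range N, u i p.1 * u i p.2| ∂(μ.prod μ) := by
  set g : ℕ → Z → ℝ := fun i z => u i (π z) * w z with hg
  have hgm : ∀ i, Measurable (g i) := fun i => ((hu i).comp hπ.measurable).mul hw
  have hg1 : ∀ i z, |g i z| ≤ 1 := fun i z => by
    rw [hg, abs_mul]
    exact mul_le_one₀ (hu1 _ _) (abs_nonneg _) (hw1 _)
  have hgint : ∀ i (ρ : Measure Z) [IsProbabilityMeasure ρ], Integrable (g i) ρ := fun i ρ _ =>
    Integrable.of_bound (hgm i).aestronglyMeasurable 1 (ae_of_all _ (hg1 i))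
  have hgL : ∀ i, MemLp (g i) 2 ν := fun i =>
    MemLp.of_bound (hgm i).aestronglyMeasurable 1 (ae_of_all _ (hg1 i))
  set H : X × X → ℝ := fun p => ∑ i ∈ Finset.range N, u i p.1 * u i p.2 with hHdef
  have hHm : Measurable H := Finset.measurable_sum _ fun i _ =>
    ((hu i).comp measurable_fst).mul ((hu i).comp measurable_snd)
  have hkey : ∀ᵐ z ∂ν, ENNReal.ofReal (∑ i ∈ Finset.range N, (ν[g i | m]) z ^ 2) ≤
      ∫⁻ p, ‖H (π p.1, π p.2)‖ₑ ∂((condExpKernel ν m z).prod (condExpKernel ν m z)) := by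
    have h1 : ∀ᵐ z ∂ν, ∀ i, (ν[g i | m]) z = ∫ y, g i y ∂condExpKernel ν m z :=
      ae_all_iff.2 fun i => condExp_ae_eq_integral_condExpKernel hm (hgint i ν)
    filter_upwards [h1] with z hz
    set ρ := condExpKernel ν m z
    -- The square of an integral is a double integral; the common factor w separates from the uᵢ and
    -- has modulus at most 1.
    have h2 : ∑ i ∈ Finset.range N, (ν[g i | m]) z ^ 2 =
        ∫ p, w p.1 * w p.2 * H (π p.1, π p.2) ∂(ρ.prod ρ) := by
      calc ∑ i ∈ Finset.range N, (ν[g i | m]) z ^ 2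
          = ∑ i ∈ Finset.range N, ∫ p, g i p.1 * g i p.2 ∂(ρ.prod ρ) :=
            Finset.sum_congr rfl fun i _ => by rw [hz, integral_prod_mul, sq]
        _ = ∫ p, ∑ i ∈ Finset.range N, g i p.1 * g i p.2 ∂(ρ.prod ρ) :=
            (integral_finsetSum _ fun i _ => (hgint i ρ).mul_prod (hgint i ρ)).symm
        _ = _ := by
            refine integral_congr_ae (ae_of_all _ fun p => ?_)
            simp only [hg, hHdef, Finset.mul_sum]
            exact Finset.sum_congr rfl fun i _ => by ring
    rw [h2]
    refine (ENNReal.ofReal_le_ofReal (le_abs_self _)).trans ?_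
    rw [← Real.enorm_eq_ofReal_abs]
    refine (enorm_integral_le_lintegral_enorm _).trans (lintegral_mono fun p => ?_)
    rw [Real.enorm_eq_ofReal_abs, Real.enorm_eq_ofReal_abs]
    refine ENNReal.ofReal_le_ofReal ?_
    rw [abs_mul, abs_mul]
    exact mul_le_of_le_one_left (abs_nonneg _)
      (mul_le_one₀ (hw1 _) (abs_nonneg _) (hw1 _))
  have hHint : Integrable (fun p => |H p|) (μ.prod μ) := by
    refine Integrable.abs (integrable_finsetSum _ fun i _ => ?_)
    have h1 : Integrable (u i) μ :=
      Integrable.of_bound (hu i).aestronglyMeasurable 1 (ae_of_all _ (hu1 i))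
    exact h1.mul_prod h1
  rw [← integral_finsetSum _ fun i _ => (memLp_condExp (hgL i)).integrable_sq]
  have h3 := (lintegral_mono_ae hkey).trans_eq
    (lintegral_lintegral_condExpKernel_prod hm hπ hi hHm.enorm)
  simp only [Real.enorm_eq_ofReal_abs] at h3
  rw [← ofReal_integral_eq_lintegral_ofReal hHint (ae_of_all _ fun _ => abs_nonneg _),
    ← ofReal_integral_eq_lintegral_ofReal
      (integrable_finsetSum _ fun i _ => (memLp_condExp (hgL i)).integrable_sq)
      (ae_of_all _ fun _ => Finset.sum_nonneg fun _ _ => sq_nonneg _)] at h3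
  exact (ENNReal.ofReal_le_ofReal_iff (integral_nonneg fun _ => abs_nonneg _)).1 h3

end SelfJoining

/-! ### Tame functions. -/

section Tame

open ProbabilityTheory

variable {X : Type*} [MeasurableSpace X] {μ : Measure X} {R₀ : MPAut (μ.prod μ)}

/-- The averages of `f` along the conjugates of `R₀` by fibre-preserving automorphisms have small
conditional expectations on all `σ`-algebras independent of the base. -/
def IsTame (R₀ : MPAut (μ.prod μ)) (f : X × X → ℝ) : Prop :=
  ∀ η > 0, ∀ᶠ N : ℕ in atTop, ∀ Ψ : MPAut (μ.prod μ), (∀ z, (Ψ z).1 = z.1) →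
    ∀ m ≤ (inferInstance : MeasurableSpace (X × X)),
      Indep m (MeasurableSpace.comap Prod.fst inferInstance) (μ.prod μ) →
      (N : ℝ)⁻¹ * ∑ i ∈ Finset.range N,
        condExpVar m (μ.prod μ) (fun z => f ((R₀ : X × X → X × X)^[i] (Ψ z))) ≤ η

theorem IsTame.const_mul {f : X × X → ℝ} (hf : IsTame R₀ f) (c : ℝ) :
    IsTame R₀ fun z => c * f z := by
  intro η hη
  filter_upwards [hf (η / (c ^ 2 + 1)) (by positivity)] with N hN Ψ hΨ m hm hi
  simp only [condExpVar_const_mul]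
  have h1 := hN Ψ hΨ m hm hi
  rw [← Finset.mul_sum, mul_left_comm]
  calc c ^ 2 * _ ≤ c ^ 2 * (η / (c ^ 2 + 1)) := mul_le_mul_of_nonneg_left h1 (sq_nonneg c)
    _ ≤ (c ^ 2 + 1) * (η / (c ^ 2 + 1)) := by gcongr; linarith
    _ = η := by field_simp

theorem memLp_comp_iterate_comp {f : X × X → ℝ} (hf : MemLp f 2 (μ.prod μ))
    (Ψ : MPAut (μ.prod μ)) (i : ℕ) :
    MemLp (fun z => f ((R₀ : X × X → X × X)^[i] (Ψ z))) 2 (μ.prod μ) :=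
  hf.comp_measurePreserving ((R₀.measurePreserving_iterate i).comp Ψ.measurePreserving)

variable [IsProbabilityMeasure μ]

theorem IsTame.add {f g : X × X → ℝ} (hf : IsTame R₀ f) (hg : IsTame R₀ g)
    (hf2 : MemLp f 2 (μ.prod μ)) (hg2 : MemLp g 2 (μ.prod μ)) :
    IsTame R₀ fun z => f z + g z := by
  intro η hη
  filter_upwards [hf (η / 4) (by positivity), hg (η / 4) (by positivity)] with N hN hN' Ψ hΨ m hm hi
  have h1 := hN Ψ hΨ m hm hi
  have h2 := hN' Ψ hΨ m hm hi
  have h3 : ∀ i ∈ Finset.range N, condExpVar m (μ.prod μ)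
      (fun z => f ((R₀ : X × X → X × X)^[i] (Ψ z)) + g ((R₀ : X × X → X × X)^[i] (Ψ z))) ≤
      2 * condExpVar m (μ.prod μ) (fun z => f ((R₀ : X × X → X × X)^[i] (Ψ z))) +
      2 * condExpVar m (μ.prod μ) (fun z => g ((R₀ : X × X → X × X)^[i] (Ψ z))) := fun i _ =>
    condExpVar_add_le (memLp_comp_iterate_comp hf2 Ψ i) (memLp_comp_iterate_comp hg2 Ψ i)
  have h4 := mul_le_mul_of_nonneg_left (Finset.sum_le_sum h3) (inv_nonneg.2 (Nat.cast_nonneg N))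
  rw [Finset.sum_add_distrib, ← Finset.mul_sum, ← Finset.mul_sum] at h4
  linarith

/-- The L² error is the same along all iterates and all Ψ, so tameness is closed in L². -/
theorem IsTame.of_forall_exists {f : X × X → ℝ} (hf2 : MemLp f 2 (μ.prod μ))
    (h : ∀ η > 0, ∃ g, IsTame R₀ g ∧ MemLp g 2 (μ.prod μ) ∧
      ∫ z, (f z - g z) ^ 2 ∂(μ.prod μ) ≤ η) : IsTame R₀ f := by
  intro η hη
  obtain ⟨g, hg, hg2, hfg⟩ := h (η / 4) (by positivity)
  filter_upwards [hg (η / 4) (by positivity), eventually_gt_atTop 0] with N hN hN0 Ψ hΨ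
  have h9 : ∀ i, ∫ z, (f ((R₀ : X × X → X × X)^[i] (Ψ z)) -
      g ((R₀ : X × X → X × X)^[i] (Ψ z))) ^ 2 ∂(μ.prod μ) =
      ∫ z, (f z - g z) ^ 2 ∂(μ.prod μ) := by
    intro i
    have := ((R₀.iter i).comp Ψ).measurePreserving.integral_comp
      ((R₀.iter i).comp Ψ).toEquiv.measurableEmbedding fun z => (f z - g z) ^ 2
    rw [← R₀.coe_iter]
    exact this
  intro m hm hi
  have h1 := hN Ψ hΨ m hm hi
  have h3 : ∀ i ∈ Finset.range N, condExpVar m (μ.prod μ)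
      (fun z => f ((R₀ : X × X → X × X)^[i] (Ψ z))) ≤
      2 * condExpVar m (μ.prod μ) (fun z => g ((R₀ : X × X → X × X)^[i] (Ψ z))) + η / 2 := by
    intro i _
    have h5 : MemLp (fun z => f z - g z) 2 (μ.prod μ) := hf2.sub hg2
    have h6 := memLp_comp_iterate_comp (R₀ := R₀) h5 Ψ i
    have h7 := condExpVar_add_le (m := m) (memLp_comp_iterate_comp (R₀ := R₀) hg2 Ψ i) h6
    have h8 := condExpVar_le_integral_sq hm h6
    have h10 : (fun z => f ((R₀ : X × X → X × X)^[i] (Ψ z))) =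
        (fun z => g ((R₀ : X × X → X × X)^[i] (Ψ z))) +
        fun z => f ((R₀ : X × X → X × X)^[i] (Ψ z)) - g ((R₀ : X × X → X × X)^[i] (Ψ z)) := by
      ext z; simp
    rw [h10]
    linarith [h9 i]
  have h4 := mul_le_mul_of_nonneg_left (Finset.sum_le_sum h3) (inv_nonneg.2 (Nat.cast_nonneg N))
  rw [Finset.sum_add_distrib, ← Finset.mul_sum, Finset.sum_const, Finset.card_range,
    nsmul_eq_mul, mul_add, inv_mul_cancel_left₀ (by positivity)] at h4
  linarith

/-- Functions of the base stay functions of the base under R₀ and Ψ, and `m` is independent of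
these. -/
theorem isTame_fst {S : MPAut μ} (hR₀ : ∀ z, (R₀ z).1 = S z.1) {a : X → ℝ} (ha : Measurable a) :
    IsTame R₀ fun z => a z.1 := by
  intro η hη
  refine Eventually.of_forall fun N Ψ hΨ m hm hi => ?_
  have h1 : ∀ i, condExpVar m (μ.prod μ)
      (fun z => a ((R₀ : X × X → X × X)^[i] (Ψ z)).1) = 0 := by
    intro i
    have h2 : (fun z => a ((R₀ : X × X → X × X)^[i] (Ψ z)).1) =
        fun z : X × X => a ((S : X → X)^[i] z.1) := by
      ext z; rw [fst_iterate hR₀, hΨ]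
    rw [h2]
    refine condExpVar_eq_zero_of_indep hm measurable_fst.comap_le ?_ hi
    exact ((ha.comp (S.measurePreserving_iterate i).measurable).comp
      (comap_measurable Prod.fst)).stronglyMeasurable
  simp only [h1, Finset.sum_const_zero, mul_zero]
  exact hη.le

/-- Functions `a ⊗ χ` with `χ` an eigenfunction on the fibres for a cocycle without quasi
coboundaries are tame. -/
theorem isTame_mul_of_not_isQuasiCoboundary [StandardBorelSpace X] {S : MPAut μ}
    (hS : IsMildlyMixing S) (hR₀ : ∀ z, (R₀ z).1 = S z.1) {ε : X → ℝ} (hε : Measurable ε)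
    (hε1 : ∀ x, |ε x| = 1) (hcob : ¬ IsQuasiCoboundary S ε) {χ : X → ℝ} (hχ : Measurable χ)
    (hχ1 : ∀ y, |χ y| = 1) (hχR : ∀ z, χ (R₀ z).2 = ε z.1 * χ z.2) {a : X → ℝ}
    (ha : Measurable a) (ha1 : ∀ x, |a x| ≤ 1) : IsTame R₀ fun z => a z.1 * χ z.2 := by
  set u : ℕ → X → ℝ := fun i x =>
    (∏ j ∈ Finset.range i, ε ((S : X → X)^[j] x)) * a ((S : X → X)^[i] x) with hu
  have hSi : ∀ i, Measurable ((S : X → X)^[i]) := fun i =>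
    (S.measurePreserving_iterate i).measurable
  have hum : ∀ i, Measurable (u i) := fun i =>
    (Finset.measurable_prod _ fun j _ => hε.comp (hSi j)).mul (ha.comp (hSi i))
  have hu1 : ∀ i x, |u i x| ≤ 1 := fun i x => by
    rw [hu, abs_mul, Finset.abs_prod, Finset.prod_congr rfl fun j _ => hε1 _,
      Finset.prod_const_one, one_mul]
    exact ha1 _
  have ha2 : MemLp a 2 μ := MemLp.of_bound ha.aestronglyMeasurable 1 (ae_of_all _ ha1)
  have hlim := tendsto_integral_average_sq hS hε hε1 hcob ha2 (u := u) fun i x => rfl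
  -- The fibre coordinate enters only through the fixed factor χ; everything else is the orbit u on
  -- the base.
  have hcoc : ∀ i z, a ((R₀ : X × X → X × X)^[i] z).1 * χ ((R₀ : X × X → X × X)^[i] z).2 =
      u i z.1 * χ z.2 := by
    intro i z
    have h1 : χ ((R₀ : X × X → X × X)^[i] z).2 =
        (∏ j ∈ Finset.range i, ε ((S : X → X)^[j] z.1)) * χ z.2 := by
      induction i with
      | zero => simp
      | succ i ih =>
        rw [Function.iterate_succ_apply', hχR, ih, fst_iterate hR₀, Finset.prod_range_succ]
        ring
    rw [h1, fst_iterate hR₀]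
    simp only [hu]
    ring
  intro η hη
  filter_upwards [(tendsto_order.1 hlim).2 (η ^ 2) (by positivity)] with N hN Ψ hΨ
  set H : X × X → ℝ := fun p => (N : ℝ)⁻¹ * ∑ i ∈ Finset.range N, u i p.1 * u i p.2 with hH
  have hχΨ : Measurable fun z => χ (Ψ z).2 := hχ.comp (measurable_snd.comp Ψ.measurable)
  have hg2 : ∀ i, MemLp (fun z => u i z.1 * χ (Ψ z).2) 2 (μ.prod μ) := fun i =>
    MemLp.of_bound (((hum i).comp measurable_fst).mul hχΨ).aestronglyMeasurable 1 (ae_of_all _ fun z => by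
        rw [Real.norm_eq_abs, abs_mul, hχ1, mul_one]; exact hu1 _ _)
  have hH2 : MemLp (fun p => |H p|) 2 (μ.prod μ) := by
    have h2 : MemLp H 2 (μ.prod μ) := by
      refine MemLp.const_mul (memLp_finsetSum (f := fun i (p : X × X) => u i p.1 * u i p.2) _
        fun i _ => ?_) _
      refine MemLp.of_bound (((hum i).comp measurable_fst).mul
        ((hum i).comp measurable_snd)).aestronglyMeasurable 1 (ae_of_all _ fun p => ?_)
      rw [Real.norm_eq_abs, abs_mul]
      exact mul_le_one₀ (hu1 _ _) (abs_nonneg _) (hu1 _ _)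
    exact h2.abs
  -- Cauchy–Schwarz turns the L² smallness of the kernel into L¹ smallness.
  have h3 : (∫ p, |H p| ∂(μ.prod μ)) ^ 2 ≤ ∫ p, H p ^ 2 ∂(μ.prod μ) := by
    have h4 := variance_eq_sub hH2
    have h5 := variance_nonneg (fun p => |H p|) (μ.prod μ)
    have h6 : ((fun p => |H p|) ^ 2 : X × X → ℝ) = fun p => H p ^ 2 := by
      ext p; simp
    rw [h6] at h4
    linarith
  have h7 : (N : ℝ)⁻¹ * ∫ p, |∑ i ∈ Finset.range N, u i p.1 * u i p.2| ∂(μ.prod μ) =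
      ∫ p, |H p| ∂(μ.prod μ) := by
    rw [← integral_const_mul]
    refine integral_congr_ae (ae_of_all _ fun p => ?_)
    simp only [hH, abs_mul, abs_inv, Nat.abs_cast]
  intro m hm hi
  have h1 : ∑ i ∈ Finset.range N, condExpVar m (μ.prod μ)
      (fun z => a ((R₀ : X × X → X × X)^[i] (Ψ z)).1 * χ ((R₀ : X × X → X × X)^[i] (Ψ z)).2) ≤
      ∫ p, |∑ i ∈ Finset.range N, u i p.1 * u i p.2| ∂(μ.prod μ) := by
    refine le_trans (Finset.sum_le_sum fun i _ => ?_)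
      (sum_integral_condExp_sq_le hm measurePreserving_fst hi hum hu1
        (w := fun z => χ (Ψ z).2) hχΨ
        (fun z => (hχ1 _).le) N)
    simp only [hcoc, hΨ]
    exact condExpVar_le_integral_condExp_sq (hg2 i)
  calc _ ≤ (N : ℝ)⁻¹ * ∫ p, |∑ i ∈ Finset.range N, u i p.1 * u i p.2| ∂(μ.prod μ) :=
        mul_le_mul_of_nonneg_left h1 (by positivity)
    _ = ∫ p, |H p| ∂(μ.prod μ) := h7
    _ ≤ η := abs_le_of_sq_le_sq' (h3.trans hN.le) hη.le |>.2

/-- If the indicators of a generating `π`-system are tame then so are those of all measurable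
sets. -/
theorem isTame_indicator_of_generateFrom {S : MPAut μ} (hR₀ : ∀ z, (R₀ z).1 = S z.1)
    {𝒞 : Set (Set (X × X))} (hgen : (inferInstance : MeasurableSpace (X × X)) =
      MeasurableSpace.generateFrom 𝒞) (hpi : IsPiSystem 𝒞)
    (h : ∀ s ∈ 𝒞, IsTame R₀ (s.indicator fun _ => 1)) {s : Set (X × X)} (hs : MeasurableSet s) :
    IsTame R₀ (s.indicator fun _ => 1) := by
  have hL : ∀ {t : Set (X × X)}, MeasurableSet t →
      MemLp (t.indicator fun _ => (1 : ℝ)) 2 (μ.prod μ) := fun ht =>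
    memLp_indicator_const _ ht _ (.inr (measure_ne_top _ _))
  have hadd : ∀ {s t : Set (X × X)}, MeasurableSet s → MeasurableSet t → Disjoint s t →
      IsTame R₀ (s.indicator fun _ => 1) → IsTame R₀ (t.indicator fun _ => 1) →
      IsTame R₀ ((s ∪ t).indicator fun _ => 1) := fun hs ht hd h1 h2 => by
    rw [Set.indicator_union_of_disjoint hd]
    exact h1.add h2 (hL hs) (hL ht)
  have hc : IsTame R₀ fun _ => 1 := isTame_fst hR₀ (a := fun _ => 1) measurable_const
  have h0 : IsTame R₀ ((∅ : Set (X × X)).indicator fun _ => 1) := by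
    rw [Set.indicator_empty]
    exact isTame_fst hR₀ (a := fun _ => 0) measurable_const
  induction s, hs using MeasurableSpace.induction_on_inter hgen hpi with
  | empty => exact h0
  | basic t ht => exact h t ht
  | compl t ht ih =>
    have := hc.add (ih.const_mul (-1)) (memLp_const 1) ((hL ht).const_mul (-1))
    convert this using 1
    ext z
    by_cases hz : z ∈ t <;> simp [hz]
  | iUnion f hd hf ih =>
    have hU : ∀ n, MeasurableSet (⋃ i ∈ Finset.range n, f i) := fun n =>
      Finset.measurableSet_biUnion _ fun i _ => hf i
    have hfin : ∀ n, IsTame R₀ ((⋃ i ∈ Finset.range n, f i).indicator fun _ => 1) := by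
      intro n
      induction n with
      | zero => simpa using h0
      | succ n ihn =>
        rw [Finset.range_add_one, Finset.set_biUnion_insert]
        refine hadd (hf n) (hU n) ?_ (ih n) ihn
        simp only [Set.disjoint_iUnion_right, Finset.mem_range]
        exact fun i hi => hd hi.ne'
    refine IsTame.of_forall_exists (hL (.iUnion hf)) fun η hη => ?_
    have hlim : Tendsto (fun n => (μ.prod μ).real ((⋃ i, f i) \ ⋃ i ∈ Finset.range n, f i))
        atTop (𝓝 0) := by
      have hemp : ⋂ n, ((⋃ i, f i) \ ⋃ i ∈ Finset.range n, f i) = ∅ := by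
        refine Set.eq_empty_of_forall_notMem fun z hz => ?_
        obtain ⟨i, hi⟩ := Set.mem_iUnion.1 (Set.mem_iInter.1 hz 0).1
        refine (Set.mem_iInter.1 hz (i + 1)).2 ?_
        exact Set.mem_biUnion (Finset.mem_coe.2 (Finset.self_mem_range_succ i)) hi
      have := tendsto_measure_iInter_atTop (μ := μ.prod μ)
        (s := fun n => (⋃ i, f i) \ ⋃ i ∈ Finset.range n, f i)
        (fun n => ((MeasurableSet.iUnion hf).diff (hU n)).nullMeasurableSet)
        (fun n k hnk => Set.sdiff_subset_sdiff_right (Set.biUnion_subset_biUnion_left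
          (Finset.coe_subset.2 (Finset.range_mono hnk)))) ⟨0, measure_ne_top _ _⟩
      rw [hemp, measure_empty] at this
      exact (ENNReal.tendsto_toReal ENNReal.zero_ne_top).comp this
    obtain ⟨n, hn⟩ := ((tendsto_order.1 hlim).2 η hη).exists
    refine ⟨_, hfin n, hL (hU n), ?_⟩
    have hsub : (⋃ i ∈ Finset.range n, f i) ⊆ ⋃ i, f i :=
      Set.iUnion₂_subset fun i _ => Set.subset_iUnion f i
    have heq : (fun z => ((⋃ i, f i).indicator (fun _ => (1 : ℝ)) z -
        (⋃ i ∈ Finset.range n, f i).indicator (fun _ => (1 : ℝ)) z) ^ 2) =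
        ((⋃ i, f i) \ ⋃ i ∈ Finset.range n, f i).indicator fun _ => 1 := by
      ext z
      by_cases h1 : z ∈ ⋃ i ∈ Finset.range n, f i
      · have h2 := hsub h1
        rw [Set.indicator_of_mem h1, Set.indicator_of_mem h2,
          Set.indicator_of_notMem (fun h => h.2 h1)]
        simp
      · rw [Set.indicator_of_notMem h1]
        by_cases h2 : z ∈ ⋃ i, f i
        · rw [Set.indicator_of_mem h2, Set.indicator_of_mem (Set.mem_sdiff _ |>.2 ⟨h2, h1⟩)]; simp
        · rw [Set.indicator_of_notMem h2, Set.indicator_of_notMem (fun h => h2 h.1)]; simp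
    rw [heq, integral_indicator ((MeasurableSet.iUnion hf).diff (hU n)), setIntegral_const,
      smul_eq_mul, mul_one]
    exact hn.le

end Tame

/-! ### Extensions by (ℤ/2)^ℕ. -/

section GroupExtension

/-- The normalized Haar measure of `ℕ → ZMod 2`. -/
theorem exists_invariant_measure_zmod_two : ∃ m : Measure (ℕ → ZMod 2), IsProbabilityMeasure m ∧
    NullSingletonClass m ∧ ∀ g, MeasurePreserving (fun y => g + y) m m := by
  have : BorelSpace (ZMod 2) := ⟨borel_eq_top_of_discrete.symm⟩
  let m : Measure (ℕ → ZMod 2) := Measure.addHaarMeasure ⊤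
  have hm : IsProbabilityMeasure m := ⟨Measure.addHaarMeasure_self (K₀ := ⊤)⟩
  refine ⟨m, hm, ⟨fun x => ?_⟩, fun g => measurePreserving_add_left m g⟩
  by_contra hx
  -- By invariance an atom would give every point of an infinite group the same positive mass.
  have hconst : ∀ y, m {x} ≤ m {y} := by
    intro y
    have h := measure_preimage_add m (y - x) {y}
    have h1 : (fun z => y - x + z) ⁻¹' {y} = {x} := by
      ext z
      simp only [Set.mem_preimage, Set.mem_singleton_iff]
      constructor
      · intro hz
        rw [sub_add_eq_add_sub, sub_eq_iff_eq_add] at hz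
        exact add_left_cancel hz
      · rintro rfl; abel
    rw [← h, h1]
  have := Set.infinite_univ (α := ℕ → ZMod 2) |>.meas_eq_top (μ := m)
    ⟨m {x}, hx, fun y _ => hconst y⟩
  exact measure_ne_top m _ this

variable {X : Type*} [MeasurableSpace X] {μ : Measure X}

/-- The extension of `S` by the cocycle `φ` with values in a group identified with the fibres. -/
noncomputable def cocycleExtension [SFinite μ] (S : MPAut μ) {m : Measure (ℕ → ZMod 2)}
    (hm : ∀ g, MeasurePreserving (fun y => g + y) m m) {e : X ≃ᵐ (ℕ → ZMod 2)}
    (he : MeasurePreserving e μ m) {φ : X → ℕ → ZMod 2} (hφ : Measurable φ) :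
    MPAut (μ.prod μ) where
  toEquiv :=
  { toFun := fun z => (S z.1, e.symm (φ z.1 + e z.2))
    invFun := fun z => (S.toEquiv.symm z.1,
      e.symm (-φ (S.toEquiv.symm z.1) + e z.2))
    left_inv := fun z => by simp
    right_inv := fun z => by simp
    measurable_toFun := (S.measurable.comp measurable_fst).prodMk (e.symm.measurable.comp
      ((hφ.comp measurable_fst).add (e.measurable.comp measurable_snd)))
    measurable_invFun := (S.toEquiv.symm.measurable.comp measurable_fst).prodMk
      (e.symm.measurable.comp (((hφ.comp S.toEquiv.symm.measurable).comp measurable_fst).neg.add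
        (e.measurable.comp measurable_snd))) }
  measurePreserving :=
    S.measurePreserving.skew_product (g := fun x y => e.symm (φ x + e y))
      (e.symm.measurable.comp
        ((hφ.comp measurable_fst).add (e.measurable.comp measurable_snd)))
      (ae_of_all _ fun x => ((he.symm e).comp ((hm (φ x)).comp he)).map_eq)

end GroupExtension

/-! ### An extension with all sets tame. -/

section TameExtension

open ProbabilityTheory

variable {X : Type*} [MeasurableSpace X] {μ : Measure X} [IsProbabilityMeasure μ]

/-- Functions on a two-point group are combinations of its two characters. -/
theorem exists_indicator_zmod_eq (t : Set (ZMod 2)) :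
    ∃ α β : ℝ, ∀ y, t.indicator (fun _ => (1 : ℝ)) y = α + β * zmodSign y := by
  refine ⟨(t.indicator (fun _ => 1) 0 + t.indicator (fun _ => 1) 1) / 2,
    (t.indicator (fun _ => 1) 0 - t.indicator (fun _ => 1) 1) / 2, fun y => ?_⟩
  rcases ZMod.eq_zero_or_one_of_two y with rfl | rfl
  · rw [zmodSign_zero]; ring
  · have : zmodSign 1 = -1 := by simp [zmodSign]
    rw [this]; ring

theorem measurable_zmodSign_sum (A : Finset ℕ) :
    Measurable fun y : ℕ → ZMod 2 => zmodSign (∑ j ∈ A, y j) :=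
  (measurable_of_countable zmodSign).comp
    (Finset.measurable_sum _ fun j _ => measurable_pi_apply j)

/-- A mildly mixing automorphism has an extension for which all measurable sets are tame. -/
theorem exists_tame_extension [StandardBorelSpace X] [NullSingletonClass μ] {S : MPAut μ}
    (hS : IsMildlyMixing S) : ∃ R₀ : MPAut (μ.prod μ), (∀ z, (R₀ z).1 = S z.1) ∧
      ∀ s : Set (X × X), MeasurableSet s → IsTame R₀ (s.indicator fun _ => 1) := by
  classical
  obtain ⟨m, hmp, hms, hm⟩ := exists_invariant_measure_zmod_two
  obtain ⟨e, he⟩ := exists_measurableEquiv_measurePreserving μ m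
  obtain ⟨φ, hφ, hcob⟩ := exists_cocycle hS.ergodic
  let R₀ := cocycleExtension S hm he hφ
  have hR₀ : ∀ z, (R₀ z).1 = S z.1 := fun z => rfl
  have hR₀2 : ∀ z, e (R₀ z).2 = φ z.1 + e z.2 := fun z => e.apply_symm_apply _
  let χ : Finset ℕ → X → ℝ := fun A y => zmodSign (∑ j ∈ A, e y j)
  have hχm : ∀ A, Measurable (χ A) := fun A => (measurable_zmodSign_sum A).comp e.measurable
  have hχ1 : ∀ A y, |χ A y| = 1 := fun A y => abs_zmodSign _
  have hchar : ∀ (D : Set X), MeasurableSet D → ∀ A : Finset ℕ,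
      IsTame R₀ fun z => D.indicator (fun _ => 1) z.1 * χ A z.2 := by
    intro D hD A
    have hDm : Measurable (D.indicator fun _ => (1 : ℝ)) := measurable_const.indicator hD
    rcases A.eq_empty_or_nonempty with rfl | hA
    · simpa [χ, zmodSign_zero] using isTame_fst hR₀ hDm
    · refine isTame_mul_of_not_isQuasiCoboundary hS hR₀
        ((measurable_zmodSign_sum A).comp hφ) (fun x => abs_zmodSign _) (hcob A hA) (hχm A) (hχ1 A)
        (fun z => ?_) hDm fun x => ?_
      · simp only [χ, hR₀2, Pi.add_apply, Finset.sum_add_distrib, zmodSign_add]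
        rfl
      · by_cases hx : x ∈ D <;> simp [hx]
  -- Cylinders expand into characters one coordinate at a time; `A` collects the coordinates from
  -- which the sign has been chosen.
  have hprod : ∀ (D : Set X), MeasurableSet D → ∀ (α β : ℕ → ℝ) (J A : Finset ℕ), Disjoint A J →
      (IsTame R₀ fun z => D.indicator (fun _ => 1) z.1 * χ A z.2 *
        ∏ j ∈ J, (α j + β j * zmodSign (e z.2 j))) ∧
      MemLp (fun z => D.indicator (fun _ => 1) z.1 * χ A z.2 *
        ∏ j ∈ J, (α j + β j * zmodSign (e z.2 j))) 2 (μ.prod μ) := by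
    intro D hD α β J
    have hDm : Measurable (D.indicator fun _ => (1 : ℝ)) := measurable_const.indicator hD
    induction J using Finset.induction_on with
    | empty =>
      intro A _
      simp only [Finset.prod_empty, mul_one]
      refine ⟨hchar D hD A, MemLp.of_bound ((hDm.comp measurable_fst).mul
        ((hχm A).comp measurable_snd)).aestronglyMeasurable 1 (ae_of_all _ fun z => ?_)⟩
      rw [Real.norm_eq_abs, abs_mul, hχ1, mul_one]
      by_cases hz : z.1 ∈ D <;> simp [hz]
    | insert j J hj ih =>
      intro A hA
      rw [Finset.disjoint_insert_right] at hA
      obtain ⟨h1, h1'⟩ := ih A hA.2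
      obtain ⟨h2, h2'⟩ := ih (insert j A) (Finset.disjoint_insert_left.2 ⟨hj, hA.2⟩)
      have heq : (fun z : X × X => D.indicator (fun _ => (1 : ℝ)) z.1 * χ A z.2 *
          ∏ j ∈ insert j J, (α j + β j * zmodSign (e z.2 j))) = fun z =>
          α j * (D.indicator (fun _ => 1) z.1 * χ A z.2 *
            ∏ j ∈ J, (α j + β j * zmodSign (e z.2 j))) +
          β j * (D.indicator (fun _ => 1) z.1 * χ (insert j A) z.2 *
            ∏ j ∈ J, (α j + β j * zmodSign (e z.2 j))) := by
        ext z
        have h3 : χ (insert j A) z.2 = zmodSign (e z.2 j) * χ A z.2 := by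
          simp only [χ, Finset.sum_insert hA.1, zmodSign_add]
        rw [Finset.prod_insert hj, h3]
        ring
      rw [heq]
      exact ⟨(h1.const_mul _).add (h2.const_mul _) (h1'.const_mul _) (h2'.const_mul _),
        (h1'.const_mul _).add (h2'.const_mul _)⟩
  let 𝒢 : Set (Set X) := (fun E => e ⁻¹' E) ''
    squareCylinders fun _ : ℕ => {s : Set (ZMod 2) | MeasurableSet s}
  have h𝒢 : (inferInstance : MeasurableSpace X) = MeasurableSpace.generateFrom 𝒢 := by
    rw [← MeasurableSpace.comap_generateFrom, generateFrom_squareCylinders]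
    exact e.measurableEmbedding.comap_eq.symm
  have h𝒢pi : IsPiSystem 𝒢 := by
    have := (isPiSystem_squareCylinders (C := fun _ : ℕ => {s : Set (ZMod 2) | MeasurableSet s})
      (fun _ => MeasurableSpace.isPiSystem_measurableSet) (by simp)).comap e
    exact this
  refine ⟨R₀, hR₀, fun s hs => isTame_indicator_of_generateFrom hR₀
    (𝒞 := Set.image2 (· ×ˢ ·) {s : Set X | MeasurableSet s} 𝒢) ?_
    (MeasurableSpace.isPiSystem_measurableSet.prod h𝒢pi) ?_ hs⟩
  · refine (generateFrom_eq_prod MeasurableSpace.generateFrom_measurableSet h𝒢.symm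
      isCountablySpanning_measurableSet ⟨fun _ => Set.univ, fun _ => ⟨Set.univ, ?_, rfl⟩, ?_⟩).symm
    · exact ⟨∅, fun _ => Set.univ, by simp, by simp⟩
    · exact Set.iUnion_const _
  · rintro _ ⟨D, hD, _, ⟨_, ⟨J, t, -, rfl⟩, rfl⟩, rfl⟩
    choose α β hαβ using fun j => exists_indicator_zmod_eq (t j)
    have h1 := (hprod D hD α β J ∅ (Finset.disjoint_empty_left J)).1
    convert h1 using 1
    ext z
    have h2 : ∏ j ∈ J, (t j).indicator (fun _ => (1 : ℝ)) (e z.2 j) =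
        (e ⁻¹' (J : Set ℕ).pi t).indicator (fun _ => 1) z.2 := by
      by_cases hz : ∀ j ∈ J, e z.2 j ∈ t j
      · rw [Set.indicator_of_mem (show z.2 ∈ e ⁻¹' (J : Set ℕ).pi t from fun j hj => hz j hj)]
        exact Finset.prod_eq_one fun j hj => Set.indicator_of_mem (hz j hj) _
      · rw [Set.indicator_of_notMem (show z.2 ∉ e ⁻¹' (J : Set ℕ).pi t from
          fun h => hz fun j hj => h j hj)]
        push Not at hz
        obtain ⟨j, hj, hjt⟩ := hz
        exact Finset.prod_eq_zero hj (Set.indicator_of_notMem hjt _)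
    simp only [← hαβ, h2]
    by_cases hz1 : z.1 ∈ D <;> by_cases hz2 : z.2 ∈ e ⁻¹' (J : Set ℕ).pi t <;>
      simp only [Set.indicator, Set.mem_prod, hz1, hz2, χ, zmodSign_zero, Finset.sum_empty,
        and_true, and_false, if_true, if_false, mul_one, mul_zero]

end TameExtension

/-! ### Rigid factors are independent of the base. -/

section RigidFactors

open ProbabilityTheory

variable {X : Type*} [mX : MeasurableSpace X] {μ : Measure X}

theorem iter_mem_extensionsOf {S : MPAut μ} {R : MPAut (μ.prod μ)} (hR : R ∈ ExtensionsOf S)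
    (n : ℕ) : R.iter n ∈ ExtensionsOf (S.iter n) := by
  induction n with
  | zero => exact ae_of_all _ fun z => rfl
  | succ n ih =>
    have h1 : ∀ᵐ z ∂(μ.prod μ), (R.iter n (R z)).1 = S.iter n (R z).1 :=
      R.measurePreserving.quasiMeasurePreserving.ae ih
    refine Filter.Eventually.mp h1 (Filter.Eventually.mono hR fun z hz2 hz1 => ?_)
    change (R.iter n (R z)).1 = S.iter n (S z.1)
    rw [hz1, hz2]

variable [IsProbabilityMeasure μ]

theorem setLIntegral_measure_prodMk_preimage {B : Set (X × X)} (hB : MeasurableSet B) {D : Set X}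
    (hD : MeasurableSet D) :
    ∫⁻ x in D, μ (Prod.mk x ⁻¹' B) ∂μ = μ.prod μ (B ∩ Prod.fst ⁻¹' D) := by
  rw [Measure.prod_apply (hB.inter (measurable_fst hD)), ← lintegral_indicator hD]
  congr
  ext x
  by_cases hx : x ∈ D
  · rw [Set.indicator_of_mem hx]
    congr 1
    ext y; simp [hx]
  · rw [Set.indicator_of_notMem hx]
    have : Prod.mk x ⁻¹' (B ∩ Prod.fst ⁻¹' D) = ∅ := by ext y; simp [hx]
    rw [this, measure_empty]

/-- The measures of the fibres of a set are transported by an extension. -/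
theorem measure_prodMk_preimage_preimage {P : MPAut μ} {T : MPAut (μ.prod μ)}
    (hT : T ∈ ExtensionsOf P) {B : Set (X × X)} (hB : MeasurableSet B) :
    (fun x => μ (Prod.mk x ⁻¹' (T ⁻¹' B))) =ᵐ[μ] fun x => μ (Prod.mk (P x) ⁻¹' B) := by
  have hmB := measurable_measure_prodMk_left (ν := μ) hB
  refine ae_eq_of_forall_setLIntegral_eq_of_sigmaFinite
    (measurable_measure_prodMk_left (T.measurable hB)) (hmB.comp P.measurable) fun D hD _ => ?_
  have hE : MeasurableSet (P.inv ⁻¹' D) := P.inv.measurable hD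
  have hDE : D = P ⁻¹' (P.inv ⁻¹' D) := by
    ext x; simp
  rw [setLIntegral_measure_prodMk_preimage (T.measurable hB) hD]
  conv_rhs => rw [hDE]
  rw [P.measurePreserving.setLIntegral_comp_preimage hE hmB,
    setLIntegral_measure_prodMk_preimage hB hE,
    ← T.measurePreserving.measure_preimage (hB.inter (measurable_fst hE)).nullMeasurableSet]
  refine measure_congr ?_
  filter_upwards [hT] with z hz
  refine propext ⟨fun h => ⟨h.1, ?_⟩, fun h => ⟨h.1, ?_⟩⟩
  · change P.inv (T z).1 ∈ D
    rw [hz, P.inv_apply_self]; exact h.2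
  · have : P.inv (T z).1 ∈ D := h.2
    rw [hz, P.inv_apply_self] at this
    exact this

/-- A set that is rigid for an extension of a mildly mixing automorphism is independent of the
base. -/
theorem IsMildlyMixing.measure_inter_eq_of_rigid {S : MPAut μ} (hS : IsMildlyMixing S)
    {R : MPAut (μ.prod μ)} (hR : R ∈ ExtensionsOf S) {n : ℕ → ℕ} (hn : Tendsto n atTop atTop)
    {B : Set (X × X)} (hB : MeasurableSet B)
    (hn0 : Tendsto (fun k => (μ.prod μ).real (((R : X × X → X × X)^[n k] '' B) ∆ B)) atTop (𝓝 0))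
    {D : Set X} (hD : MeasurableSet D) :
    μ.prod μ (B ∩ Prod.fst ⁻¹' D) = μ.prod μ B * μ.prod μ (Prod.fst ⁻¹' D) := by
  set g : X → ℝ := fun x => μ.real (Prod.mk x ⁻¹' B) with hg
  have hmg : Measurable g := (measurable_measure_prodMk_left hB).ennreal_toReal
  -- Fibrewise, the change of the fibre measure is at most the measure of the symmetric difference
  -- of the fibres.
  have hle : ∀ k, ∫⁻ x, ‖g ((S : X → X)^[k] x) - g x‖ₑ ∂μ ≤
      ENNReal.ofReal ((μ.prod μ).real (((R : X × X → X × X)^[k] '' B) ∆ B)) := by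
    intro k
    rw [R.iterate_image_symmDiff k hB, ofReal_measureReal,
      Measure.prod_apply (((R.measurePreserving_iterate k).measurable hB).symmDiff hB)]
    refine lintegral_mono_ae ?_
    filter_upwards [measure_prodMk_preimage_preimage (iter_mem_extensionsOf hR k) hB] with x hx
    rw [R.coe_iter, S.coe_iter] at hx
    have hs : MeasurableSet (Prod.mk x ⁻¹' ((R : X × X → X × X)^[k] ⁻¹' B)) :=
      measurable_prodMk_left ((R.measurePreserving_iterate k).measurable hB)
    have h1 : g ((S : X → X)^[k] x) =
        μ.real (Prod.mk x ⁻¹' ((R : X × X → X × X)^[k] ⁻¹' B)) := by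
      simp only [hg, measureReal_def, hx]
    rw [h1, hg, Real.enorm_eq_ofReal_abs]
    refine (ENNReal.ofReal_le_ofReal (abs_measureReal_sub_le_measureReal_symmDiff
      hs.nullMeasurableSet (measurable_prodMk_left hB).nullMeasurableSet)).trans_eq ?_
    rw [ofReal_measureReal, Set.preimage_symmDiff]
  have hlim : Tendsto (fun k => ∫⁻ x, ‖g ((S : X → X)^[n k] x) - g x‖ₑ ∂μ) atTop (𝓝 0) := by
    refine tendsto_of_tendsto_of_tendsto_of_le_of_le tendsto_const_nhds ?_
      (fun _ => zero_le) fun k => hle (n k)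
    have := ENNReal.tendsto_ofReal hn0
    rwa [ENNReal.ofReal_zero] at this
  obtain ⟨c, hc⟩ := hS.ae_const_of_tendsto_integral hn hmg hlim
  have hc' : ∀ᵐ x ∂μ, μ (Prod.mk x ⁻¹' B) = ENNReal.ofReal c := by
    filter_upwards [hc] with x hx
    rw [← hx, hg, ofReal_measureReal]
  have h1 : ∀ {E : Set X}, MeasurableSet E →
      μ.prod μ (B ∩ Prod.fst ⁻¹' E) = ENNReal.ofReal c * μ E := fun hE => by
    rw [← setLIntegral_measure_prodMk_preimage hB hE,
      lintegral_congr_ae (ae_restrict_of_ae hc'), setLIntegral_const]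
  have h2 := h1 MeasurableSet.univ
  rw [Set.preimage_univ, Set.inter_univ, measure_univ, mul_one] at h2
  rw [h1 hD, h2, measurePreserving_fst.measure_preimage hD.nullMeasurableSet]

/-- A rigid factor of an extension of a mildly mixing automorphism is independent of the base. -/
theorem IsMildlyMixing.indep_of_isRigidOn {S : MPAut μ} (hS : IsMildlyMixing S)
    {R : MPAut (μ.prod μ)} (hR : R ∈ ExtensionsOf S) {m : MeasurableSpace (X × X)}
    (hm : IsFactor m R) (hrig : IsRigidOn m R) :
    Indep m (MeasurableSpace.comap Prod.fst mX) (μ.prod μ) := by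
  obtain ⟨n, hn, hn0⟩ := hrig
  rw [Indep_iff]
  rintro B _ hBm ⟨D, hD, rfl⟩
  exact hS.measure_inter_eq_of_rigid hR hn (hm.le B hBm) (hn0 B hBm) hD

theorem integral_indicator_sub_indicator_sq {Z : Type*} {mZ : MeasurableSpace Z} {ν : Measure Z}
    {s t : Set Z} (hs : MeasurableSet s) (ht : MeasurableSet t) :
    ∫ z, (s.indicator (fun _ => (1 : ℝ)) z - t.indicator (fun _ => 1) z) ^ 2 ∂ν =
      ν.real (s ∆ t) := by
  have h : (fun z => (s.indicator (fun _ => (1 : ℝ)) z - t.indicator (fun _ => 1) z) ^ 2) =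
      (s ∆ t).indicator fun _ => 1 := by
    ext z
    by_cases h1 : z ∈ s <;> by_cases h2 : z ∈ t <;>
      simp [Set.indicator, Set.mem_symmDiff, h1, h2]
  rw [h, integral_indicator (hs.symmDiff ht), setIntegral_const, smul_eq_mul, mul_one]

theorem memLp_indicator_one {Z : Type*} {mZ : MeasurableSpace Z} {ν : Measure Z}
    [IsFiniteMeasure ν] {s : Set Z} (hs : MeasurableSet s) :
    MemLp (s.indicator fun _ => (1 : ℝ)) 2 ν :=
  memLp_indicator_const _ hs _ (.inr (measure_ne_top _ _))

theorem condExpVar_indicator_le {Z : Type*} {m mZ : MeasurableSpace Z} {ν : Measure Z}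
    [IsProbabilityMeasure ν] (hm : m ≤ mZ) {s t : Set Z} (hs : MeasurableSet s)
    (ht : MeasurableSet t) : condExpVar m ν (s.indicator fun _ => 1) ≤
      2 * condExpVar m ν (t.indicator fun _ => 1) + 2 * ν.real (s ∆ t) := by
  have hd := (memLp_indicator_one (ν := ν) hs).sub (memLp_indicator_one (ν := ν) ht)
  have h1 := condExpVar_add_le (m := m) (memLp_indicator_one (ν := ν) ht) hd
  have h2 := condExpVar_le_integral_sq hm hd
  simp only [Pi.sub_apply, integral_indicator_sub_indicator_sq hs ht] at h2
  rw [add_sub_cancel] at h1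
  linarith

/-- `m` need only be a factor of `R`: invariance is used for `R`, and the comparison with `Q`
concerns sets alone. -/
theorem IsFactor.condExpVar_indicator_le {Z : Type*} {m mZ : MeasurableSpace Z} {ν : Measure Z}
    [IsProbabilityMeasure ν] {R : MPAut ν} (hm : IsFactor m R) (Q : MPAut ν) {C : Set Z}
    (hC : MeasurableSet C) (i : ℕ) : condExpVar m ν (C.indicator fun _ => 1) ≤
      2 * condExpVar m ν (((Q : Z → Z)^[i] ⁻¹' C).indicator fun _ => 1) +
        2 * ν.real (((R : Z → Z)^[i] ⁻¹' C) ∆ ((Q : Z → Z)^[i] ⁻¹' C)) := by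
  rw [← hm.condExpVar_comp_iterate
    ((memLp_indicator_one (ν := ν) hC).integrable (by norm_num)) i]
  exact _root_.condExpVar_indicator_le hm.le
    ((R.measurePreserving_iterate i).measurable hC) ((Q.measurePreserving_iterate i).measurable hC)

/-- A `σ`-algebra whose conditional expectations of a dense family of sets are constant is
trivial. -/
theorem isTrivialFactor_of_condExpVar_eq_zero {Z : Type*} {m mZ : MeasurableSpace Z}
    {ν : Measure Z} [IsProbabilityMeasure ν] (hm : m ≤ mZ) {A : ℕ → Set Z}
    (hA : ν.MeasureDense (Set.range A))
    (h : ∀ l, condExpVar m ν ((A l).indicator fun _ => 1) ≤ 0) : IsTrivialFactor m ν := by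
  intro B hBm
  have hB := hm B hBm
  have h1 : condExpVar m ν (B.indicator fun _ => 1) ≤ 0 := by
    refine le_of_forall_pos_le_add fun η hη => ?_
    obtain ⟨_, ⟨l, rfl⟩, hl⟩ := hA.approx B hB (measure_ne_top _ _) (η / 2) (by positivity)
    have h2 : ν.real (B ∆ A l) < η / 2 := ENNReal.toReal_lt_of_lt_ofReal hl
    linarith [condExpVar_indicator_le (ν := ν) hm hB (hA.measurable _ ⟨l, rfl⟩), h l]
  have hL := memLp_indicator_one (ν := ν) hB
  -- For B in `m` the conditional expectation is 1_B, whose variance is ν(B)(1 - ν(B)).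
  rw [condExpVar, condExp_of_stronglyMeasurable hm (stronglyMeasurable_const.indicator hBm)
    (hL.integrable (by norm_num)), variance_eq_sub hL] at h1
  have h3 : ((B.indicator fun _ => (1 : ℝ)) ^ 2) = B.indicator fun _ => 1 := by
    ext z
    by_cases hz : z ∈ B <;> simp [hz]
  rw [h3, integral_indicator hB, setIntegral_const, smul_eq_mul, mul_one] at h1
  have h4 : ν.real B * (1 - ν.real B) ≤ 0 := by linarith
  have h5 : 0 ≤ ν.real B := measureReal_nonneg
  have h6 : ν.real B ≤ 1 := measureReal_le_one
  rcases h5.eq_or_lt with h7 | h7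
  · exact .inl ((measureReal_eq_zero_iff).1 h7.symm)
  · refine .inr ((measureReal_eq_zero_iff).1 ?_)
    rw [measureReal_compl hB, probReal_univ]
    nlinarith

end RigidFactors

/-! ### The dense Gδ set. -/

section Genericity

open ProbabilityTheory

variable {X : Type*} [mX : MeasurableSpace X] {μ : Measure X} [IsProbabilityMeasure μ]

/-- All factors of `R` independent of the base have conditional expectations of `C` of variance
at most `c`. -/
def HasSmallFactors (C : Set (X × X)) (c : ℝ) (R : MPAut (μ.prod μ)) : Prop :=
  ∀ m : MeasurableSpace (X × X), IsFactor m R →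
    Indep m (MeasurableSpace.comap Prod.fst mX) (μ.prod μ) →
    condExpVar m (μ.prod μ) (C.indicator fun _ => 1) ≤ c

/-- Automorphisms near a conjugate of an automorphism with tame sets have small factors. -/
theorem exists_hasSmallFactors_of_halmosDist_lt {A : ℕ → Set (X × X)}
    (hA : (μ.prod μ).MeasureDense (Set.range A)) {R₀ Ψ : MPAut (μ.prod μ)}
    (htame : ∀ s : Set (X × X), MeasurableSet s → IsTame R₀ (s.indicator fun _ => 1))
    (hΨ : ∀ z, (Ψ z).1 = z.1) {C : Set (X × X)} (hC : MeasurableSet C) {c : ℝ} (hc : 0 < c) :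
    ∃ δ > 0, ∀ R : MPAut (μ.prod μ), halmosDist A R (Ψ.inv.comp (R₀.comp Ψ)) < δ →
      HasSmallFactors C c R := by
  set Q := Ψ.inv.comp (R₀.comp Ψ) with hQ
  -- 1_C ∘ Qⁱ is the indicator of Ψ C composed with R₀ⁱ Ψ, so tameness is used for Ψ C. Both errors
  -- enter doubled: 2 · c/4 + 2 · c/4 = c.
  obtain ⟨N, hN, hN0⟩ := ((htame _ (Ψ.inv.measurable hC) (c / 4) (by positivity)).and
    (eventually_gt_atTop 0)).exists
  choose δ hδ hδQ using fun i => exists_measureReal_iterate_preimage_symmDiff_lt hA Q hC i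
    (show 0 < c / 4 by positivity)
  obtain ⟨d, hd, hd0⟩ : ∃ d : ℝ, (∀ i ∈ Finset.range N, d < δ i) ∧ 0 < d :=
    (((Finset.range N).eventually_all.2 fun i _ => nhdsWithin_le_nhds (Iio_mem_nhds (hδ i))).and
      (self_mem_nhdsWithin : Set.Ioi (0 : ℝ) ∈ 𝓝[>] 0)).exists
  have hiter : ∀ i z, (Q : X × X → X × X)^[i] z =
      Ψ.inv ((R₀ : X × X → X × X)^[i] (Ψ z)) := by
    intro i z
    induction i with
    | zero => simp
    | succ i ih =>
      rw [Function.iterate_succ_apply', ih, Function.iterate_succ_apply']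
      simp [hQ]
  have h5 : ∀ i, (((Q : X × X → X × X)^[i] ⁻¹' C).indicator fun _ => (1 : ℝ)) =
      fun z => (Ψ.inv ⁻¹' C).indicator (fun _ => 1) ((R₀ : X × X → X × X)^[i] (Ψ z)) := by
    intro i
    have h : (Q : X × X → X × X)^[i] ⁻¹' C =
        (fun z => (R₀ : X × X → X × X)^[i] (Ψ z)) ⁻¹' (Ψ.inv ⁻¹' C) := by
      ext z
      rw [Set.mem_preimage, hiter]
      rfl
    rw [h]
    rfl
  have hN' : (N : ℝ) ≠ 0 := by positivity
  refine ⟨d, hd0, fun R hRQ m hm hi => ?_⟩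
  have h8 := hN Ψ hΨ m hm.le hi
  simp only [← h5] at h8
  have h1 : ∀ i ∈ Finset.range N, condExpVar m (μ.prod μ) (C.indicator fun _ => 1) ≤
      2 * condExpVar m (μ.prod μ)
        (((Q : X × X → X × X)^[i] ⁻¹' C).indicator fun _ => 1) + c / 2 := by
    intro i hiN
    linarith [hδQ i R (hRQ.trans (hd i hiN)), hm.condExpVar_indicator_le Q hC i]
  have h6 := Finset.sum_le_sum h1
  rw [Finset.sum_const, Finset.card_range, nsmul_eq_mul, Finset.sum_add_distrib, ← Finset.mul_sum,
    Finset.sum_const, Finset.card_range, nsmul_eq_mul] at h6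
  have h7 := mul_le_mul_of_nonneg_left h6 (inv_nonneg.2 (Nat.cast_nonneg (α := ℝ) N))
  rw [inv_mul_cancel_left₀ hN', mul_add, inv_mul_cancel_left₀ hN'] at h7
  linarith

/-- A mildly mixing automorphism of a space with an atom lives on a one-point space. -/
theorem IsMildlyMixing.measure_compl_singleton_eq_zero [MeasurableSingletonClass X] {S : MPAut μ}
    (hS : IsMildlyMixing S) {x : X} (hx : μ {x} ≠ 0) : μ {x}ᶜ = 0 := by
  -- By Poincaré recurrence an atom is a periodic point, hence a rigid set along the multiples of
  -- its period.
  obtain ⟨y, hy, p, hp, hpx⟩ := S.measurePreserving.conservative.exists_mem_iterate_mem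
    (measurableSet_singleton x).nullMeasurableSet hx
  rw [Set.mem_singleton_iff] at hy hpx
  subst hy
  refine (hS.trivial_of_rigid (n := fun k => p * (k + 1)) ?_ (measurableSet_singleton y)
    ?_).resolve_left hx
  · refine tendsto_atTop_mono (fun k => ?_) tendsto_id
    have : 1 ≤ p := Nat.one_le_iff_ne_zero.2 hp
    simp only [id]; nlinarith
  · have h1 : ∀ k, ((S : X → X)^[p * (k + 1)]) ⁻¹' {y} = {y} := by
      intro k
      have h2 : ((S : X → X)^[p * (k + 1)]) y = y := by
        rw [Function.iterate_mul]
        exact Function.iterate_fixed hpx _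
      ext z
      simp only [Set.mem_preimage, Set.mem_singleton_iff]
      exact ⟨fun hz => S.toEquiv.injective.iterate _ (hz.trans h2.symm), fun hz => hz ▸ h2⟩
    simp [h1]

theorem isMildlyMixing_of_measure_compl_singleton_eq_zero {Z : Type*} {mZ : MeasurableSpace Z}
    {ν : Measure Z} (T : MPAut ν) {z : Z} (hz : ν {z}ᶜ = 0) : IsMildlyMixing T := by
  intro m _ _ B _
  by_cases h : z ∈ B
  · exact .inr (measure_mono_null (Set.compl_subset_compl.2 (Set.singleton_subset_iff.2 h)) hz)
  · exact .inl (measure_mono_null (Set.subset_compl_singleton_iff.2 h) hz)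

end Genericity

theorem mainTheorem6 {X : Type*} [MeasurableSpace X] [StandardBorelSpace X]
    (μ : Measure X) [IsProbabilityMeasure μ]
    (A : ℕ → Set (X × X)) (hA : (μ.prod μ).MeasureDense (Set.range A))
    (S : MPAut μ) (hS : IsMildlyMixing S) :
    IsGenericExtProperty A S (fun R => IsMildlyMixing R) := by
  let := halmosPseudoMetric (μ.prod μ) A
  -- With an atom, the base and hence the product is one point up to null sets, and every extension
  -- is mildly mixing.
  by_cases hatom : ∃ x, μ {x} ≠ 0
  · obtain ⟨x, hx⟩ := hatom
    have h1 := hS.measure_compl_singleton_eq_zero hx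
    refine ⟨Set.univ, IsGδ.univ, dense_univ, fun R _ =>
      isMildlyMixing_of_measure_compl_singleton_eq_zero R.1 (z := (x, x)) ?_⟩
    refine measure_mono_null (t := {x}ᶜ ×ˢ Set.univ ∪ Set.univ ×ˢ {x}ᶜ) (fun z hz => ?_)
      (measure_union_null (by simp [h1]) (by simp [h1]))
    by_contra hcon
    simp only [Set.mem_union, Set.mem_prod, Set.mem_compl_iff, Set.mem_singleton_iff, Set.mem_univ,
      and_true, true_and, not_or, not_not] at hcon
    exact hz (Prod.ext hcon.1 hcon.2)
  push Not at hatom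
  have : NullSingletonClass μ := ⟨hatom⟩
  obtain ⟨R₀, hR₀, htame⟩ := exists_tame_extension hS
  -- Taking interiors makes the sets open; each contains all conjugates of R₀ because smallness
  -- holds on a neighbourhood of each conjugate.
  let W : ℕ × ℕ → Set (ExtensionsOf S) := fun p =>
    interior {R | HasSmallFactors (A p.1) (1 / ((p.2 : ℝ) + 1)) R.1}
  refine ⟨⋂ p, W p, .iInter_of_isOpen fun p => isOpen_interior, ?_, fun R hR => ?_⟩
  · refine Metric.dense_iff.2 fun R r hr => ?_
    obtain ⟨Ψ, hΨ, hdist⟩ := exists_conjugate_halmosDist_lt hS.ergodic hR₀ A R.2 hr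
    have hQ : Ψ.inv.comp (R₀.comp Ψ) ∈ ExtensionsOf S := ae_of_all _ fun z => by
      have h1 : ∀ z, (Ψ.inv z).1 = z.1 := fun z => by
        conv_rhs => rw [← Ψ.self_apply_inv z, hΨ]
      rw [MPAut.comp_apply, MPAut.comp_apply, h1, hR₀, hΨ]
    refine ⟨⟨_, hQ⟩, hdist, Set.mem_iInter.2 fun p => mem_interior_iff_mem_nhds.2 ?_⟩
    obtain ⟨δ, hδ, hδR⟩ := exists_hasSmallFactors_of_halmosDist_lt hA htame hΨ
      (hA.measurable _ ⟨p.1, rfl⟩) (c := 1 / ((p.2 : ℝ) + 1)) (by positivity)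
    exact Metric.mem_nhds_iff.2 ⟨δ, hδ, fun R' hR' => hδR R'.1 hR'⟩
  · intro m hm hrig
    have hi := hS.indep_of_isRigidOn R.2 hm hrig
    refine isTrivialFactor_of_condExpVar_eq_zero hm.le hA fun l => ?_
    refine ge_of_tendsto' tendsto_one_div_add_atTop_nhds_zero_nat fun j => ?_
    exact interior_subset (Set.mem_iInter.1 hR (l, j)) m hm hi
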